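/- Fix integers $k\ge 3$ and $r\ge 1$. For each $n$ (large enough) let $v_1,\dots,v_r\in\mathbb R^n$ be orthonormal, let $\beta_1,\dots,\beta_r$ be non-zero reals with $|\beta_j|\le|\beta_1|$ for all $j$ (the $v_j$, $\beta_j$ may depend on $n$), and observe the tensor $$X=\sum_{j=1}^r\beta_j v_j^{\otimes k}+Z\in\otimes^k\mathbb R^n ,$$ where $Z$ has i.i.d. $N(0,1/n)$ entries. Let $u$ be uniformly distributed on the unit sphere of $\mathbb R^n$, independent of $Z$, and run the power iteration $u_0=u$, $u_{t+1}=X[u_t^{\otimes(k-1)}]/\|X[u_t^{\otimes(k-1)}]\|$, where $X[\eta]_i=\sum_{i_1,\dots,i_{k-1}}X_{i i_1\dots i_{k-1}}\eta_{i_1\dots i_{k-1}}$. Let $\kappa\ge1$ and $\varepsilon>0$ be constants, suppose that $|\beta_1|\ge n^{(k-2)/2+\varepsilon}$ for all large $n$, and let $T=T_n$ be integers such that, for all large $n$, $$T\ge 1+\frac1\varepsilon\Big(\frac12+\frac{2\log|\beta_1|}{\log n}\Big)+\frac{\log\log(\sqrt n|\beta_1|)}{\log(k-1)},\qquad T\ge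 3+\frac{\log\kappa+\log\log(\sqrt n|\beta_1|)}{\log(k-1)}$$ (the second bound follows from the first when $\varepsilon\log\kappa\le(k-\tfrac32)\log(k-1)$, that is, when $\varepsilon$ is small enough for the given $\kappa$). Put $\widehat v=u_T$ and $\widehat\beta=\langle X,\widehat v^{\otimes k}\rangle$. Let $\alpha\in(0,1)$ and $z_\alpha=\Phi^{-1}(1-\alpha/2)$, where $\Phi$ is the standard Gaussian distribution function. For $1\le i\le r$ let $G_i$ be the event that $1/\kappa\le|\langle u,v_j\rangle/\langle u,v_l\rangle|\le\kappa$ for all $j,l$ and $|\beta_j\langle u,v_j\rangle^{k-2}|\le(1-1/\kappa)|\beta_i\langle u,v_i\rangle^{k-2}|$ for all $j\ne i$, and let $$p_i=\int_0^\infty\sqrt{\tfrac2\pi}\,e^{-x^2/2}\prod_{\ell\ne i}\Big(\int_0^{(|\beta_i|/|\beta_\ell|)^{1/(k-2)}x}\sqrt{\tfrac2\pi}\,e^{-y^2/2}\,dy\Big)dx .$$ Say that random sets $I_n$ are *asymptotic $(1-\alpha)$-confidence sets for $\theta_n$ on events $G_n$* if $\mathbb P(G_n,\ \theta_n\in I_n)-(1-\alpha)\,\mathbb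 P(G_n)\to0$ (if $\mathbb P(G_n)$ stays away from $0$, this means that the conditional coverage probability given $G_n$ tends to $1-\alpha$). There is a constant $C>0$ depending only on $k$ and $r$ such that the following holds for each fixed $i$. (1) Let $k$ be odd and $\beta_i>0$ for all large $n$. Then $|\mathbb P(G_i)-p_i|\le C/\sqrt\kappa$ for all large $n$. On the events $G_i$, the interval $$\Big[\widehat\beta+\frac{k/2-1}{\widehat\beta}-\frac{z_\alpha}{\sqrt n},\ \ \widehat\beta+\frac{k/2-1}{\widehat\beta}+\frac{z_\alpha}{\sqrt n}\Big]$$ is an asymptotic $(1-\alpha)$-confidence interval for $\beta_i$; and for all unit vectors $a=a_n\in\mathbb R^n$ with $|\beta_1|\,\|a-\langle a,v_i\rangle v_i\|\to\infty$, the interval with end points $$\frac1{1-1/(2\widehat\beta^2)}\Big[\langle a,\widehat v\rangle\mp z_\alpha\frac{\sqrt{\langle a,(I_n-\widehat v\widehat v^\top)a\rangle}}{\sqrt n\,\widehat\beta}\Big]$$ is an asymptotic $(1-\alpha)$-confidence interval for $\langle a,v_i\rangle$. (2) If $k$ is odd and $\beta_i<0$ for all large $n$, the same holds with $(\beta_i,v_i)$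 replaced by $(-\beta_i,-v_i)$ as the estimated pair. (3) If $k$ is even and $\beta_i>0$ for all large $n$, then for each sign $\sigma\in\{1,-1\}$ the same holds on the event $G_i\cap\{\sigma\langle u,v_i\rangle>0\}$, whose probability differs from $p_i/2$ by at most $C/\sqrt\kappa$ for all large $n$, with $(\beta_i,\sigma v_i)$ as the estimated pair. (4) If $k$ is even and $\beta_i<0$ for all large $n$, then for each sign $\sigma\in\{1,-1\}$ the same holds on the event $G_i\cap\{\sigma\langle u,v_i\rangle>0\}$, whose probability differs from $p_i/2$ by at most $C/\sqrt\kappa$ for all large $n$, with $(\beta_i,(-1)^T\sigma v_i)$ as the estimated pair. -/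

import Mathlib

open MeasureTheory ProbabilityTheory Filter Topology
open scoped NNReal ENNReal RealInnerProductSpace

noncomputable section

namespace SpikedTensor

/-- `k`-th order tensors over `ℝⁿ`, as arrays of `n ^ k` real entries. -/
abbrev Tensor (n k : ℕ) : Type := (Fin k → Fin n) → ℝ

/-- The tensor power `u^{⊗k}`. -/
def tensorPow {n : ℕ} (u : EuclideanSpace ℝ (Fin n)) (k : ℕ) : Tensor n k :=
  fun I => ∏ s, u (I s)

/-- The inner product of two tensors: the sum of the products of their entries. -/
def tensorInner {n k : ℕ} (τ η : Tensor n k) : ℝ := ∑ I, τ I * η I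

/-- The action `τ[η] ∈ ℝⁿ` of a `k`-th order tensor on a `(k-1)`-th order tensor:
`τ[η](i) = ∑_{i₁,…,i_{k-1}} τ_{i i₁ … i_{k-1}} η_{i₁ … i_{k-1}}`. -/
def act {n k : ℕ} [NeZero k] (τ : Tensor n k) (η : Tensor n (k - 1)) :
    EuclideanSpace ℝ (Fin n) :=
  WithLp.toLp 2 fun i =>
    ∑ I : Fin k → Fin n with I 0 = i, τ I * η fun s => I ⟨s.1 + 1, by have := s.2; omega⟩

/-- The observation `X = ∑_j β_j v_j^{⊗k} + Z`. -/
def observation {n k r : ℕ} (β : Fin r → ℝ) (v : Fin r → EuclideanSpace ℝ (Fin n))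
    (Z : Tensor n k) : Tensor n k :=
  fun I => ∑ j, β j * tensorPow (v j) k I + Z I

/-- The power iteration `u_0 = u`, `u_{t+1} = X[u_t^{⊗(k-1)}] / ‖X[u_t^{⊗(k-1)}]‖`. -/
def powerIter {n k : ℕ} [NeZero k] (X : Tensor n k) (u : EuclideanSpace ℝ (Fin n)) :
    ℕ → EuclideanSpace ℝ (Fin n)
  | 0 => u
  | t + 1 =>
      ‖act X (tensorPow (powerIter X u t) (k - 1))‖⁻¹ •
        act X (tensorPow (powerIter X u t) (k - 1))

/-- The estimator `β̂ = X[v̂^{⊗k}] = ⟨X, v̂^{⊗k}⟩`. -/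
def strengthEst {n k : ℕ} (X : Tensor n k) (vhat : EuclideanSpace ℝ (Fin n)) : ℝ :=
  tensorInner X (tensorPow vhat k)

/-- The uniform distribution on the unit sphere of `ℝⁿ` (`n ≥ 1`): normalized surface measure,
seen as a measure on `ℝⁿ`. -/
def uniformSphere (n : ℕ) : Measure (EuclideanSpace ℝ (Fin n)) :=
  (((volume : Measure (EuclideanSpace ℝ (Fin n))).toSphere Set.univ)⁻¹ •
    (volume : Measure (EuclideanSpace ℝ (Fin n))).toSphere).map Subtype.val

/-- The noise tensor `Z` has i.i.d. `N(0, 1/n)` entries, and the initialization `u` is uniformly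
distributed on the unit sphere and independent of the noise. -/
structure IsNoiseAndInit {Ω : Type*} [MeasurableSpace Ω] (P : Measure Ω) {n k : ℕ}
    (Z : Ω → Tensor n k) (u : Ω → EuclideanSpace ℝ (Fin n)) : Prop where
  noise_law : ∀ I, HasLaw (fun ω => Z ω I) (gaussianReal 0 (1 / (n : ℝ≥0))) P
  noise_indep : iIndepFun (fun I ω => Z ω I) P
  init_law : HasLaw u (uniformSphere n) P
  init_indep : IndepFun u Z P

/-- The mixture weight
`p_i = ∫₀^∞ √(2/π) e^{-x²/2} ∏_{ℓ≠i} (∫₀^{(|β_i|/|β_ℓ|)^{1/(k-2)} x} √(2/π) e^{-y²/2} dy) dx`,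
the probability that `i` maximizes `j ↦ |β_j ⟨u, v_j⟩^{k-2}|` for `u` uniform on the sphere. -/
def mixtureWeight {r : ℕ} (k : ℕ) (β : Fin r → ℝ) (i : Fin r) : ℝ :=
  ∫ x in Set.Ioi (0 : ℝ), √(2 / Real.pi) * Real.exp (-x ^ 2 / 2) *
    ∏ l ∈ Finset.univ.erase i,
      ∫ y in (0 : ℝ)..((|β i| / |β l|) ^ (1 / ((k : ℝ) - 2)) * x),
        √(2 / Real.pi) * Real.exp (-y ^ 2 / 2)

/-- The initialization `u` selects the index `i` with constant `κ`: the overlaps `⟨u, v_j⟩` are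
comparable up to a factor `κ`, and `i` is the maximizer of `j ↦ |β_j ⟨u, v_j⟩^{k-2}|`, with the
values at all other indices smaller by a factor `1 - 1/κ`. -/
def Selects {n r : ℕ} (k : ℕ) (κ : ℝ) (β : Fin r → ℝ) (v : Fin r → EuclideanSpace ℝ (Fin n))
    (i : Fin r) (u : EuclideanSpace ℝ (Fin n)) : Prop :=
  (∀ j l, 1 / κ ≤ |⟪u, v j⟫ / ⟪u, v l⟫| ∧ |⟪u, v j⟫ / ⟪u, v l⟫| ≤ κ) ∧
    ∀ j, j ≠ i → |β j * ⟪u, v j⟫ ^ (k - 2)| ≤ (1 - 1 / κ) * |β i * ⟪u, v i⟫ ^ (k - 2)|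

/-- The confidence interval for `⟨a, v⟩`, with end points
`(1 - 1/(2β̂²))⁻¹ (⟨a, v̂⟩ ∓ z √⟨a, (I - v̂ v̂ᵀ) a⟩ / (√n β̂))`.
The unordered interval is used because the end points change places when `β̂ < 0`. -/
def linearCI {n : ℕ} (z : ℝ) (a vhat : EuclideanSpace ℝ (Fin n)) (bhat : ℝ) : Set ℝ :=
  Set.uIcc
    (1 / (1 - 1 / (2 * bhat ^ 2)) *
      (⟪a, vhat⟫ - z * (√⟪a, a - ⟪vhat, a⟫ • vhat⟫ / (√n * bhat))))
    (1 / (1 - 1 / (2 * bhat ^ 2)) *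
      (⟪a, vhat⟫ + z * (√⟪a, a - ⟪vhat, a⟫ • vhat⟫ / (√n * bhat))))

/-- The confidence interval `β̂ + (k/2 - 1)/β̂ ± z/√n` for the signal strength. -/
def strengthCI (n k : ℕ) (z bhat : ℝ) : Set ℝ :=
  Set.Icc (bhat + ((k : ℝ) / 2 - 1) / bhat - z / √n)
    (bhat + ((k : ℝ) / 2 - 1) / bhat + z / √n)

/-- On the events `G n`, the random sets `I n` are asymptotic confidence sets of level `1 - α` for
`θ n`: `P(G n, θ n ∈ I n) = (1 - α) P(G n) + o(1)`. Whenever `P(G n)` stays away from `0`, this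
says that the conditional probability of coverage given `G n` tends to `1 - α`. -/
def AsympCovers {Ω : Type*} [MeasurableSpace Ω] (P : Measure Ω) (G : ℕ → Set Ω) (α : ℝ)
    (θ : ℕ → ℝ) (I : ℕ → Ω → Set ℝ) : Prop :=
  Tendsto (fun n => P.real (G n ∩ {ω | θ n ∈ I n ω}) - (1 - α) * P.real (G n)) atTop (𝓝 0)

/-- The assertion about the estimators `v̂ = vhat n`, `β̂ = bhat n` on the events `G n`, when
the limit there is `(b n, w n)`: the event `G n` has probability `q n + O(1/√κ)` with implied
constant `C`; the interval for the strength is an asymptotic confidence interval for `b n`; and,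
for all unit vectors `a n` with `B n * ‖a n - ⟨a n, w n⟩ w n‖ → ∞`, the interval for linear
functionals is an asymptotic confidence interval for `⟨a n, w n⟩`. -/
def IntervalsValid {Ω : Type*} [MeasurableSpace Ω] (P : Measure Ω) (k : ℕ) (C κ α z : ℝ)
    (vhat : (n : ℕ) → Ω → EuclideanSpace ℝ (Fin n)) (bhat : ℕ → Ω → ℝ) (B : ℕ → ℝ)
    (G : ℕ → Set Ω) (q b : ℕ → ℝ) (w : (n : ℕ) → EuclideanSpace ℝ (Fin n)) : Prop :=
  (∀ᶠ n in atTop, |P.real (G n) - q n| ≤ C / √κ) ∧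
  AsympCovers P G α b (fun n ω => strengthCI n k z (bhat n ω)) ∧
  ∀ a : (n : ℕ) → EuclideanSpace ℝ (Fin n), (∀ᶠ n in atTop, ‖a n‖ = 1) →
    Tendsto (fun n => B n * ‖a n - ⟪a n, w n⟫ • w n‖) atTop atTop →
    AsympCovers P G α (fun n => ⟪a n, w n⟫) (fun n ω => linearCI z (a n) (vhat n ω) (bhat n ω))

end SpikedTensor

end

open SpikedTensor

noncomputable section

namespace SpikedTensor

/-! Put `c_t(j) = ⟨u_t, v_j⟩`. Without noise, one step replaces `c(j)` by a common multiple of `β_j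
c(j)^(k-1)`. With `s_j = (|β_j|/|β_i|)^(1/(k-2))`, the rescaled ratio `s_j |c(j)| / |c(i)|` is
therefore raised to the power `k - 1`. Hence the index maximizing `|β_j ⟨u, v_j⟩^(k-2)|` wins doubly
exponentially fast, and which index wins is decided by `u` alone.

The noise has injective norm `O(1)` (`exists_injBound_noiseTensor`), but at the start the overlaps
are only of order `n^(-1/2)` and the signal `β c^(k-1)` may be far below `1`. What matters then is
the noise in the directions `v_j`, which is `O(n^(-1/2))` during any bounded number `τ` of steps,
although `u_t` depends on the noise (`exists_noise_overlap_bound`). Indeed, split the noise into the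
Gaussian part seen by tensors whose first factor is a spike, and the independent rest. Given the
rest, the first `τ` iterates stay in subspaces of bounded dimension, whatever the first part is
(`exists_trajectory_submodule`), and on such subspaces the first part is small. After `τ` steps the
overlap with `v_i` is of constant order and the injective norm suffices. `overlap_bounds` runs both
regimes in one induction.

Once the part of the iterate orthogonal to `v_i` is `O(1/β)`, one more step gives
(`exists_powerStep_expansion`) that this part is `± Z[v_i^{⊗(k-1)}]^⊥ / β + O(1/β²)` and that `β̂ =
±(β + ⟨Z, v_i^{⊗k}⟩) + O(1/β)`. The leading terms are linear in the Gaussian tensor, hence exact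
Gaussian pivots, and they are independent of `u` and so of the event of selection. Since `k ≥ 3`,
`√n / β → 0`, so the errors are smaller than the fluctuations. The squared norm of
`Z[v_i^{⊗(k-1)}]^⊥` concentrates at `1`, so the iterate has overlap `±(1 - 1/(2β²))` with `v_i` up
to smaller terms, which explains the factor in the interval for linear functionals.
`asympCovers_of_pivot` turns these expansions into coverage.

For the probabilities, `u` is a normalized Gaussian vector and selection is invariant under scaling,
so the overlaps may be taken to be i.i.d. Gaussians. The mixture weight is the probability that `i`
is the maximizer, and the margins required by `κ` cost `O(1/√κ)` (`abs_overlapsSelect_sub_le`). -/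

/-! ### The multilinear form of a tensor -/

/-- The multilinear form `(x₁, …, x_k) ↦ ⟨τ, x₁ ⊗ … ⊗ x_k⟩` of a tensor. -/
def mform {n k : ℕ} (τ : Tensor n k) :
    MultilinearMap ℝ (fun _ : Fin k => EuclideanSpace ℝ (Fin n)) ℝ :=
  ∑ I : Fin k → Fin n, τ I • (MultilinearMap.mkPiAlgebra ℝ (Fin k) ℝ).compLinearMap
    (fun s => (EuclideanSpace.proj (I s) : EuclideanSpace ℝ (Fin n) →L[ℝ] ℝ).toLinearMap)

theorem mform_apply {n k : ℕ} (τ : Tensor n k) (x : Fin k → EuclideanSpace ℝ (Fin n)) :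
    mform τ x = ∑ I, τ I * ∏ s, x s (I s) := by
  simp [mform]

theorem mform_add {n k : ℕ} (τ η : Tensor n k) (x : Fin k → EuclideanSpace ℝ (Fin n)) :
    mform (τ + η) x = mform τ x + mform η x := by
  simp [mform_apply, add_mul, Finset.sum_add_distrib]

theorem mform_tensorPow {n k : ℕ} (v : EuclideanSpace ℝ (Fin n))
    (x : Fin k → EuclideanSpace ℝ (Fin n)) : mform (tensorPow v k) x = ∏ s, ⟪x s, v⟫ := by
  simp only [mform_apply, tensorPow, PiLp.inner_apply, ← Finset.prod_mul_distrib]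
  rw [Finset.prod_univ_sum]
  simp

theorem mform_observation {n k r : ℕ} (β : Fin r → ℝ) (v : Fin r → EuclideanSpace ℝ (Fin n))
    (Z : Tensor n k) (x : Fin k → EuclideanSpace ℝ (Fin n)) :
    mform (observation β v Z) x = ∑ j, β j * ∏ s, ⟪x s, v j⟫ + mform Z x := by
  simp_rw [← mform_tensorPow]
  simp only [mform_apply, observation, add_mul, Finset.sum_add_distrib, Finset.sum_mul,
    Finset.mul_sum]
  rw [Finset.sum_comm]
  simp only [mul_assoc]

theorem strengthEst_eq_mform {n k : ℕ} (X : Tensor n k) (x : EuclideanSpace ℝ (Fin n)) :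
    strengthEst X x = mform X fun _ => x := by
  simp [strengthEst, tensorInner, tensorPow, mform_apply]

theorem prod_update_zero {k : ℕ} [NeZero k] {A : Type*} (f : Fin k → A → ℝ) (w x : A) :
    ∏ s, f s (Function.update (fun _ => x) 0 w s) =
      f 0 w * ∏ s : Fin (k - 1), f ⟨s.1 + 1, by have := s.2; omega⟩ x := by
  obtain ⟨m, rfl⟩ : ∃ m, k = m + 1 := ⟨k - 1, by have := NeZero.pos k; omega⟩
  rw [Fin.prod_univ_succ]
  congr 1

/-- Slot `0` is the one left free by `act`, so pairing with `w` fills it. Every estimate on the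
vector `act` thereby becomes one on the multilinear form. -/
theorem inner_act {n k : ℕ} [NeZero k] (X : Tensor n k) (w x : EuclideanSpace ℝ (Fin n)) :
    ⟪w, act X (tensorPow x (k - 1))⟫ = mform X (Function.update (fun _ => x) 0 w) := by
  rw [mform_apply]
  simp_rw [fun I : Fin k → Fin n => prod_update_zero (fun s (y : EuclideanSpace ℝ (Fin n)) =>
    y (I s)) w x]
  rw [PiLp.inner_apply, ← Finset.sum_fiberwise Finset.univ (fun I : Fin k → Fin n => I 0)]
  refine Finset.sum_congr rfl fun i _ => ?_
  simp only [act, tensorPow, RCLike.inner_apply, conj_trivial, Finset.sum_mul]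
  refine Finset.sum_congr rfl fun I hI => ?_
  rw [← (Finset.mem_filter.1 hI).2]
  ring

theorem prod_inner_update {n k : ℕ} [NeZero k] (v w x : EuclideanSpace ℝ (Fin n)) :
    ∏ s : Fin k, ⟪Function.update (fun _ => x) 0 w s, v⟫ = ⟪w, v⟫ * ⟪x, v⟫ ^ (k - 1) := by
  rw [prod_update_zero (fun _ (y : EuclideanSpace ℝ (Fin n)) => ⟪y, v⟫) w x]
  simp

theorem inner_act_observation {n k r : ℕ} [NeZero k] (β : Fin r → ℝ)
    (v : Fin r → EuclideanSpace ℝ (Fin n)) (Z : Tensor n k) (w x : EuclideanSpace ℝ (Fin n)) :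
    ⟪w, act (observation β v Z) (tensorPow x (k - 1))⟫ =
      ∑ j, β j * (⟪w, v j⟫ * ⟪x, v j⟫ ^ (k - 1)) + ⟪w, act Z (tensorPow x (k - 1))⟫ := by
  rw [inner_act, mform_observation, inner_act]
  simp_rw [prod_inner_update]

theorem act_observation {n k r : ℕ} [NeZero k] (β : Fin r → ℝ)
    (v : Fin r → EuclideanSpace ℝ (Fin n)) (Z : Tensor n k) (x : EuclideanSpace ℝ (Fin n)) :
    act (observation β v Z) (tensorPow x (k - 1)) =
      ∑ j, (β j * ⟪x, v j⟫ ^ (k - 1)) • v j + act Z (tensorPow x (k - 1)) := by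
  refine ext_inner_left ℝ fun w => ?_
  rw [inner_act_observation, inner_add_right, inner_sum]
  simp_rw [inner_smul_right]
  congr 1
  exact Finset.sum_congr rfl fun j _ => by ring

/-- The injective norm of `Z` is at most `L`. -/
def InjBound {n k : ℕ} (Z : Tensor n k) (L : ℝ) : Prop :=
  ∀ x : Fin k → EuclideanSpace ℝ (Fin n), |mform Z x| ≤ L * ∏ s, ‖x s‖

/-- Duality: test the form with `act` itself in the free slot. -/
theorem InjBound.norm_act_le {n k : ℕ} [NeZero k] {Z : Tensor n k} {L : ℝ} (hL : 0 ≤ L)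
    (h : InjBound Z L) {x : EuclideanSpace ℝ (Fin n)} (hx : ‖x‖ ≤ 1) :
    ‖act Z (tensorPow x (k - 1))‖ ≤ L := by
  set y := act Z (tensorPow x (k - 1)) with hy
  have h1 := h (Function.update (fun _ => x) 0 y)
  rw [← inner_act, ← hy, real_inner_self_eq_norm_sq,
    prod_update_zero (fun _ (y : EuclideanSpace ℝ (Fin n)) => ‖y‖) y x] at h1
  simp only [Finset.prod_const, Finset.card_univ, Fintype.card_fin] at h1
  rw [abs_of_nonneg (by positivity)] at h1
  have h2 : ‖x‖ ^ (k - 1) ≤ 1 := pow_le_one₀ (norm_nonneg _) hx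
  by_contra! hlt
  have : ‖y‖ ^ 2 ≤ L * ‖y‖ := h1.trans (by
    have : 0 ≤ L * ‖y‖ := by positivity
    nlinarith)
  nlinarith [norm_nonneg y]

/-- The slots are exchanged one at a time, each exchange costing `L * d`. -/
theorem InjBound.abs_sub_le {n k : ℕ} {Z : Tensor n k} {L : ℝ} (hL : 0 ≤ L)
    (h : InjBound Z L) {x y : Fin k → EuclideanSpace ℝ (Fin n)} {d : ℝ} (hd : 0 ≤ d)
    (hx : ∀ s, ‖x s‖ ≤ 1) (hy : ∀ s, ‖y s‖ ≤ 1) (hxy : ∀ s, ‖x s - y s‖ ≤ d) :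
    |mform Z x - mform Z y| ≤ L * k * d := by
  have h1 := (mform Z).norm_image_sub_le_of_bound hL h x y
  have hx' : ‖x‖ ≤ 1 := (pi_norm_le_iff_of_nonneg zero_le_one).2 hx
  have hy' : ‖y‖ ≤ 1 := (pi_norm_le_iff_of_nonneg zero_le_one).2 hy
  have hxy' : ‖x - y‖ ≤ d := (pi_norm_le_iff_of_nonneg hd).2 hxy
  rw [Fintype.card_fin] at h1
  have h2 : max ‖x‖ ‖y‖ ^ (k - 1) ≤ 1 := pow_le_one₀ (by positivity) (max_le hx' hy')
  calc |mform Z x - mform Z y| ≤ _ := h1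
    _ ≤ L * k * 1 * d := by gcongr
    _ = L * k * d := by ring

/-- Duality again, with the normalized difference in the free slot. That slot agrees on both sides,
so the factor `k` is not sharp, but only a bounded constant matters. -/
theorem InjBound.norm_act_sub_le {n k : ℕ} [NeZero k] {Z : Tensor n k} {L : ℝ} (hL : 0 ≤ L)
    (h : InjBound Z L) {x y : EuclideanSpace ℝ (Fin n)} (hx : ‖x‖ ≤ 1) (hy : ‖y‖ ≤ 1) :
    ‖act Z (tensorPow x (k - 1)) - act Z (tensorPow y (k - 1))‖ ≤ L * k * ‖x - y‖ := by
  set d := act Z (tensorPow x (k - 1)) - act Z (tensorPow y (k - 1)) with hd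
  rcases eq_or_ne d 0 with h0 | h0
  · rw [h0, norm_zero]; positivity
  have hn : ‖‖d‖⁻¹ • d‖ ≤ 1 := by
    rw [norm_smul, norm_inv, norm_norm, inv_mul_cancel₀ (norm_ne_zero_iff.2 h0)]
  have h1 : ⟪‖d‖⁻¹ • d, d⟫ = ‖d‖ := by
    rw [real_inner_smul_left, real_inner_self_eq_norm_sq]
    field_simp
  rw [← h1]
  nth_rewrite 2 [hd]
  rw [inner_sub_right, inner_act, inner_act]
  refine (le_abs_self _).trans (h.abs_sub_le hL (norm_nonneg _) ?_ ?_ ?_)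
  · intro s
    rcases eq_or_ne s 0 with rfl | hs
    · simpa using hn
    · simpa [Function.update_of_ne hs] using hx
  · intro s
    rcases eq_or_ne s 0 with rfl | hs
    · simpa using hn
    · simpa [Function.update_of_ne hs] using hy
  · intro s
    rcases eq_or_ne s 0 with rfl | hs
    · simp
    · simp [Function.update_of_ne hs]

/-! ### The overlaps along the power iteration -/

/-- One step of the recursion for the overlaps: if the noise is at most `η` times the signal at
`i`, then the other overlaps grow at most as fast as without noise, up to errors of order `η`. -/
theorem overlap_step {βi βj ci cj νi νj N η B M ρ : ℝ} {p : ℕ} (hB : |cj| ≤ B * |ci|) (hρ : 0 ≤ ρ)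
    (hM : |βj| * |cj| ^ p ≤ ρ * (|βi| * |ci| ^ p))
    (hνi : |νi| ≤ η * (|βi| * |ci| ^ (p + 1))) (hνj : |νj| ≤ η * (|βi| * |ci| ^ (p + 1)))
    (hMB : ρ * B + η ≤ (1 - η) * M) (hM0 : 0 ≤ M) :
    |N⁻¹ * (βj * cj ^ (p + 1) + νj)| ≤ M * |N⁻¹ * (βi * ci ^ (p + 1) + νi)| := by
  have hS : 0 ≤ |βi| * |ci| ^ (p + 1) := by positivity
  set S := |βi| * |ci| ^ (p + 1) with hSdef
  have h1 : (1 - η) * S ≤ |βi * ci ^ (p + 1) + νi| := by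
    have : |βi * ci ^ (p + 1)| = S := by rw [abs_mul, abs_pow]
    have h2 := abs_sub_abs_le_abs_sub (βi * ci ^ (p + 1)) (-νi)
    rw [sub_neg_eq_add, abs_neg, this] at h2
    linarith
  have h3 : |βj * cj ^ (p + 1) + νj| ≤ (ρ * B + η) * S := by
    refine (abs_add_le _ _).trans ?_
    have : |βj * cj ^ (p + 1)| ≤ ρ * B * S := by
      rw [abs_mul, abs_pow, pow_succ, ← mul_assoc]
      calc |βj| * |cj| ^ p * |cj| ≤ (ρ * (|βi| * |ci| ^ p)) * (B * |ci|) := by gcongr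
        _ = ρ * B * S := by rw [hSdef]; ring
    linarith
  rw [abs_mul, abs_mul, mul_left_comm]
  refine mul_le_mul_of_nonneg_left ?_ (abs_nonneg _)
  calc _ ≤ (ρ * B + η) * S := h3
    _ ≤ (1 - η) * M * S := by gcongr
    _ = M * ((1 - η) * S) := by ring
    _ ≤ _ := by gcongr

/-- The bound at time `t` for the rescaled ratio of a competing overlap to the selected one. -/
def ratioBound (p : ℕ) (q0 θ δ : ℝ) (t : ℕ) : ℝ := max (θ * q0 ^ (p + 1) ^ t) δ

/-- Raising the first branch to the power `p + 1` raises `q0 ^ (p + 1) ^ t` to its value at `t + 1`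
and produces surplus factors `θ`; the floor `δ ≤ θ` also gains a factor `θ`. That spare factor
leaves room `1 - θ` for the noise in each step. -/
theorem ratioBound_pow_succ_le {p : ℕ} (hp : 1 ≤ p) {q0 θ δ : ℝ} (hq0 : 0 < q0)
    (hθ : 0 < θ) (hθ1 : θ ≤ 1) (hδ : 0 ≤ δ) (hδθ : δ ≤ θ) (t : ℕ) :
    ratioBound p q0 θ δ t ^ (p + 1) ≤ θ * ratioBound p q0 θ δ (t + 1) := by
  unfold ratioBound
  have hp2 : 2 ≤ p + 1 := by omega
  have hsq : ∀ x : ℝ, 0 ≤ x → x ≤ 1 → x ^ (p + 1) ≤ x * x := fun x h0 h1 => by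
    rw [← sq]; exact pow_le_pow_of_le_one h0 h1 hp2
  rcases le_total (θ * q0 ^ (p + 1) ^ t) δ with h | h
  · rw [max_eq_right h]
    calc δ ^ (p + 1) ≤ δ * δ := hsq _ hδ (hδθ.trans hθ1)
      _ ≤ θ * δ := by gcongr
      _ ≤ _ := by gcongr; exact le_max_right _ _
  · rw [max_eq_left h, mul_pow]
    calc θ ^ (p + 1) * (q0 ^ (p + 1) ^ t) ^ (p + 1)
        ≤ θ * θ * (q0 ^ (p + 1) ^ t) ^ (p + 1) := by gcongr; exact hsq _ hθ.le hθ1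
      _ = θ * (θ * q0 ^ (p + 1) ^ (t + 1)) := by rw [← pow_mul, ← pow_succ (p + 1) t]; ring
      _ ≤ _ := by gcongr; exact le_max_left _ _

/-- Deterministic analysis of the overlaps `c t j` of the power iteration with the spikes. The
noise is at most `ν₀` up to time `τ`, and at most `L` at all times. -/
theorem overlap_bounds {r p τ : ℕ} (hp : 1 ≤ p) (i : Fin r) (β s : Fin r → ℝ)
    (c ν : ℕ → Fin r → ℝ) (nrm : ℕ → ℝ) {κ L ν₀ θ q0 η0 η1 a0 astar G : ℝ}
    (hκ : 1 ≤ κ) (hL : 0 < L) (hβ : β i ≠ 0)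
    (hs0 : ∀ j, 0 ≤ s j) (hsκ : ∀ j, s j ≤ κ) (hs : ∀ j, s j ^ p * |β i| = |β j|)
    (hrec : ∀ t j, c (t + 1) j = (nrm t)⁻¹ * (β j * c t j ^ (p + 1) + ν t j))
    (hnrm : ∀ t, nrm t ≤ ∑ j, |β j| * |c t j| ^ (p + 1) + L)
    (hnrm' : ∀ t, |β i * c t i ^ (p + 1) + ν t i| ≤ nrm t)
    (hνL : ∀ t j, |ν t j| ≤ L) (hν : ∀ t < τ, ∀ j, |ν t j| ≤ ν₀)
    (hθ : 0 < θ) (hθ1 : θ < 1) (hq0 : 0 < q0) (hq1 : q0 ≤ 1)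
    (hinit : ∀ j, |c 0 j| ≤ κ * |c 0 i|)
    (hinit' : ∀ j ≠ i, s j * |c 0 j| ≤ θ * q0 * |c 0 i|)
    (ha0 : 0 < a0) (hc0 : a0 ≤ |c 0 i|) (hastar : astar = 1 / (4 * (κ * r))) (ha0' : a0 ≤ astar)
    (hη0 : ν₀ ≤ η0 * (|β i| * a0 ^ (p + 1))) (hη0nn : 0 ≤ η0)
    (hη1 : η1 = L / (|β i| * astar ^ (p + 1)))
    (hη0θ : η0 ≤ (1 - θ) / 4) (hη1θ : η1 ≤ (1 - θ) / 4)
    (hη0q : κ * η0 ≤ (1 - θ) / 2 * (θ * q0 ^ (p + 1) ^ τ))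
    (hδ : 2 * κ / (1 - θ) * η1 ≤ θ)
    (hG1 : 1 ≤ G) (hG : G * (4 * L) ≤ |β i| * a0 ^ p) (hGτ : astar ≤ G ^ τ * a0) (t : ℕ) :
    (∀ j, |c t j| ≤ κ * |c t i|) ∧
    (∀ j ≠ i, s j * |c t j| ≤ ratioBound p q0 θ (2 * κ / (1 - θ) * η1) t * |c t i|) ∧
    min astar (G ^ t * a0) ≤ |c t i| ∧
    0 < nrm t ∧
    (∀ j, |ν t j| ≤ (if t < τ then η0 else η1) * (|β i| * |c t i| ^ (p + 1))) := by
  set δ := 2 * κ / (1 - θ) * η1 with hδdef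
  set M := ratioBound p q0 θ δ with hM
  have hb : 0 < |β i| := abs_pos.2 hβ
  have hr : (1 : ℝ) ≤ r := by
    have : 0 < r := i.pos
    exact_mod_cast this
  have hκr : 0 < κ * r := by positivity
  have hast : 0 < astar := by rw [hastar]; positivity
  have hη1nn : 0 ≤ η1 := by rw [hη1]; positivity
  have h1θ : 0 < 1 - θ := by linarith
  have hδ0 : 0 ≤ δ := by positivity
  have hMθ : ∀ t, M t ≤ θ := fun t => by
    refine max_le ?_ hδ
    exact mul_le_of_le_one_right hθ.le (pow_le_one₀ hq0.le hq1)
  have hM0 : ∀ t, 0 < M t := fun t => lt_max_of_lt_left (by positivity)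
  have hmin : ∀ t, a0 ≤ min astar (G ^ t * a0) := fun t =>
    le_min ha0' (le_mul_of_one_le_left ha0.le (one_le_pow₀ hG1))
  -- the noise is small compared to the signal
  have hnoise : ∀ t, min astar (G ^ t * a0) ≤ |c t i| →
      ∀ j, |ν t j| ≤ (if t < τ then η0 else η1) * (|β i| * |c t i| ^ (p + 1)) := by
    intro t ht j
    split_ifs with htτ
    · have := (hmin t).trans ht
      calc |ν t j| ≤ ν₀ := hν t htτ j
        _ ≤ _ := hη0
        _ ≤ _ := by gcongr
    -- From time `τ` on, `G ^ t * a0` has passed `astar`, so the lower bound on the overlap is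
    -- `astar` itself.
    · have h1 : astar ≤ |c t i| := by
        refine le_trans (le_min le_rfl (hGτ.trans ?_)) ht
        gcongr
        omega
      calc |ν t j| ≤ L := hνL t j
        _ = η1 * (|β i| * astar ^ (p + 1)) := by rw [hη1]; field_simp
        _ ≤ _ := by gcongr
  have hηle : ∀ t, (if t < τ then η0 else η1) ≤ (1 - θ) / 4 := fun t => by
    split_ifs <;> assumption
  have hηnn : ∀ t, 0 ≤ (if t < τ then η0 else η1) := fun t => by
    split_ifs <;> assumption
  have hlow : ∀ t, min astar (G ^ t * a0) ≤ |c t i| →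
      |β i| * |c t i| ^ (p + 1) / 2 ≤ |β i * c t i ^ (p + 1) + ν t i| := by
    intro t ht
    have h1 := hnoise t ht i
    have h2 := abs_sub_abs_le_abs_sub (β i * c t i ^ (p + 1)) (-ν t i)
    rw [sub_neg_eq_add, abs_neg, abs_mul, abs_pow] at h2
    have h3 := hηle t
    have hS : 0 ≤ |β i| * |c t i| ^ (p + 1) := by positivity
    have : (if t < τ then η0 else η1) * (|β i| * |c t i| ^ (p + 1)) ≤
      1 / 2 * (|β i| * |c t i| ^ (p + 1)) := by
      gcongr; linarith
    linarith
  have hnpos : ∀ t, min astar (G ^ t * a0) ≤ |c t i| → 0 < nrm t := by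
    intro t ht
    have : 0 < |c t i| := ha0.trans_le ((hmin t).trans ht)
    exact lt_of_lt_of_le (by positivity) ((hlow t ht).trans (hnrm' t))
  -- Only these three bounds need induction. The lower bound on `|c t i|` alone controls the
  -- relative noise and makes the normalization positive.
  suffices h : (∀ j, |c t j| ≤ κ * |c t i|) ∧ (∀ j ≠ i, s j * |c t j| ≤ M t * |c t i|) ∧
      min astar (G ^ t * a0) ≤ |c t i| from
    ⟨h.1, h.2.1, h.2.2, hnpos t h.2.2, hnoise t h.2.2⟩
  induction t with
  | zero =>
    refine ⟨hinit, fun j hj => (hinit' j hj).trans ?_, (min_le_right _ _).trans (by simpa using hc0)⟩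
    gcongr
    have : θ * q0 = θ * q0 ^ (p + 1) ^ 0 := by simp
    rw [this]
    exact le_max_left _ _
  | succ t ih =>
    obtain ⟨h1, h2, h3⟩ := ih
    have hcpos : 0 < |c t i| := ha0.trans_le ((hmin t).trans h3)
    have hn := hnpos t h3
    set η := (if t < τ then η0 else η1) with hηdef
    have hη4 : η ≤ (1 - θ) / 4 := hηle t
    have hη0' : 0 ≤ η := hηnn t
    have hηhalf : η ≤ 1 / 2 := by linarith
    have hno : ∀ j, |ν t j| ≤ η * (|β i| * |c t i| ^ (p + 1)) := hnoise t h3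
    -- relative strength of the competing spikes
    have hρ : ∀ j ≠ i, |β j| * |c t j| ^ p ≤ M t ^ p * (|β i| * |c t i| ^ p) := by
      intro j hj
      have := pow_le_pow_left₀ (mul_nonneg (hs0 j) (abs_nonneg _)) (h2 j hj) p
      rw [mul_pow, mul_pow] at this
      rw [← hs j]
      nlinarith
    have hMp : M t ^ p ≤ θ := (pow_le_of_le_one (hM0 t).le ((hMθ t).trans hθ1.le) (by omega)).trans
      (hMθ t)
    have hMsucc : M t ^ (p + 1) ≤ θ * M (t + 1) :=
      ratioBound_pow_succ_le hp hq0 hθ hθ1.le hδ0 hδ t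
    -- The relative noise must stay below the next ratio bound. Before `τ` it is compared with the
    -- smallest value of the first branch up to that time, afterwards with the floor `δ`, which is
    -- defined so that equality holds.
    have hκη : κ * η ≤ (1 - θ) / 2 * M (t + 1) := by
      rw [hηdef]
      split_ifs with ht
      · refine hη0q.trans ?_
        gcongr
        refine le_trans ?_ (le_max_left _ _)
        gcongr θ * ?_
        refine pow_le_pow_of_le_one hq0.le hq1 ?_
        gcongr
        · omega
        · omega
      · have : κ * η1 = (1 - θ) / 2 * δ := by rw [hδdef]; field_simp
        rw [this]
        gcongr
        exact le_max_right _ _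
    refine ⟨fun j => ?_, fun j hj => ?_, ?_⟩
    · rcases eq_or_ne j i with rfl | hj
      · exact le_mul_of_one_le_left (abs_nonneg _) hκ
      rw [hrec, hrec]
      refine overlap_step (h1 j) (pow_nonneg (hM0 t).le p) (hρ j hj) (hno i) (hno j) ?_ (by linarith)
      calc M t ^ p * κ + η ≤ θ * κ + η := by gcongr
        _ ≤ (1 - η) * κ := by nlinarith
    · rw [hrec, hrec]
      rcases (hs0 j).eq_or_lt with h0 | hsj
      · rw [← h0, zero_mul]; exact mul_nonneg (hM0 _).le (abs_nonneg _)
      rw [← le_div_iff₀' hsj, mul_div_right_comm]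
      refine overlap_step (B := M t / s j) ?_ (pow_nonneg (hM0 t).le p) (hρ j hj) (hno i) (hno j) ?_
        (div_nonneg (hM0 _).le hsj.le)
      · rw [div_mul_eq_mul_div, le_div_iff₀' hsj]
        exact h2 j hj
      -- After multiplication by `s j`, the claim is `M t ^ (p + 1) + η * s j ≤ (1 - η) * M (t +
      -- 1)`. It holds since `θ + (1 - θ) / 2 + (1 - θ) / 4 ≤ 1`.
      · rw [← mul_div_assoc, ← mul_div_assoc, div_add' _ _ _ hsj.ne', ← pow_succ]
        gcongr
        have : η * s j ≤ κ * η := by rw [mul_comm]; gcongr; exact hsκ j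
        nlinarith [hM0 (t + 1)]
    · have hnb : nrm t ≤ κ * r * (|β i| * |c t i| ^ (p + 1)) + L := by
        refine (hnrm t).trans ?_
        gcongr
        calc ∑ j, |β j| * |c t j| ^ (p + 1) ≤ ∑ j : Fin r, κ * (|β i| * |c t i| ^ (p + 1)) := by
              refine Finset.sum_le_sum fun j _ => ?_
              rcases eq_or_ne j i with rfl | hj
              · exact le_mul_of_one_le_left (by positivity) hκ
              calc |β j| * |c t j| ^ (p + 1) = |β j| * |c t j| ^ p * |c t j| := by ring
                _ ≤ (1 * (|β i| * |c t i| ^ p)) * (κ * |c t i|) := by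
                  refine mul_le_mul ((hρ j hj).trans ?_) (h1 j) (abs_nonneg _) (by positivity)
                  gcongr
                  linarith
                _ = _ := by ring
          _ = _ := by simp; ring
      have hl := hlow t h3
      rw [hrec, abs_mul, abs_inv, abs_of_pos hn, inv_mul_eq_div, le_div_iff₀ hn]
      set S := |β i| * |c t i| ^ (p + 1) with hS
      have hSpos : 0 < S := by positivity
      have hmpos : 0 ≤ min astar (G ^ (t + 1) * a0) := ha0.le.trans (hmin _)
      refine le_trans ?_ hl
      -- If the signal dominates the norm, the new overlap is at least `(S / 2) / (2 κ r S) =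
      -- astar`. Otherwise the norm is at most `2 L` and the overlap grows by the factor `G`.
      rcases le_total L (κ * r * S) with hcase | hcase
      · calc min astar (G ^ (t + 1) * a0) * nrm t ≤ astar * (2 * (κ * r * S)) := by
              gcongr
              · exact min_le_left _ _
              · linarith
          _ = S / 2 := by rw [hastar]; field_simp; norm_num
      · have h5 : min astar (G ^ (t + 1) * a0) ≤ G * |c t i| := by
          calc min astar (G ^ (t + 1) * a0) ≤ G * min astar (G ^ t * a0) := by
                rw [mul_min_of_nonneg _ _ (by linarith)]
                refine min_le_min (le_mul_of_one_le_left hast.le hG1) (le_of_eq (by ring))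
            _ ≤ _ := by gcongr
        have h6 : a0 ≤ |c t i| := (hmin t).trans h3
        calc min astar (G ^ (t + 1) * a0) * nrm t ≤ (G * |c t i|) * (2 * L) := by
              gcongr; linarith
          _ = G * (4 * L) * |c t i| / 2 := by ring
          _ ≤ |β i| * a0 ^ p * |c t i| / 2 := by gcongr
          _ ≤ |β i| * |c t i| ^ p * |c t i| / 2 := by gcongr
          _ = S / 2 := by rw [hS]; ring

/-! ### The last steps of the power iteration -/

section Rejection

variable {F : Type*} [NormedAddCommGroup F] [InnerProductSpace ℝ F]

/-- The component of `y` orthogonal to the unit vector `v`. -/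
def rej (v y : F) : F := y - ⟪y, v⟫ • v

theorem rej_add (v y z : F) : rej v (y + z) = rej v y + rej v z := by
  simp only [rej, inner_add_left, add_smul]; abel

theorem rej_smul (v : F) (c : ℝ) (y : F) : rej v (c • y) = c • rej v y := by
  simp only [rej, real_inner_smul_left, smul_sub, mul_smul]

theorem rej_self {v : F} (hv : ‖v‖ = 1) : rej v v = 0 := by
  simp [rej, hv]

theorem inner_rej_self {v : F} (hv : ‖v‖ = 1) (y : F) : ⟪rej v y, v⟫ = 0 := by
  simp [rej, inner_sub_left, real_inner_smul_left, hv]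

theorem norm_sq_rej {v : F} (hv : ‖v‖ = 1) (y : F) : ‖rej v y‖ ^ 2 = ‖y‖ ^ 2 - ⟪y, v⟫ ^ 2 := by
  rw [← real_inner_self_eq_norm_sq, ← real_inner_self_eq_norm_sq y]
  simp only [rej, inner_sub_left, inner_sub_right, real_inner_smul_left, real_inner_smul_right,
    real_inner_self_eq_norm_sq v, hv, real_inner_comm y v]
  rw [real_inner_comm v y]
  ring

theorem norm_rej_le {v : F} (hv : ‖v‖ = 1) (y : F) : ‖rej v y‖ ≤ ‖y‖ := by
  refine le_of_sq_le_sq ?_ (norm_nonneg _)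
  rw [norm_sq_rej hv]
  nlinarith [sq_nonneg ⟪y, v⟫]

theorem rej_smul_left {s : ℝ} (hs : s ^ 2 = 1) (v y : F) : rej (s • v) y = rej v y := by
  simp only [rej, real_inner_smul_right, smul_smul]
  rw [show s * ⟪y, v⟫ * s = ⟪y, v⟫ by linear_combination ⟪y, v⟫ * hs]

/-- A unit vector whose component orthogonal to `v` is small is close to `± v`. -/
theorem norm_sub_sign_smul_le {v x : F} (hv : ‖v‖ = 1) (hx : ‖x‖ = 1) {s : ℝ} (hs : s ^ 2 = 1)
    (hsx : 0 ≤ s * ⟪x, v⟫) :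
    1 - ‖rej v x‖ ^ 2 ≤ |⟪x, v⟫| ∧ |⟪x, v⟫| ≤ 1 ∧ s * ⟪x, v⟫ = |⟪x, v⟫| ∧
      ‖x - s • v‖ ≤ 2 * ‖rej v x‖ := by
  have h1 := norm_sq_rej hv x
  rw [hx] at h1
  have h2 : |⟪x, v⟫| ≤ 1 := by
    rw [← sq_le_one_iff_abs_le_one]; nlinarith [sq_nonneg ‖rej v x‖]
  have hs1 : |s| = 1 := by
    have : |s| ^ 2 = 1 := by rw [sq_abs, hs]
    nlinarith [abs_nonneg s]
  have h3 : s * ⟪x, v⟫ = |⟪x, v⟫| := by rw [← abs_of_nonneg hsx, abs_mul, hs1, one_mul]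
  have h4 : 1 - ‖rej v x‖ ^ 2 ≤ |⟪x, v⟫| := by
    have : |⟪x, v⟫| ^ 2 = ⟪x, v⟫ ^ 2 := sq_abs _
    nlinarith [abs_nonneg ⟪x, v⟫]
  refine ⟨h4, h2, h3, ?_⟩
  have h5 : ‖rej v x‖ ≤ 1 := (norm_rej_le hv x).trans hx.le
  have h6 : x - s • v = (⟪x, v⟫ - s) • v + rej v x := by
    simp only [rej, sub_smul]; abel
  rw [h6]
  refine (norm_add_le _ _).trans ?_
  rw [norm_smul, hv, mul_one, Real.norm_eq_abs]
  have h7 : |⟪x, v⟫ - s| = 1 - |⟪x, v⟫| := by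
    have : s * (⟪x, v⟫ - s) = -(1 - |⟪x, v⟫|) := by rw [mul_sub, h3, ← sq, hs]; ring
    have h8 : |s * (⟪x, v⟫ - s)| = 1 - |⟪x, v⟫| := by
      rw [this, abs_neg, abs_of_nonneg (by linarith)]
    rwa [abs_mul, hs1, one_mul] at h8
  rw [h7]
  nlinarith [norm_nonneg (rej v x)]

/-- Normalizing a small perturbation `m v + e` of a multiple of `v`. -/
theorem normalize_perturbation {v e : F} (hv : ‖v‖ = 1) {m E : ℝ} (he : ‖e‖ ≤ E)
    (hm : 2 * E ≤ |m|) (hm0 : m ≠ 0) :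
    |m| / 2 ≤ ‖m • v + e‖ ∧ abs (‖m • v + e‖ - |m|) ≤ E ∧
    ‖‖m • v + e‖⁻¹ • (m • v + e)‖ = 1 ∧
      rej v (‖m • v + e‖⁻¹ • (m • v + e)) = ‖m • v + e‖⁻¹ • rej v e ∧
      ‖rej v (‖m • v + e‖⁻¹ • (m • v + e))‖ ≤ 2 * E / |m| ∧
      0 < m * ⟪‖m • v + e‖⁻¹ • (m • v + e), v⟫ := by
  set y := m • v + e with hy
  have hmpos : 0 < |m| := abs_pos.2 hm0
  have h1 : abs (‖y‖ - |m|) ≤ E := by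
    have := abs_norm_sub_norm_le y (m • v)
    rw [norm_smul, hv, mul_one, Real.norm_eq_abs, hy, add_sub_cancel_left] at this
    exact this.trans he
  have h2 : |m| / 2 ≤ ‖y‖ := by linarith [neg_abs_le (‖y‖ - |m|)]
  have hypos : 0 < ‖y‖ := by linarith
  have h3 : rej v (‖y‖⁻¹ • y) = ‖y‖⁻¹ • rej v e := by
    rw [rej_smul, hy, rej_add, rej_smul, rej_self hv, smul_zero, zero_add]
  refine ⟨h2, h1, ?_, h3, ?_, ?_⟩
  · rw [norm_smul, norm_inv, norm_norm, inv_mul_cancel₀ hypos.ne']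
  · rw [h3, norm_smul, norm_inv, norm_norm, inv_mul_eq_div, div_le_div_iff₀ hypos hmpos]
    have : ‖rej v e‖ ≤ E := (norm_rej_le hv e).trans he
    nlinarith [norm_nonneg (rej v e)]
  · rw [real_inner_smul_left, hy, inner_add_left, real_inner_smul_left,
      real_inner_self_eq_norm_sq, hv, ← hy, mul_left_comm]
    refine mul_pos (inv_pos.2 hypos) ?_
    have h4 : |⟪e, v⟫| ≤ E := by
      refine (abs_real_inner_le_norm e v).trans ?_
      rwa [hv, mul_one]
    have h5 : |m * ⟪e, v⟫| ≤ |m| * (|m| / 2) := by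
      rw [abs_mul]; gcongr; linarith
    have h6 : |m| * |m| = m * m := abs_mul_abs_self m
    nlinarith [neg_abs_le (m * ⟪e, v⟫), mul_pos hmpos hmpos]

end Rejection

/-- One step of the power iteration. -/
def powerStep {n k : ℕ} [NeZero k] (X : Tensor n k) (x : EuclideanSpace ℝ (Fin n)) :
    EuclideanSpace ℝ (Fin n) :=
  ‖act X (tensorPow x (k - 1))‖⁻¹ • act X (tensorPow x (k - 1))

theorem norm_sum_erase_le {n r q : ℕ} {β : Fin r → ℝ} {v : Fin r → EuclideanSpace ℝ (Fin n)}
    (hv : Orthonormal ℝ v) (i : Fin r) {K b d : ℝ} (hd : 0 ≤ d) (hβ : ∀ j, |β j| ≤ K * b)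
    {x : EuclideanSpace ℝ (Fin n)} (hx : ∀ j ≠ i, |⟪x, v j⟫| ≤ d) :
    ‖∑ j ∈ Finset.univ.erase i, (β j * ⟪x, v j⟫ ^ q) • v j‖ ≤ r * (K * b * d ^ q) := by
  have hKb : 0 ≤ K * b := (abs_nonneg _).trans (hβ i)
  refine (norm_sum_le _ _).trans ?_
  calc _ ≤ ∑ j ∈ Finset.univ.erase i, K * b * d ^ q := by
        refine Finset.sum_le_sum fun j hj => ?_
        rw [norm_smul, hv.1 j, mul_one, Real.norm_eq_abs, abs_mul, abs_pow]
        gcongr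
        · exact hβ j
        · exact hx j (Finset.ne_of_mem_erase hj)
    _ ≤ ∑ j : Fin r, K * b * d ^ q :=
        Finset.sum_le_sum_of_subset_of_nonneg (Finset.erase_subset _ _) fun _ _ _ => by positivity
    _ = _ := by simp

theorem act_observation_eq {n k r : ℕ} [NeZero k] (β : Fin r → ℝ)
    (v : Fin r → EuclideanSpace ℝ (Fin n)) (Z : Tensor n k) (i : Fin r)
    (x : EuclideanSpace ℝ (Fin n)) :
    act (observation β v Z) (tensorPow x (k - 1)) = (β i * ⟪x, v i⟫ ^ (k - 1)) • v i +
      (∑ j ∈ Finset.univ.erase i, (β j * ⟪x, v j⟫ ^ (k - 1)) • v j +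
        act Z (tensorPow x (k - 1))) := by
  rw [act_observation, ← Finset.add_sum_erase _ _ (Finset.mem_univ i), add_assoc]

/-- Here `k ≥ 3` enters: overlaps of size `C / b` appear to a power `q ≥ 2`, which beats the
strength `b` of a competing spike and leaves `O(1/b)`. -/
theorem mul_div_pow_le {b C : ℝ} {q : ℕ} (hb : 1 ≤ b) (hC : 0 ≤ C) (hq : 2 ≤ q) :
    b * (C / b) ^ q ≤ C ^ q / b := by
  rw [div_pow, mul_div_assoc', div_le_div_iff₀ (by positivity) (by positivity)]
  have : b ^ 2 ≤ b ^ q := pow_le_pow_right₀ hb hq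
  nlinarith [pow_nonneg hC q]

/-- Once the overlaps with the competing spikes are `O(1/β)`, one more step makes the whole
component orthogonal to the selected spike `O(1/β)`. -/
theorem exists_norm_rej_powerStep_le (k r : ℕ) [NeZero k] (hk : 3 ≤ k) {K L a C₀ : ℝ} (hK : 0 ≤ K)
    (hL : 0 ≤ L) (ha : 0 < a) (hC₀ : 0 ≤ C₀) :
    ∃ C : ℝ, 1 ≤ C ∧ ∀ (n : ℕ) (β : Fin r → ℝ) (v : Fin r → EuclideanSpace ℝ (Fin n))
      (Z : Tensor n k) (i : Fin r) (x : EuclideanSpace ℝ (Fin n)), Orthonormal ℝ v →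
      InjBound Z L → C ≤ |β i| → (∀ j, |β j| ≤ K * |β i|) → ‖x‖ ≤ 1 → a ≤ |⟪x, v i⟫| →
      (∀ j ≠ i, |⟪x, v j⟫| ≤ C₀ / |β i|) →
      ‖powerStep (observation β v Z) x‖ = 1 ∧
        ‖rej (v i) (powerStep (observation β v Z) x)‖ ≤ C / |β i| := by
  set E := r * (K * C₀ ^ (k - 1)) + L with hE
  have hE0 : 0 ≤ E := by positivity
  -- `E` bounds the noise and the competing spikes together. For `|β i|` above this constant the
  -- signal is at least `|β i| * a ^ (k - 1) ≥ 2 * E`, as needed to normalize.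
  refine ⟨2 * E / a ^ (k - 1) + 1, by have : 0 ≤ 2 * E / a ^ (k - 1) := by positivity
                                      linarith, ?_⟩
  intro n β v Z i x hv hZ hb hβ hx hax hxj
  have hb1 : 1 ≤ |β i| := by
    have : 0 ≤ 2 * E / a ^ (k - 1) := by positivity
    linarith
  have hb0 : 0 < |β i| := by linarith
  unfold powerStep
  rw [act_observation_eq β v Z i]
  have he : ‖∑ j ∈ Finset.univ.erase i, (β j * ⟪x, v j⟫ ^ (k - 1)) • v j +
      act Z (tensorPow x (k - 1))‖ ≤ E := by
    refine (norm_add_le _ _).trans (add_le_add ?_ (hZ.norm_act_le hL hx))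
    refine (norm_sum_erase_le hv i (by positivity) hβ hxj).trans ?_
    rw [mul_assoc]
    gcongr
    refine (mul_div_pow_le hb1 hC₀ (by omega)).trans ?_
    exact div_le_self (by positivity) hb1
  have hm : |β i| * a ^ (k - 1) ≤ |β i * ⟪x, v i⟫ ^ (k - 1)| := by
    rw [abs_mul, abs_pow]; gcongr
  have hm0 : 0 < |β i| * a ^ (k - 1) := by positivity
  obtain ⟨-, -, h1, -, h2, -⟩ := normalize_perturbation (hv.1 i) he
    (m := β i * ⟪x, v i⟫ ^ (k - 1)) (le_trans (by
      have : 2 * E / a ^ (k - 1) ≤ |β i| := by linarith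
      rwa [div_le_iff₀ (by positivity)] at this) hm) (abs_pos.1 (hm0.trans_le hm))
  refine ⟨h1, h2.trans ?_⟩
  calc 2 * E / |β i * ⟪x, v i⟫ ^ (k - 1)| ≤ 2 * E / (|β i| * a ^ (k - 1)) := by gcongr
    _ = 2 * E / a ^ (k - 1) / |β i| := by rw [div_div, mul_comm |β i|]
    _ ≤ _ := by gcongr; linarith

theorem act_smul_tensorPow {n k : ℕ} [NeZero k] (Z : Tensor n k) (s : ℝ)
    (x : EuclideanSpace ℝ (Fin n)) :
    act Z (tensorPow (s • x) (k - 1)) = s ^ (k - 1) • act Z (tensorPow x (k - 1)) := by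
  ext j
  simp [act, tensorPow, Finset.prod_mul_distrib, Finset.mul_sum, mul_left_comm]

theorem mul_pos_of_mul_pos {s m c : ℝ} (h₁ : 0 < s * c) (h₂ : 0 < m * c) : 0 < s * m := by
  have h : 0 < s * m * c ^ 2 := by nlinarith [mul_pos h₁ h₂]
  exact pos_of_mul_pos_left h (sq_nonneg c)

/-- Trades the sign of the new overlap divided by `β` for a power of the sign of the old overlap
divided by `|β|`. The expansion of one step naturally produces the latter, while the conclusion uses
the former. -/
theorem sign_div_eq {s w β b m : ℝ} (hs : s ^ 2 = 1) (hw : w ^ 2 = 1) (hβ : β ≠ 0) (hb : b ≠ 0)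
    (hm : m ≠ 0) (h : s * (β * m) = w * (b * m)) : s / β = w / b := by
  rw [div_eq_div_iff hβ hb]
  have h5 : s * β = w * b := mul_right_cancel₀ hm (by linarith)
  calc s * b = w * (w * b) * s := by linear_combination (-s * b) * hw
    _ = w * β := by rw [← h5]; linear_combination (w * β) * hs

theorem abs_eq_one_of_sq {σ : ℝ} (hσ : σ ^ 2 = 1) : |σ| = 1 := by
  have : |σ| ^ 2 = 1 := by rw [sq_abs, hσ]
  nlinarith [abs_nonneg σ]

theorem abs_inner_le_norm_rej {n r : ℕ} {v : Fin r → EuclideanSpace ℝ (Fin n)}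
    (hv : Orthonormal ℝ v) {i j : Fin r} (hj : j ≠ i) (x : EuclideanSpace ℝ (Fin n)) :
    |⟪x, v j⟫| ≤ ‖rej (v i) x‖ := by
  have : ⟪x, v j⟫ = ⟪rej (v i) x, v j⟫ := by
    rw [rej, inner_sub_left, real_inner_smul_left, hv.2 hj.symm, mul_zero, sub_zero]
  rw [this]
  refine (abs_real_inner_le_norm _ _).trans ?_
  rw [hv.1 j, mul_one]

/-- The strength estimator at a point within `O(1/β)` of `± v i`. -/
theorem abs_strengthEst_sub_le {n k r : ℕ} (hk : 3 ≤ k) {K L C₃ : ℝ} (hK : 0 ≤ K)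
    (hL : 0 ≤ L) (hC₃0 : 0 ≤ C₃) {β : Fin r → ℝ} {v : Fin r → EuclideanSpace ℝ (Fin n)}
    {Z : Tensor n k} {i : Fin r} {x' : EuclideanSpace ℝ (Fin n)} {s b : ℝ} (hv : Orthonormal ℝ v)
    (hZ : InjBound Z L) (hbdef : b = |β i|) (hb1 : 1 ≤ b) (hβ : ∀ j, |β j| ≤ K * b)
    (hx' : ‖x'‖ = 1) (hrej' : ‖rej (v i) x'‖ ≤ C₃ / b) (hs : s ^ 2 = 1)
    (hspos : 0 < s * ⟪x', v i⟫) :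
    |strengthEst (observation β v Z) x' - s ^ k * (β i + mform Z fun _ => v i)| ≤
      (k * C₃ ^ 2 + r * (K * C₃ ^ k) + 2 * L * k * C₃) / b := by
  have hb0 : 0 < b := by linarith
  have hvi : ‖v i‖ = 1 := hv.1 i
  have hs1 := abs_eq_one_of_sq hs
  obtain ⟨hc1', hc2', hc3', hc4'⟩ := norm_sub_sign_smul_le hvi hx' hs hspos.le
  have hcj' : ∀ j ≠ i, |⟪x', v j⟫| ≤ C₃ / b := fun j hj =>
    (abs_inner_le_norm_rej hv hj x').trans hrej'
  rw [strengthEst_eq_mform, mform_observation, ← Finset.add_sum_erase _ _ (Finset.mem_univ i)]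
  simp only [Finset.prod_const, Finset.card_univ, Fintype.card_fin]
  have hZs : mform Z (fun _ => s • v i) = s ^ k * mform Z fun _ => v i := by
    have := (mform Z).map_smul_univ (fun _ => s) (fun _ => v i)
    simpa using this
  have g1 : |β i * ⟪x', v i⟫ ^ k - s ^ k * β i| ≤ k * C₃ ^ 2 / b := by
    have h1 : s ^ k * ⟪x', v i⟫ ^ k = |⟪x', v i⟫| ^ k := by rw [← mul_pow, hc3']
    have hss : (s ^ k) ^ 2 = 1 := by rw [← pow_mul, mul_comm, pow_mul, hs, one_pow]
    have h2 : β i * ⟪x', v i⟫ ^ k - s ^ k * β i = s ^ k * β i * (|⟪x', v i⟫| ^ k - 1) := by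
      rw [← h1]; linear_combination (-β i * ⟪x', v i⟫ ^ k) * hss
    rw [h2, abs_mul, abs_mul, abs_pow, hs1, one_pow, one_mul, ← hbdef]
    have h3 : |⟪x', v i⟫| ^ k ≤ 1 := pow_le_one₀ (abs_nonneg _) hc2'
    -- The overlap falls short of `1` only quadratically, so by Bernoulli its `k`-th power loses
    -- `O(1/b²)`, and multiplication by `b` leaves `O(1/b)`.
    have h4 : 1 - k * (C₃ / b) ^ 2 ≤ |⟪x', v i⟫| ^ k := by
      have h5 : 1 - (C₃ / b) ^ 2 ≤ |⟪x', v i⟫| := by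
        refine le_trans ?_ hc1'
        gcongr
      have := one_add_mul_le_pow (a := |⟪x', v i⟫| - 1) (by linarith [abs_nonneg ⟪x', v i⟫]) k
      rw [add_sub_cancel] at this
      refine le_trans ?_ this
      have : (k : ℝ) * (1 - (C₃ / b) ^ 2) ≤ k * |⟪x', v i⟫| := by gcongr
      linarith
    rw [abs_of_nonpos (by linarith)]
    calc b * -(|⟪x', v i⟫| ^ k - 1) ≤ b * (k * (C₃ / b) ^ 2) := by gcongr; linarith
      _ = k * C₃ ^ 2 / b := by field_simp
  have g2 : |∑ j ∈ Finset.univ.erase i, β j * ⟪x', v j⟫ ^ k| ≤ r * (K * C₃ ^ k) / b := by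
    refine (Finset.abs_sum_le_sum_abs _ _).trans ?_
    calc _ ≤ ∑ j ∈ Finset.univ.erase i, K * (C₃ ^ k / b) := by
          refine Finset.sum_le_sum fun j hj => ?_
          rw [abs_mul, abs_pow]
          calc _ ≤ K * b * (C₃ / b) ^ k := by
                gcongr
                · exact hβ j
                · exact hcj' j (Finset.ne_of_mem_erase hj)
            _ = K * (b * (C₃ / b) ^ k) := by ring
            _ ≤ _ := by gcongr; exact mul_div_pow_le hb1 hC₃0 (by omega)
      _ ≤ ∑ j : Fin r, K * (C₃ ^ k / b) :=
          Finset.sum_le_sum_of_subset_of_nonneg (Finset.erase_subset _ _) fun _ _ _ => by positivity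
      _ = _ := by simp; ring
  have g3 : |mform Z (fun _ => x') - s ^ k * mform Z fun _ => v i| ≤ 2 * L * k * C₃ / b := by
    rw [← hZs]
    have h1 : ‖s • v i‖ ≤ 1 := by rw [norm_smul, hvi, Real.norm_eq_abs, hs1, one_mul]
    refine (hZ.abs_sub_le hL (d := 2 * (C₃ / b)) (by positivity) (fun _ => hx'.le) (fun _ => h1)
      fun _ => hc4'.trans (by gcongr)).trans (le_of_eq (by ring))
  calc _ = |(β i * ⟪x', v i⟫ ^ k - s ^ k * β i) +
        (∑ j ∈ Finset.univ.erase i, β j * ⟪x', v j⟫ ^ k) +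
        (mform Z (fun _ => x') - s ^ k * mform Z fun _ => v i)| := by congr 1; ring
    _ ≤ k * C₃ ^ 2 / b + r * (K * C₃ ^ k) / b + 2 * L * k * C₃ / b :=
      (abs_add_le _ _).trans (add_le_add ((abs_add_le _ _).trans (add_le_add g1 g2)) g3)
    _ = (k * C₃ ^ 2 + r * (K * C₃ ^ k) + 2 * L * k * C₃) / b := by ring

/-- There are two errors. Replacing the norm `y` by `b` changes the inverse by `O(1/b²)`, against a
bounded vector. Replacing `e` by `w • ζ` costs `O(1/b)`, against the factor `1/y = O(1/b)`. -/
theorem norm_rej_sub_le {F : Type*} [NormedAddCommGroup F] [InnerProductSpace ℝ F] {v x' e ζ : F}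
    {w y b D E L : ℝ} (hv : ‖v‖ = 1) (hb0 : 0 < b) (hw : |w| = 1) (hζL : ‖ζ‖ ≤ L)
    (he : ‖e - w • ζ‖ ≤ E / b) (hyb : |y - b| ≤ D) (hy0 : b / 2 ≤ y)
    (hx' : rej v x' = y⁻¹ • rej v e) :
    ‖rej v x' - (w / b) • rej v ζ‖ ≤ (2 * D * L + 2 * E) / b ^ 2 := by
  have hypos : 0 < y := by linarith
  have hD : 0 ≤ D := (abs_nonneg _).trans hyb
  have hE : 0 ≤ E / b := (norm_nonneg _).trans he
  have h1 : rej v x' - (w / b) • rej v ζ =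
      (y⁻¹ - b⁻¹) • w • rej v ζ + y⁻¹ • rej v (e - w • ζ) := by
    have : rej v (e - w • ζ) = rej v e - w • rej v ζ := by
      rw [sub_eq_add_neg, ← neg_smul, rej_add, rej_smul, neg_smul, ← sub_eq_add_neg]
    rw [hx', this, div_eq_inv_mul, mul_smul, sub_smul, smul_sub]
    abel
  rw [h1]
  have h2 : |y⁻¹ - b⁻¹| ≤ 2 * D / b ^ 2 := by
    have hyb' : 0 < y * b := mul_pos hypos hb0
    rw [inv_sub_inv hypos.ne' hb0.ne', abs_div, abs_sub_comm, abs_of_pos hyb',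
      div_le_div_iff₀ hyb' (by positivity)]
    calc |y - b| * b ^ 2 ≤ D * b ^ 2 := by gcongr
      _ = 2 * D * (b / 2 * b) := by ring
      _ ≤ 2 * D * (y * b) := by gcongr
  have h3 : y⁻¹ ≤ 2 / b := by
    rw [inv_le_comm₀ hypos (by positivity), inv_div]; exact hy0
  refine (norm_add_le _ _).trans ?_
  rw [norm_smul, norm_smul, norm_smul, Real.norm_eq_abs, Real.norm_eq_abs, Real.norm_eq_abs,
    hw, one_mul, abs_of_pos (inv_pos.2 hypos)]
  have h4 : ‖rej v ζ‖ ≤ L := (norm_rej_le hv _).trans hζL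
  have h5 : ‖rej v (e - w • ζ)‖ ≤ E / b := (norm_rej_le hv _).trans he
  calc _ ≤ 2 * D / b ^ 2 * L + 2 / b * (E / b) := by gcongr
    _ = (2 * D * L + 2 * E) / b ^ 2 := by field_simp

set_option maxHeartbeats 1000000 in
/-- Second-order expansion of the power iteration and of the strength estimator once the
iteration is within `O(1/β)` of `± v i`. -/
theorem exists_powerStep_expansion (k r : ℕ) [NeZero k] (hk : 3 ≤ k) {K L C₁ : ℝ} (hK : 0 ≤ K)
    (hL : 0 ≤ L) (hC₁ : 0 ≤ C₁) :
    ∃ C : ℝ, 1 ≤ C ∧ ∀ (n : ℕ) (β : Fin r → ℝ) (v : Fin r → EuclideanSpace ℝ (Fin n))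
      (Z : Tensor n k) (i : Fin r) (x : EuclideanSpace ℝ (Fin n)) (s : ℝ), Orthonormal ℝ v →
      InjBound Z L → C ≤ |β i| → (∀ j, |β j| ≤ K * |β i|) → ‖x‖ = 1 →
      ‖rej (v i) x‖ ≤ C₁ / |β i| → s ^ 2 = 1 →
      0 < s * ⟪powerStep (observation β v Z) x, v i⟫ →
      ‖powerStep (observation β v Z) x‖ = 1 ∧
      ‖rej (v i) (powerStep (observation β v Z) x)‖ ≤ C / |β i| ∧
      ‖rej (v i) (powerStep (observation β v Z) x) -
        (s / β i) • rej (v i) (act Z (tensorPow (v i) (k - 1)))‖ ≤ C / |β i| ^ 2 ∧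
      |strengthEst (observation β v Z) (powerStep (observation β v Z) x) -
        s ^ k * (β i + mform Z fun _ => v i)| ≤ C / |β i| := by
  -- `E₁` bounds the perturbation `e` of the signal, `E₂ / b` its distance to `± ζ`, `D` the gap
  -- between the norm and `b`, `F / b ^ 2` the error of the expansion, and `C₃ / b` the new
  -- orthogonal component.
  obtain ⟨E₂, hE₂⟩ : ∃ c : ℝ, c = r * (K * C₁ ^ (k - 1)) + 2 * L * k * C₁ := ⟨_, rfl⟩
  obtain ⟨E₁, hE₁⟩ : ∃ c : ℝ, c = r * (K * C₁ ^ (k - 1)) + L := ⟨_, rfl⟩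
  obtain ⟨D, hD⟩ : ∃ c : ℝ, c = E₁ + (k - 1 : ℕ) * C₁ := ⟨_, rfl⟩
  obtain ⟨F, hF⟩ : ∃ c : ℝ, c = 2 * D * L + 2 * E₂ := ⟨_, rfl⟩
  obtain ⟨C₃, hC₃⟩ : ∃ c : ℝ, c = L + F := ⟨_, rfl⟩
  have hE₂0 : 0 ≤ E₂ := by rw [hE₂]; positivity
  have hE₁0 : 0 ≤ E₁ := by rw [hE₁]; positivity
  have hD0 : 0 ≤ D := by rw [hD]; positivity
  have hF0 : 0 ≤ F := by rw [hF]; positivity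
  have hC₃0 : 0 ≤ C₃ := by rw [hC₃]; positivity
  have hC₄0 : 0 ≤ k * C₃ ^ 2 + r * (K * C₃ ^ k) + 2 * L * k * C₃ := by positivity
  refine ⟨1 + F + C₃ + (k * C₃ ^ 2 + r * (K * C₃ ^ k) + 2 * L * k * C₃) + 2 * C₁ + 2 * D + 4 * E₁,
    by linarith, ?_⟩
  intro n β v Z i x s hv hZ hb hβ hx hrej hs hspos
  have hb1 : 1 ≤ |β i| := by linarith
  have hβ0 : β i ≠ 0 := abs_pos.1 (by linarith)
  generalize hbdef : |β i| = b at *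
  replace hbdef := hbdef.symm
  have hb0 : 0 < b := by linarith
  obtain ⟨d, hd⟩ : ∃ d : ℝ, d = C₁ / b := ⟨_, rfl⟩
  rw [← hd] at hrej
  have hd0 : 0 ≤ d := by rw [hd]; positivity
  have hd1 : d ≤ 1 / 2 := by rw [hd, div_le_iff₀ hb0]; linarith
  have hvi : ‖v i‖ = 1 := hv.1 i
  -- the sign of the previous overlap
  obtain ⟨s₀, hs₀, hs₀x⟩ : ∃ s₀ : ℝ, s₀ ^ 2 = 1 ∧ 0 ≤ s₀ * ⟪x, v i⟫ := by
    rcases le_total 0 ⟪x, v i⟫ with h | h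
    · exact ⟨1, by norm_num, by linarith⟩
    · exact ⟨-1, by norm_num, by linarith⟩
  obtain ⟨hc1, hc2, hc3, hc4⟩ := norm_sub_sign_smul_le hvi hx hs₀ hs₀x
  have hs₀1 := abs_eq_one_of_sq hs₀
  have hs1 := abs_eq_one_of_sq hs
  have hcd : 1 - d ≤ |⟪x, v i⟫| := by
    refine le_trans ?_ hc1
    have : ‖rej (v i) x‖ ^ 2 ≤ d := by nlinarith [norm_nonneg (rej (v i) x)]
    linarith
  have hcj : ∀ j ≠ i, |⟪x, v j⟫| ≤ d := fun j hj => (abs_inner_le_norm_rej hv hj x).trans hrej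
  -- decomposition of the unnormalized step
  set ζ := act Z (tensorPow (v i) (k - 1)) with hζ
  set m := β i * ⟪x, v i⟫ ^ (k - 1) with hm
  set e := ∑ j ∈ Finset.univ.erase i, (β j * ⟪x, v j⟫ ^ (k - 1)) • v j +
        act Z (tensorPow x (k - 1)) with he
  have hQ : ‖∑ j ∈ Finset.univ.erase i, (β j * ⟪x, v j⟫ ^ (k - 1)) • v j‖ ≤
      r * (K * C₁ ^ (k - 1)) / b := by
    refine (norm_sum_erase_le hv i hd0 hβ hcj).trans ?_
    rw [hd, mul_div_assoc, mul_assoc, mul_div_assoc]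
    gcongr
    exact mul_div_pow_le hb1 hC₁ (by omega)
  have hζL : ‖ζ‖ ≤ L := hZ.norm_act_le hL hvi.le
  have heE : ‖e‖ ≤ E₁ := by
    rw [hE₁]
    refine (norm_add_le _ _).trans (add_le_add (hQ.trans ?_) (hZ.norm_act_le hL hx.le))
    exact div_le_self (by positivity) hb1
  have he' : ‖e - s₀ ^ (k - 1) • ζ‖ ≤ E₂ / b := by
    rw [hζ, ← act_smul_tensorPow, he, add_sub_assoc]
    have h1 : ‖s₀ • v i‖ ≤ 1 := by rw [norm_smul, hvi, Real.norm_eq_abs, hs₀1, one_mul]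
    have h2 := hZ.norm_act_sub_le hL hx.le h1
    refine (norm_add_le _ _).trans ((add_le_add hQ h2).trans ?_)
    calc _ ≤ r * (K * C₁ ^ (k - 1)) / b + L * k * (2 * d) := by
          gcongr
          exact hc4.trans (by gcongr)
      _ = E₂ / b := by rw [hE₂, hd]; ring
  have hpow : 1 - (k - 1 : ℕ) * d ≤ |⟪x, v i⟫| ^ (k - 1) := by
    have := one_add_mul_le_pow (a := -d) (by linarith) (k - 1)
    calc 1 - (k - 1 : ℕ) * d = 1 + (k - 1 : ℕ) * -d := by ring
      _ ≤ (1 + -d) ^ (k - 1) := this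
      _ ≤ _ := pow_le_pow_left₀ (by linarith) (by linarith) _
  have hmabs : |m| = b * |⟪x, v i⟫| ^ (k - 1) := by rw [hm, abs_mul, abs_pow, hbdef]
  have hm1 : |m| ≤ b := by
    rw [hmabs]; exact mul_le_of_le_one_right hb0.le (pow_le_one₀ (abs_nonneg _) hc2)
  have hm2 : b - (k - 1 : ℕ) * C₁ ≤ |m| := by
    rw [hmabs]
    calc b - (k - 1 : ℕ) * C₁ = b * (1 - (k - 1 : ℕ) * d) := by rw [hd]; field_simp
      _ ≤ _ := by gcongr
  have hmE : 2 * E₁ ≤ |m| := by linarith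
  have hm0 : m ≠ 0 := by
    rw [← abs_pos]
    have : (k - 1 : ℕ) * C₁ ≤ D := by linarith
    linarith
  obtain ⟨hy1, hy2, hy3, hy4, -, hy6⟩ := normalize_perturbation hvi heE hmE hm0
  have hstep : powerStep (observation β v Z) x = ‖m • v i + e‖⁻¹ • (m • v i + e) := by
    unfold powerStep
    rw [act_observation_eq β v Z i]
  rw [← hstep] at hy3 hy4 hy6
  set x' := powerStep (observation β v Z) x with hx'
  set y := ‖m • v i + e‖ with hy
  have hyb : |y - b| ≤ D := by
    rw [abs_le] at hy2 ⊢
    constructor <;> linarith [hy2.1, hy2.2]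
  have hy0 : b / 2 ≤ y := by
    have := (abs_le.1 hyb).1
    linarith
  have hypos : 0 < y := by linarith
  -- the sign of the new overlap
  have hsβ : s / β i = s₀ ^ (k - 1) / b := by
    have hmsign : 0 < s * m := mul_pos_of_mul_pos hspos hy6
    have h1 : s₀ ^ (k - 1) * ⟪x, v i⟫ ^ (k - 1) = |⟪x, v i⟫| ^ (k - 1) := by
      rw [← mul_pow, hc3]
    have h2 : s * m = |m| := by rw [← abs_of_pos hmsign, abs_mul, hs1, one_mul]
    have h3 : |⟪x, v i⟫| ^ (k - 1) ≠ 0 := pow_ne_zero _ (by linarith)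
    have hss : (s₀ ^ (k - 1)) ^ 2 = 1 := by rw [← pow_mul, mul_comm, pow_mul, hs₀, one_pow]
    refine sign_div_eq hs hss hβ0 hb0.ne' h3 ?_
    rw [← hmabs, ← h2, ← h1, hm, mul_left_comm (s₀ ^ (k - 1)) s,
      mul_left_comm (s₀ ^ (k - 1)) (β i)]
  have hw1 : |s₀ ^ (k - 1)| = 1 := by rw [abs_pow, hs₀1, one_pow]
  have hexp : ‖rej (v i) x' - (s / β i) • rej (v i) ζ‖ ≤ F / b ^ 2 := by
    rw [hsβ, hF]
    exact norm_rej_sub_le hvi hb0 hw1 hζL he' hyb hy0 hy4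
  have hrej' : ‖rej (v i) x'‖ ≤ C₃ / b := by
    have h1 : ‖(s / β i) • rej (v i) ζ‖ ≤ L / b := by
      rw [norm_smul, Real.norm_eq_abs, abs_div, hs1, ← hbdef, one_div_mul_eq_div]
      gcongr
      exact (norm_rej_le hvi _).trans hζL
    have h2 : F / b ^ 2 ≤ F / b :=
      div_le_div_of_nonneg_left hF0 hb0 (le_self_pow₀ hb1 two_ne_zero)
    have h3 := norm_add_le (rej (v i) x' - (s / β i) • rej (v i) ζ) ((s / β i) • rej (v i) ζ)
    rw [sub_add_cancel] at h3
    rw [hC₃, add_div]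
    linarith
  refine ⟨hy3, hrej'.trans ?_, hexp.trans ?_,
    (abs_strengthEst_sub_le hk hK hL hC₃0 hv hZ hbdef hb1 hβ hy3 hrej' hs hspos).trans ?_⟩
  · exact div_le_div_of_nonneg_right (by linarith) hb0.le
  · exact div_le_div_of_nonneg_right (by linarith) (by positivity)
  · exact div_le_div_of_nonneg_right (by linarith) hb0.le

/-! ### The confidence intervals -/

theorem mem_strengthCI_iff {n k : ℕ} {z bhat θ : ℝ} :
    θ ∈ strengthCI n k z bhat ↔ |bhat + ((k : ℝ) / 2 - 1) / bhat - θ| ≤ z / √n := by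
  rw [strengthCI, Set.mem_Icc, abs_le]
  constructor <;> rintro ⟨h1, h2⟩ <;> constructor <;> linarith

theorem mem_uIcc_iff_abs_sub_le {c d x : ℝ} : x ∈ Set.uIcc (c - d) (c + d) ↔ |x - c| ≤ |d| := by
  rw [Set.mem_uIcc, abs_le]
  rcases abs_cases d with ⟨h, h'⟩ | ⟨h, h'⟩ <;> rw [h] <;>
  constructor
  · rintro (⟨h1, h2⟩ | ⟨h1, h2⟩) <;> constructor <;> linarith
  · rintro ⟨h1, h2⟩; left; constructor <;> linarith
  · rintro (⟨h1, h2⟩ | ⟨h1, h2⟩) <;> constructor <;> linarith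
  · rintro ⟨h1, h2⟩; right; constructor <;> linarith

theorem inner_sub_smul_eq_norm_rej_sq {F : Type*} [NormedAddCommGroup F] [InnerProductSpace ℝ F]
    {a x : F} (hx : ‖x‖ = 1) : ⟪a, a - ⟪x, a⟫ • x⟫ = ‖rej x a‖ ^ 2 := by
  rw [norm_sq_rej hx, inner_sub_right, real_inner_smul_right, real_inner_self_eq_norm_sq,
    real_inner_comm x a]
  ring

/-- The assumption `1 < |bhat|` makes the debiasing factor positive, so it may be cleared from both
sides. The sign of `bhat` drops out because the interval is unordered. -/
theorem mem_linearCI_iff {n : ℕ} {z bhat θ : ℝ} {a x : EuclideanSpace ℝ (Fin n)} (hx : ‖x‖ = 1)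
    (hz : 0 ≤ z) (hb : 1 < |bhat|) :
    θ ∈ linearCI z a x bhat ↔
      |⟪a, x⟫ - θ * (1 - 1 / (2 * bhat ^ 2))| ≤ z * (‖rej x a‖ / (√n * |bhat|)) := by
  have hb2 : 1 < bhat ^ 2 := by rw [← sq_abs]; nlinarith
  have hγ : 0 < 1 - 1 / (2 * bhat ^ 2) := by
    rw [sub_pos, div_lt_one (by positivity)]; linarith
  rw [linearCI, inner_sub_smul_eq_norm_rej_sq hx, Real.sqrt_sq (norm_nonneg _)]
  set γ := 1 - 1 / (2 * bhat ^ 2) with hγdef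
  rw [mul_sub, mul_add, mem_uIcc_iff_abs_sub_le, abs_mul (1 / γ), abs_mul z, abs_div ‖rej x a‖,
    abs_mul √n, abs_of_nonneg hz, abs_norm, abs_of_nonneg (Real.sqrt_nonneg _),
    abs_of_pos (one_div_pos.2 hγ), one_div_mul_eq_div, one_div_mul_eq_div, le_div_iff₀ hγ]
  have h1 : |θ - ⟪a, x⟫ / γ| * γ = |⟪a, x⟫ - θ * γ| := by
    nth_rewrite 2 [← abs_of_pos hγ]
    rw [← abs_mul, sub_mul, div_mul_cancel₀ _ hγ.ne', abs_sub_comm]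
  rw [h1]

/-- This is `√(1 - q²) = 1 - q²/2 + O(q⁴)`. With `c = √(1 - q²)` the error is exactly `-(1 - c)²/2`,
while `q⁴ = (1 - c)² (1 + c)²`. -/
theorem abs_abs_inner_sub_le {F : Type*} [NormedAddCommGroup F] [InnerProductSpace ℝ F]
    {v x : F} (hv : ‖v‖ = 1) (hx : ‖x‖ = 1) :
    |(|⟪x, v⟫| - (1 - ‖rej v x‖ ^ 2 / 2))| ≤ ‖rej v x‖ ^ 4 := by
  have h1 := norm_sq_rej hv x
  rw [hx] at h1
  have h2 : |⟪x, v⟫| ^ 2 = ⟪x, v⟫ ^ 2 := sq_abs _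
  have h0 : 0 ≤ |⟪x, v⟫| := abs_nonneg _
  generalize |⟪x, v⟫| = c at h0 h2 ⊢
  rw [← h2] at h1
  generalize ‖rej v x‖ = q at h1
  have h3 : c - (1 - q ^ 2 / 2) = -((1 - c) ^ 2 / 2) := by rw [h1]; ring
  have h5 : q ^ 4 = (1 - c) ^ 2 * (1 + c) ^ 2 := by
    rw [show q ^ 4 = (q ^ 2) ^ 2 by ring, h1]; ring
  rw [h3, abs_neg, abs_of_nonneg (by positivity), h5]
  have h6 : 1 ≤ (1 + c) ^ 2 := by nlinarith
  nlinarith [sq_nonneg (1 - c)]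

theorem abs_inv_sq_sub_le {b x D : ℝ} (hb : 0 < b) (hx : b / 2 ≤ x) (hx2 : x ≤ 2 * b)
    (hxb : |x - b| ≤ D) : |1 / (2 * x ^ 2) - 1 / (2 * b ^ 2)| ≤ 6 * D / b ^ 3 := by
  have hx0 : 0 < x := by linarith
  have hD : 0 ≤ D := (abs_nonneg _).trans hxb
  have h1 : 1 / (2 * x ^ 2) - 1 / (2 * b ^ 2) = (b - x) * (b + x) / (2 * (x ^ 2 * b ^ 2)) := by
    field_simp
    ring
  have hpos : 0 < 2 * (x ^ 2 * b ^ 2) := by positivity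
  rw [h1, abs_div, abs_mul, abs_sub_comm, abs_of_pos (by linarith : 0 < b + x), abs_of_pos hpos,
    div_le_div_iff₀ hpos (by positivity)]
  calc |x - b| * (b + x) * b ^ 3 ≤ D * (3 * b) * b ^ 3 := by gcongr; linarith
    _ = 6 * D * (2 * ((b / 2) ^ 2 * b ^ 2)) := by ring
    _ ≤ 6 * D * (2 * (x ^ 2 * b ^ 2)) := by gcongr

/-- First-order expansion of the linear functional `⟨a, v̂⟩` and of the width of its confidence
interval. -/
theorem abs_inner_sub_expansion_le {F : Type*} [NormedAddCommGroup F] [InnerProductSpace ℝ F]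
    {v x a ζ : F} {s β b bhat C D ρ : ℝ} (hv : ‖v‖ = 1) (hx : ‖x‖ = 1) (ha : ‖a‖ = 1)
    (hs : s ^ 2 = 1) (hsx : 0 < s * ⟪x, v⟫) (hβ : |β| = b) (hb1 : 1 ≤ b) (hC : 0 ≤ C)
    (hrej : ‖rej v x‖ ≤ C / b)
    (hexp : ‖rej v x - (s / β) • rej v ζ‖ ≤ C / b ^ 2)
    (hbhat : abs (|bhat| - b) ≤ D) (hDb : 2 * D ≤ b)
    (hζ : |‖rej v ζ‖ ^ 2 - 1| ≤ ρ) (hζC : ‖rej v ζ‖ ≤ C) :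
    abs (⟪a, x⟫ - ⟪a, s • v⟫ * (1 - 1 / (2 * bhat ^ 2)) - s / β * ⟪rej v a, ζ⟫) ≤
        ‖rej v a‖ * (C / b ^ 2) + (C ^ 4 + C * C + 6 * D) / b ^ 3 + ρ / (2 * b ^ 2) ∧
      abs (‖rej x a‖ / |bhat| - ‖rej v a‖ / b) ≤ (8 * C + 2 * D) / b ^ 2 := by
  have hb0 : 0 < b := by linarith
  have hs1 := abs_eq_one_of_sq hs
  have hD : 0 ≤ D := (abs_nonneg _).trans hbhat
  obtain ⟨hB1, hB2⟩ := abs_le.1 hbhat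
  have hB3 : b / 2 ≤ |bhat| := by linarith
  have hB4 : |bhat| ≤ 2 * b := by linarith
  have hB0 : 0 < |bhat| := by linarith
  obtain ⟨-, -, hc3, hc4⟩ := norm_sub_sign_smul_le hv hx hs hsx.le
  constructor
  · have hθ1 : |⟪a, s • v⟫| ≤ 1 := by
      refine (abs_real_inner_le_norm _ _).trans ?_
      rw [norm_smul, ha, hv, Real.norm_eq_abs, hs1]; norm_num
    have e1 : ⟪a, x⟫ = ⟪a, s • v⟫ * |⟪x, v⟫| + ⟪rej v a, rej v x⟫ := by
      have h1 : ⟪rej v a, rej v x⟫ = ⟪rej v a, x⟫ := by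
        nth_rewrite 2 [rej]
        rw [inner_sub_right, real_inner_smul_right, inner_rej_self hv, mul_zero, sub_zero]
      rw [h1, ← hc3, rej, inner_sub_left, real_inner_smul_left, real_inner_smul_right,
        real_inner_comm x v]
      linear_combination (-⟪a, v⟫ * ⟪x, v⟫) * hs
    have e2 : ⟪rej v a, ζ⟫ = ⟪rej v a, rej v ζ⟫ := by
      nth_rewrite 3 [rej]
      rw [inner_sub_right, real_inner_smul_right, inner_rej_self hv, mul_zero, sub_zero]
    -- The source of the bias correction: `|⟨x, v⟩|` is `1 - ‖rej v x‖² / 2`, then `‖rej v x‖` is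
    -- replaced by `‖rej v ζ‖ / b`, then `‖rej v ζ‖²` by `1`, and finally `b` by `|bhat|`. Each
    -- replacement is one of the four bracketed terms.
    have e3 : ⟪a, x⟫ - ⟪a, s • v⟫ * (1 - 1 / (2 * bhat ^ 2)) - s / β * ⟪rej v a, ζ⟫ =
        ⟪rej v a, rej v x - (s / β) • rej v ζ⟫ + ⟪a, s • v⟫ *
          ((|⟪x, v⟫| - (1 - ‖rej v x‖ ^ 2 / 2)) - (‖rej v x‖ ^ 2 - ‖rej v ζ‖ ^ 2 / b ^ 2) / 2 -
          (‖rej v ζ‖ ^ 2 - 1) / (2 * b ^ 2) + (1 / (2 * |bhat| ^ 2) - 1 / (2 * b ^ 2))) := by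
      rw [e1, e2, inner_sub_right, real_inner_smul_right _ (rej v ζ), sq_abs]
      ring
    have g1 : |⟪rej v a, rej v x - (s / β) • rej v ζ⟫| ≤ ‖rej v a‖ * (C / b ^ 2) :=
      (abs_real_inner_le_norm _ _).trans (by gcongr)
    have g2 : |(|⟪x, v⟫| - (1 - ‖rej v x‖ ^ 2 / 2))| ≤ C ^ 4 / b ^ 3 := by
      refine (abs_abs_inner_sub_le hv hx).trans ?_
      calc ‖rej v x‖ ^ 4 ≤ (C / b) ^ 4 := by gcongr
        _ = C ^ 4 / b ^ 4 := by rw [div_pow]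
        _ ≤ C ^ 4 / b ^ 3 := by gcongr; norm_num
    have g3 : |(‖rej v x‖ ^ 2 - ‖rej v ζ‖ ^ 2 / b ^ 2) / 2| ≤ C * C / b ^ 3 := by
      have h1 : ‖(s / β) • rej v ζ‖ = ‖rej v ζ‖ / b := by
        rw [norm_smul, Real.norm_eq_abs, abs_div, hs1, hβ, one_div_mul_eq_div]
      have h2 : |‖rej v x‖ - ‖rej v ζ‖ / b| ≤ C / b ^ 2 := by
        rw [← h1]; exact (abs_norm_sub_norm_le _ _).trans hexp
      have h3 : ‖rej v x‖ + ‖rej v ζ‖ / b ≤ 2 * (C / b) := by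
        have : ‖rej v ζ‖ / b ≤ C / b := by gcongr
        linarith
      have h4 : (‖rej v x‖ ^ 2 - ‖rej v ζ‖ ^ 2 / b ^ 2) / 2 =
          (‖rej v x‖ - ‖rej v ζ‖ / b) * ((‖rej v x‖ + ‖rej v ζ‖ / b) / 2) := by ring
      rw [h4, abs_mul, abs_of_nonneg (by positivity : 0 ≤ (‖rej v x‖ + ‖rej v ζ‖ / b) / 2)]
      calc _ ≤ C / b ^ 2 * (C / b) := mul_le_mul h2 (by linarith) (by positivity) (by positivity)
        _ = _ := by field_simp
    have g4 : |(‖rej v ζ‖ ^ 2 - 1) / (2 * b ^ 2)| ≤ ρ / (2 * b ^ 2) := by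
      rw [abs_div, abs_of_pos (by positivity : 0 < 2 * b ^ 2)]; gcongr
    have g5 := abs_inv_sq_sub_le hb0 hB3 hB4 hbhat
    rw [e3]
    refine (abs_add_le _ _).trans ?_
    rw [abs_mul ⟪a, s • v⟫, add_assoc]
    refine add_le_add g1 ((mul_le_of_le_one_left (abs_nonneg _) hθ1).trans ?_)
    refine (abs_add_le _ _).trans ((add_le_add ((abs_sub _ _).trans
      (add_le_add ((abs_sub _ _).trans (add_le_add g2 g3)) g4)) g5).trans (le_of_eq ?_))
    ring
  · have h1 : |‖rej x a‖ - ‖rej v a‖| ≤ 4 * (C / b) := by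
      have h2 : ‖rej x a - rej v a‖ ≤ 2 * ‖x - s • v‖ := by
        have h3 : rej x a - rej v a = -(⟪a, x - s • v⟫ • x + ⟪a, s • v⟫ • (x - s • v)) := by
          rw [← rej_smul_left hs v a]
          simp only [rej, inner_sub_right, sub_smul, smul_sub]
          abel
        rw [h3, norm_neg]
        refine (norm_add_le _ _).trans ?_
        rw [norm_smul, norm_smul, hx, Real.norm_eq_abs, Real.norm_eq_abs]
        have h4 := abs_real_inner_le_norm a (x - s • v)
        have h5 := abs_real_inner_le_norm a (s • v)
        rw [norm_smul, ha, hv, Real.norm_eq_abs, hs1] at h5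
        rw [ha] at h4
        nlinarith [norm_nonneg (x - s • v)]
      refine (abs_norm_sub_norm_le _ _).trans (h2.trans ?_)
      linarith
    have h2 : ‖rej x a‖ / |bhat| - ‖rej v a‖ / b =
        (‖rej x a‖ - ‖rej v a‖) / |bhat| + ‖rej v a‖ * ((b - |bhat|) / (|bhat| * b)) := by
      field_simp
      ring
    have hη : ‖rej v a‖ ≤ 1 := (norm_rej_le hv a).trans ha.le
    rw [h2]
    refine (abs_add_le _ _).trans ?_
    have hBb : 0 < |bhat| * b := mul_pos hB0 hb0
    rw [abs_mul, abs_norm, abs_div, abs_div, abs_abs, abs_sub_comm b, abs_of_pos hBb]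
    have h3 : |‖rej x a‖ - ‖rej v a‖| / |bhat| ≤ 4 * (C / b) / (b / 2) := by gcongr
    have h4 : |(|bhat| - b)| / (|bhat| * b) ≤ D / (b / 2 * b) := by gcongr
    calc _ ≤ 4 * (C / b) / (b / 2) + 1 * (D / (b / 2 * b)) := by gcongr
      _ = _ := by field_simp; ring

/-! ### Standard Gaussian vectors -/

section Gaussian

variable {E : Type*} [NormedAddCommGroup E] [InnerProductSpace ℝ E] [FiniteDimensional ℝ E]
  [MeasurableSpace E] [BorelSpace E]

theorem map_inner_stdGaussian (t : E) :
    (stdGaussian E).map (fun W => ⟪t, W⟫) = gaussianReal 0 (‖t‖₊ ^ 2) := by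
  have h := IsGaussian.map_eq_gaussianReal (μ := stdGaussian E) (innerSL ℝ t)
  rw [integral_strongDual_stdGaussian, variance_dual_stdGaussian, innerSL_apply_norm] at h
  have h2 : (⇑(innerSL ℝ t) : E → ℝ) = fun W => ⟪t, W⟫ := by ext; simp
  rw [h2] at h
  rw [h]
  congr 1
  ext
  simp

/-- The coordinates of a standard Gaussian vector along an orthonormal family are independent
standard Gaussians. -/
theorem map_inner_orthonormal_stdGaussian {ι : Type*} [Fintype ι] {t : ι → E}
    (ht : Orthonormal ℝ t) :
    (stdGaussian E).map (fun W i => ⟪t i, W⟫) = Measure.pi fun _ => gaussianReal 0 1 := by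
  have hm : Measurable fun (W : E) (i : ι) => ⟪t i, W⟫ := by fun_prop
  suffices h : (stdGaussian E).map (fun W => WithLp.toLp 2 fun i => ⟪t i, W⟫) =
      (Measure.pi fun _ : ι => gaussianReal 0 1).map (WithLp.toLp 2) by
    have h2 := congrArg (fun μ => μ.map (WithLp.ofLp (p := 2))) h
    rw [Measure.map_map (by fun_prop) (by fun_prop), Measure.map_map (by fun_prop) (by fun_prop)] at h2
    simpa [Function.comp_def] using h2
  rw [map_pi_eq_stdGaussian]
  have : IsProbabilityMeasure ((stdGaussian E).map (fun W => WithLp.toLp 2 fun i => ⟪t i, W⟫)) :=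
    Measure.isProbabilityMeasure_map (by fun_prop)
  refine Measure.ext_of_charFun (E := EuclideanSpace ℝ ι) ?_
  ext c
  have h1 : charFun ((stdGaussian E).map (fun W => WithLp.toLp 2 fun i => ⟪t i, W⟫)) c =
      charFun (stdGaussian E) (∑ i, c i • t i) := by
    rw [charFun_apply, integral_map (by fun_prop) (by fun_prop), charFun_apply]
    congr with W
    congr 3
    rw [inner_sum, PiLp.inner_apply]
    refine Finset.sum_congr rfl fun i _ => ?_
    simp [real_inner_smul_right, real_inner_comm W]
  rw [h1, charFun_stdGaussian, charFun_stdGaussian]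
  congr 4
  refine congrArg _ ((sq_eq_sq₀ (norm_nonneg _) (norm_nonneg _)).1 ?_)
  rw [← real_inner_self_eq_norm_sq, EuclideanSpace.real_norm_sq_eq, ht.inner_sum]
  simp [sq]

/-- Chernoff at parameter `s`, applied to `t` and to `-t`; the variance is at most `1`. -/
theorem measureReal_le_abs_inner_le {t : E} (ht : ‖t‖ ≤ 1) {s : ℝ} (hs : 0 ≤ s) :
    (stdGaussian E).real {W | s ≤ |⟪t, W⟫|} ≤ 2 * Real.exp (-s ^ 2 / 2) := by
  have h1 : ∀ t : E, ‖t‖ ≤ 1 → (stdGaussian E).real {W | s ≤ ⟪t, W⟫} ≤ Real.exp (-s ^ 2 / 2) := by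
    intro t ht
    have hlaw := map_inner_stdGaussian t
    have hint : Integrable (fun W => Real.exp (s * ⟪t, W⟫)) (stdGaussian E) := by
      have := integrable_exp_mul_gaussianReal (μ := 0) (v := ‖t‖₊ ^ 2) s
      rw [← hlaw] at this
      exact (integrable_map_measure (f := fun W : E => ⟪t, W⟫) (g := fun x => Real.exp (s * x))
        (by fun_prop) (by fun_prop)).1 this
    refine (measure_ge_le_exp_mul_mgf s hs hint).trans ?_
    rw [mgf_gaussianReal hlaw, ← Real.exp_add, Real.exp_le_exp]
    have : (((‖t‖₊ ^ 2 : ℝ≥0) : ℝ)) ≤ 1 := by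
      push_cast
      exact pow_le_one₀ (norm_nonneg _) ht
    nlinarith [sq_nonneg s]
  have h2 : {W : E | s ≤ |⟪t, W⟫|} ⊆ {W | s ≤ ⟪t, W⟫} ∪ {W | s ≤ ⟪-t, W⟫} := by
    intro W hW
    simp only [Set.mem_ofPred_eq, Set.mem_union, inner_neg_left] at hW ⊢
    exact le_abs.1 hW
  calc _ ≤ _ := measureReal_mono h2
    _ ≤ _ := measureReal_union_le _ _
    _ ≤ Real.exp (-s ^ 2 / 2) + Real.exp (-s ^ 2 / 2) :=
      add_le_add (h1 t ht) (h1 (-t) (by rwa [norm_neg]))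
    _ = _ := by ring

/-- A standard Gaussian vector may be resampled independently in a subspace. -/
theorem stdGaussian_eq_map_resample (S : Submodule ℝ E) :
    stdGaussian E = ((stdGaussian E).prod (stdGaussian E)).map
      (fun p => Sᗮ.starProjection p.1 + S.starProjection p.2) := by
  have hm : Measurable fun p : E × E => Sᗮ.starProjection p.1 + S.starProjection p.2 := by fun_prop
  have : IsProbabilityMeasure (((stdGaussian E).prod (stdGaussian E)).map
      (fun p => Sᗮ.starProjection p.1 + S.starProjection p.2)) :=
    Measure.isProbabilityMeasure_map hm.aemeasurable
  refine Measure.ext_of_charFun ?_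
  ext c
  have h1 : ∀ p : E × E, Complex.exp (⟪Sᗮ.starProjection p.1 + S.starProjection p.2, c⟫ *
      Complex.I) = Complex.exp (⟪p.1, Sᗮ.starProjection c⟫ * Complex.I) *
        Complex.exp (⟪p.2, S.starProjection c⟫ * Complex.I) := by
    intro p
    rw [← Complex.exp_add, inner_add_left, Submodule.inner_starProjection_left_eq_right,
      Submodule.inner_starProjection_left_eq_right]
    push_cast
    ring_nf
  rw [charFun_apply (μ := Measure.map _ _), integral_map hm.aemeasurable (by fun_prop)]
  simp_rw [h1]
  rw [integral_prod_mul (fun x => Complex.exp (⟪x, Sᗮ.starProjection c⟫ * Complex.I))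
    (fun x => Complex.exp (⟪x, S.starProjection c⟫ * Complex.I)), ← charFun_apply, ← charFun_apply,
    charFun_stdGaussian, charFun_stdGaussian, charFun_stdGaussian, ← Complex.exp_add]
  congr 1
  -- By Pythagoras the product of the two Gaussian characteristic functions is the original one.
  have := Submodule.norm_sq_eq_add_norm_sq_starProjection c S
  have h3 : ((‖c‖ ^ 2 : ℝ) : ℂ) = ((‖S.starProjection c‖ ^ 2 + ‖Sᗮ.starProjection c‖ ^ 2 : ℝ) : ℂ) := by
    rw [this]
  push_cast at h3
  rw [h3]
  ring

end Gaussian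

/-! ### The noise tensor -/

/-- The tensor product `x₁ ⊗ … ⊗ x_k`, as an element of a Euclidean space. -/
def elemTensor {n k : ℕ} (x : Fin k → EuclideanSpace ℝ (Fin n)) :
    EuclideanSpace ℝ (Fin k → Fin n) :=
  WithLp.toLp 2 fun I => ∏ s, x s (I s)

/-- The noise tensor with entries `W I / √n`. -/
def noiseTensor {n k : ℕ} (W : EuclideanSpace ℝ (Fin k → Fin n)) : Tensor n k :=
  fun I => (√n)⁻¹ * W I

theorem inner_elemTensor {n k : ℕ} (x y : Fin k → EuclideanSpace ℝ (Fin n)) :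
    ⟪elemTensor x, elemTensor y⟫ = ∏ s, ⟪x s, y s⟫ := by
  simp only [elemTensor, PiLp.inner_apply, RCLike.inner_apply, conj_trivial,
    ← Finset.prod_mul_distrib]
  rw [Finset.prod_univ_sum]
  simp

theorem norm_elemTensor {n k : ℕ} (x : Fin k → EuclideanSpace ℝ (Fin n)) :
    ‖elemTensor x‖ = ∏ s, ‖x s‖ := by
  refine (sq_eq_sq₀ (norm_nonneg _) (by positivity)).1 ?_
  rw [← real_inner_self_eq_norm_sq, inner_elemTensor, ← Finset.prod_pow]
  simp_rw [real_inner_self_eq_norm_sq]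

theorem mform_noiseTensor {n k : ℕ} (W : EuclideanSpace ℝ (Fin k → Fin n))
    (x : Fin k → EuclideanSpace ℝ (Fin n)) :
    mform (noiseTensor W) x = (√n)⁻¹ * ⟪elemTensor x, W⟫ := by
  rw [mform_apply, PiLp.inner_apply, Finset.mul_sum]
  refine Finset.sum_congr rfl fun I _ => ?_
  simp [noiseTensor, elemTensor, mul_assoc]

theorem noiseTensor_add {n k : ℕ} (W W' : EuclideanSpace ℝ (Fin k → Fin n)) :
    noiseTensor (W + W') = noiseTensor W + noiseTensor W' := by
  ext I
  simp [noiseTensor, mul_add]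

/-- The unit ball of a Euclidean space has a `1/2`-net with at most `5 ^ n` points. -/
theorem exists_halfNet (n : ℕ) : ∃ N : Finset (EuclideanSpace ℝ (Fin n)), N.card ≤ 5 ^ n ∧
    (∀ p ∈ N, ‖p‖ ≤ 1) ∧ ∀ x : EuclideanSpace ℝ (Fin n), ‖x‖ ≤ 1 → ∃ p ∈ N, ‖x - p‖ ≤ 1 / 2 := by
  classical
  -- A `1`-separated set of maximal cardinality in the ball of radius `2` is a `1`-net there.
  -- Halving it gives a `1/2`-net of the unit ball, and the packing bound for separated sets gives
  -- `5 ^ n`.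
  let Sep : Finset (EuclideanSpace ℝ (Fin n)) → Prop := fun s =>
    (∀ c ∈ s, ‖c‖ ≤ 2) ∧ ∀ c ∈ s, ∀ d ∈ s, c ≠ d → 1 ≤ ‖c - d‖
  have hcard : ∀ s, Sep s → s.card ≤ 5 ^ n := fun s hs => by
    simpa using Besicovitch.card_le_of_separated s hs.1 hs.2
  have hne : {m | ∃ s, Sep s ∧ s.card = m}.Nonempty := ⟨0, ∅, by simp [Sep]⟩
  have hbd : BddAbove {m | ∃ s, Sep s ∧ s.card = m} :=
    ⟨5 ^ n, by rintro _ ⟨s, hs, rfl⟩; exact hcard s hs⟩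
  obtain ⟨s, hs, hsm⟩ := Nat.sSup_mem hne hbd
  have hcov : ∀ y : EuclideanSpace ℝ (Fin n), ‖y‖ ≤ 2 → ∃ c ∈ s, ‖y - c‖ ≤ 1 := by
    intro y hy
    by_contra! hcon
    have hys : y ∉ s := fun h => by have := hcon y h; simp at this; linarith
    have hins : Sep (insert y s) := by
      refine ⟨fun c hc => ?_, fun c hc d hd hcd => ?_⟩
      · rcases Finset.mem_insert.1 hc with rfl | hc
        · exact hy
        · exact hs.1 c hc
      · rcases Finset.mem_insert.1 hc with rfl | hc <;> rcases Finset.mem_insert.1 hd with rfl | hd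
        · exact absurd rfl hcd
        · exact (hcon d ‹_›).le
        · rw [norm_sub_rev]; exact (hcon c ‹_›).le
        · exact hs.2 c hc d hd hcd
    have := le_csSup hbd ⟨_, hins, rfl⟩
    rw [Finset.card_insert_of_notMem hys, ← hsm] at this
    omega
  refine ⟨s.image fun c => (1 / 2 : ℝ) • c, Finset.card_image_le.trans (hcard s hs), ?_, ?_⟩
  · intro p hp
    obtain ⟨c, hc, rfl⟩ := Finset.mem_image.1 hp
    rw [norm_smul, Real.norm_of_nonneg (by norm_num)]
    linarith [hs.1 c hc]
  · intro x hx
    obtain ⟨c, hc, hxc⟩ := hcov ((2 : ℝ) • x) (by rw [norm_smul]; norm_num; linarith)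
    refine ⟨_, Finset.mem_image_of_mem _ hc, ?_⟩
    have : x - (1 / 2 : ℝ) • c = (1 / 2 : ℝ) • ((2 : ℝ) • x - c) := by
      rw [smul_sub, smul_smul]; norm_num
    rw [this, norm_smul, Real.norm_of_nonneg (by norm_num)]
    linarith

/-- The operator norm satisfies `‖g‖ ≤ B + ‖g‖ / 2`: round a unit vector to the net and estimate the
remainder by `‖g‖` itself. -/
theorem abs_le_two_mul_of_net {n : ℕ} {N : Finset (EuclideanSpace ℝ (Fin n))}
    (hN : ∀ x : EuclideanSpace ℝ (Fin n), ‖x‖ ≤ 1 → ∃ p ∈ N, ‖x - p‖ ≤ 1 / 2)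
    (f : EuclideanSpace ℝ (Fin n) →ₗ[ℝ] ℝ) {B : ℝ} (hB : 0 ≤ B) (hf : ∀ p ∈ N, |f p| ≤ B)
    {x : EuclideanSpace ℝ (Fin n)} (hx : ‖x‖ ≤ 1) : |f x| ≤ 2 * B := by
  set g := LinearMap.toContinuousLinearMap f with hg
  have hgf : ∀ y, g y = f y := fun y => rfl
  have h1 : ‖g‖ ≤ B + ‖g‖ / 2 := by
    refine ContinuousLinearMap.opNorm_le_of_unit_norm (by positivity) fun y hy => ?_
    obtain ⟨p, hp, hyp⟩ := hN y hy.le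
    have h2 : g y = f p + g (y - p) := by rw [map_sub, hgf p]; ring
    rw [h2]
    refine (norm_add_le _ _).trans (add_le_add (hf p hp) ?_)
    refine (g.le_opNorm _).trans ?_
    have := norm_nonneg g
    nlinarith
  have h3 := g.le_opNorm x
  rw [Real.norm_eq_abs, hgf] at h3
  have := norm_nonneg g
  nlinarith

/-- The slots are freed from the net one after the other, each time at the cost of a factor `2`,
with all other slots fixed so that the form is linear. Homogeneity then removes the restriction to
the unit ball. -/
theorem injBound_of_net {n k : ℕ} {Z : Tensor n k} {N : Finset (EuclideanSpace ℝ (Fin n))}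
    (hN : ∀ x : EuclideanSpace ℝ (Fin n), ‖x‖ ≤ 1 → ∃ p ∈ N, ‖x - p‖ ≤ 1 / 2) {B : ℝ} (hB : 0 ≤ B)
    (hZ : ∀ x : Fin k → EuclideanSpace ℝ (Fin n), (∀ s, x s ∈ N) → |mform Z x| ≤ B) :
    InjBound Z (2 ^ k * B) := by
  classical
  have key : ∀ S : Finset (Fin k), ∀ x : Fin k → EuclideanSpace ℝ (Fin n),
      (∀ s ∈ S, ‖x s‖ ≤ 1) → (∀ s ∉ S, x s ∈ N) → |mform Z x| ≤ 2 ^ S.card * B := by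
    intro S
    induction S using Finset.induction_on with
    | empty => intro x _ hx; simpa using hZ x fun s => hx s (by simp)
    | insert a S ha ih =>
      intro x hx1 hx2
      have h1 : mform Z x = (mform Z).toLinearMap x a (x a) := by simp
      rw [h1, Finset.card_insert_of_notMem ha, pow_succ, mul_comm _ (2 : ℝ), mul_assoc]
      refine abs_le_two_mul_of_net hN _ (by positivity) (fun p hp => ?_)
        (hx1 a (Finset.mem_insert_self _ _))
      refine ih _ (fun s hs => ?_) (fun s hs => ?_)
      · have hsa : s ≠ a := fun h => ha (h ▸ hs)
        rw [Function.update_of_ne hsa]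
        exact hx1 s (Finset.mem_insert_of_mem hs)
      · rcases eq_or_ne s a with rfl | hsa
        · simpa using hp
        · rw [Function.update_of_ne hsa]
          exact hx2 s (by simp [hsa, hs])
  intro x
  by_cases h0 : ∃ s, x s = 0
  · obtain ⟨s, hs⟩ := h0
    rw [(mform Z).map_coord_zero s hs, abs_zero]
    positivity
  push Not at h0
  have hx : x = fun s => ‖x s‖ • (‖x s‖⁻¹ • x s) := by
    ext1 s
    rw [smul_smul, mul_inv_cancel₀ (norm_ne_zero_iff.2 (h0 s)), one_smul]
  have h1 := key Finset.univ (fun s => ‖x s‖⁻¹ • x s) (fun s _ => by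
    rw [norm_smul, norm_inv, norm_norm, inv_mul_cancel₀ (norm_ne_zero_iff.2 (h0 s))]) (by simp)
  rw [hx, (mform Z).map_smul_univ, smul_eq_mul, abs_mul, abs_of_nonneg (by positivity), ← hx]
  rw [Finset.card_univ, Fintype.card_fin] at h1
  rw [mul_comm]
  gcongr

/-- The injective norm of the noise is bounded with probability tending to one. -/
theorem exists_injBound_noiseTensor (k : ℕ) : ∃ L : ℝ, 1 ≤ L ∧ ∀ n : ℕ, 1 ≤ n →
    (stdGaussian (EuclideanSpace ℝ (Fin k → Fin n))).real {W | ¬InjBound (noiseTensor W) L} ≤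
      2 * Real.exp (-n) := by
  classical
  -- Chosen so that the union bound over the `5 ^ (n * k)` tuples of net points, each with tail `2
  -- exp(-n B² / 2)`, leaves exactly `2 exp(-n)`.
  set B := √(2 * (k * Real.log 5 + 1)) with hB
  have hlog5 : 0 ≤ Real.log 5 := Real.log_nonneg (by norm_num)
  have hB2 : B ^ 2 = 2 * (k * Real.log 5 + 1) := Real.sq_sqrt (by positivity)
  have hB1 : 1 ≤ B := by
    rw [hB, Real.one_le_sqrt]
    have : 0 ≤ k * Real.log 5 := by positivity
    linarith
  refine ⟨2 ^ k * B, ?_, fun n hn => ?_⟩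
  · exact one_le_mul_of_one_le_of_one_le (one_le_pow₀ (by norm_num)) hB1
  obtain ⟨N, hNc, hN1, hN2⟩ := exists_halfNet n
  have hn0 : (0 : ℝ) < √n := Real.sqrt_pos.2 (by exact_mod_cast hn)
  have hsub : {W : EuclideanSpace ℝ (Fin k → Fin n) | ¬InjBound (noiseTensor W) (2 ^ k * B)} ⊆
      ⋃ x ∈ Fintype.piFinset fun _ : Fin k => N, {W | √n * B ≤ |⟪elemTensor x, W⟫|} := by
    intro W hW
    by_contra hcon
    refine hW (injBound_of_net hN2 (by positivity) fun x hx => ?_)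
    simp only [Set.mem_iUnion, not_exists, Set.mem_ofPred_eq, not_le] at hcon
    rw [mform_noiseTensor, abs_mul, abs_of_pos (inv_pos.2 hn0), inv_mul_le_iff₀ hn0]
    exact (hcon x (Fintype.mem_piFinset.2 hx)).le
  refine (measureReal_mono hsub (measure_ne_top _ _)).trans ((measureReal_biUnion_finset_le _ _).trans ?_)
  calc _ ≤ ∑ x ∈ Fintype.piFinset fun _ : Fin k => N, 2 * Real.exp (-(√n * B) ^ 2 / 2) := by
        refine Finset.sum_le_sum fun x hx => measureReal_le_abs_inner_le ?_ (by positivity)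
        rw [norm_elemTensor]
        exact Finset.prod_le_one (fun _ _ => norm_nonneg _)
          fun s _ => hN1 _ (Fintype.mem_piFinset.1 hx s)
    _ = (N.card : ℝ) ^ k * (2 * Real.exp (-(√n * B) ^ 2 / 2)) := by
        rw [Finset.sum_const, Fintype.card_piFinset]; simp
    _ ≤ ((5 : ℝ) ^ n) ^ k * (2 * Real.exp (-(√n * B) ^ 2 / 2)) := by
        gcongr; exact_mod_cast hNc
    _ = 2 * Real.exp (-n) := by
        rw [mul_pow, hB2, Real.sq_sqrt (by positivity)]
        have : ((5 : ℝ) ^ n) ^ k = Real.exp (n * k * Real.log 5) := by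
          rw [← pow_mul, ← Nat.cast_mul, Real.exp_nat_mul, Real.exp_log (by norm_num)]
        rw [this, mul_left_comm, ← Real.exp_add]
        congr 2
        ring

/-- Filling the free slot is an isometry when the other slots hold a unit vector. Hence the
coordinates of `Z[v^{⊗(k-1)}]` are i.i.d. Gaussians, and its squared norm is a normalized chi-square
variable. -/
theorem update_inner_prod {n k : ℕ} [NeZero k] {v : EuclideanSpace ℝ (Fin n)} (hv : ‖v‖ = 1)
    (w w' : EuclideanSpace ℝ (Fin n)) :
    ⟪elemTensor (k := k) (Function.update (fun _ => v) 0 w),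
      elemTensor (Function.update (fun _ => v) 0 w')⟫ = ⟪w, w'⟫ := by
  rw [inner_elemTensor, Fintype.prod_eq_single 0]
  · simp
  · intro s hs
    simp [Function.update_of_ne hs, hv]

/-- Concentration of the squared norm of `Z[v^{⊗(k-1)}]`. -/
theorem exists_norm_act_concentration : ∃ c : ℝ, 0 ≤ c ∧ ∀ (k : ℕ) [NeZero k] (n : ℕ), 1 ≤ n →
    ∀ v : EuclideanSpace ℝ (Fin n), ‖v‖ = 1 → ∀ δ : ℝ, 0 < δ →
    (stdGaussian (EuclideanSpace ℝ (Fin k → Fin n))).real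
      {W | δ ≤ |‖act (noiseTensor W) (tensorPow v (k - 1))‖ ^ 2 - 1|} ≤ c / (n * δ ^ 2) := by
  refine ⟨Var[fun x => x ^ 2; gaussianReal 0 1], variance_nonneg _ _, ?_⟩
  intro k _ n hn v hv δ hδ
  set c := Var[fun x => x ^ 2; gaussianReal 0 1] with hc
  have hn0 : (0 : ℝ) < n := by exact_mod_cast hn
  set e := EuclideanSpace.basisFun (Fin n) ℝ with he
  have hort : Orthonormal ℝ fun i : Fin n => elemTensor (k := k) (Function.update (fun _ => v) 0 (e i)) := by
    rw [orthonormal_iff_ite]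
    intro i j
    rw [update_inner_prod hv]
    exact orthonormal_iff_ite.1 e.orthonormal i j
  have hlaw := map_inner_orthonormal_stdGaussian hort
  have hnorm : ∀ W : EuclideanSpace ℝ (Fin k → Fin n),
      ‖act (noiseTensor W) (tensorPow v (k - 1))‖ ^ 2 =
        (∑ i, ⟪elemTensor (k := k) (Function.update (fun _ => v) 0 (e i)), W⟫ ^ 2) / n := by
    intro W
    rw [← e.sum_sq_inner_right, Finset.sum_div]
    refine Finset.sum_congr rfl fun i _ => ?_
    rw [inner_act, mform_noiseTensor, mul_pow, inv_pow, Real.sq_sqrt hn0.le, inv_mul_eq_div]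
  have hL4 : MemLp (fun x : ℝ => x ^ 2) 2 (gaussianReal 0 1) := by
    have h := (memLp_id_gaussianReal (μ := 0) (v := 1) 4).integrable_norm_pow (by norm_num)
    rw [memLp_two_iff_integrable_sq (by fun_prop)]
    refine h.congr (Eventually.of_forall fun x => ?_)
    have h4 : (ENNReal.toReal ((4 : ℝ≥0) : ℝ≥0∞)) = 4 := rfl
    have : (x ^ 2) ^ 2 = |x| ^ 4 := by rw [← sq_abs x]; ring
    simpa [h4] using this.symm
  have hint2 : ∫ x, x ^ 2 ∂gaussianReal 0 1 = 1 := by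
    have h := variance_fun_id_gaussianReal (μ := 0) (v := 1)
    rw [variance_of_integral_eq_zero (by fun_prop) (by simp)] at h
    simpa using h
  have hmem : MemLp (∑ i : Fin n, fun ω : Fin n → ℝ => ω i ^ 2) 2
      (Measure.pi fun _ => gaussianReal 0 1) :=
    memLp_finsetSum' _ fun i _ =>
      hL4.comp_measurePreserving (measurePreserving_eval _ i)
  have hvar := variance_sum_pi (μ := fun _ : Fin n => gaussianReal 0 1)
    (X := fun _ x => x ^ 2) fun _ => hL4
  have hmean : ∫ ω, (∑ i : Fin n, fun ω : Fin n → ℝ => ω i ^ 2) ω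
      ∂(Measure.pi fun _ => gaussianReal 0 1) = n := by
    simp only [Finset.sum_apply]
    rw [integral_finsetSum]
    · have : ∀ i : Fin n, ∫ ω : Fin n → ℝ, ω i ^ 2 ∂(Measure.pi fun _ => gaussianReal 0 1) = 1 := by
        intro i
        rw [← hint2]
        have h := (measurePreserving_eval (fun _ : Fin n => gaussianReal 0 1) i).map_eq
        nth_rewrite 2 [← h]
        rw [integral_map (measurable_pi_apply i).aemeasurable (by fun_prop)]
      simp [this]
    · intro i _
      exact (hL4.comp_measurePreserving (measurePreserving_eval
        (fun _ : Fin n => gaussianReal 0 1) i)).integrable one_le_two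
  have hcheb := meas_ge_le_variance_div_sq hmem (c := n * δ) (by positivity)
  rw [hmean, hvar, ← hlaw, Measure.map_apply (by fun_prop)
    (measurableSet_le (by fun_prop) (by fun_prop))] at hcheb
  have hset : {W | δ ≤ |‖act (noiseTensor W) (tensorPow v (k - 1))‖ ^ 2 - 1|} =
      (fun W i => ⟪elemTensor (k := k) (Function.update (fun _ => v) 0 (e i)), W⟫) ⁻¹'
        {ω : Fin n → ℝ | n * δ ≤ |(∑ i : Fin n, fun ω : Fin n → ℝ => ω i ^ 2) ω - n|} := by
    ext W
    simp only [Set.mem_ofPred_eq, Set.mem_preimage, Finset.sum_apply, hnorm]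
    rw [div_sub_one hn0.ne', abs_div, abs_of_pos hn0, le_div_iff₀' hn0]
  rw [hset, Measure.real]
  refine (ENNReal.toReal_mono ENNReal.ofReal_ne_top hcheb).trans (le_of_eq ?_)
  rw [ENNReal.toReal_ofReal (by have := variance_nonneg (fun x : ℝ => x ^ 2) (gaussianReal 0 1)
                                positivity)]
  simp only [Finset.sum_const, Finset.card_univ, Fintype.card_fin, nsmul_eq_mul]
  rw [← hc]
  field_simp

/-! ### The noise along the first steps of the power iteration -/

theorem measurable_act {Ω : Type*} [MeasurableSpace Ω] {n k : ℕ} [NeZero k] {X : Ω → Tensor n k}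
    {η : Ω → Tensor n (k - 1)} (hX : Measurable X) (hη : Measurable η) :
    Measurable fun ω => act (X ω) (η ω) := by
  refine (MeasurableEquiv.toLp 2 (Fin n → ℝ)).measurable.comp (measurable_pi_lambda _ fun i => ?_)
  exact Finset.measurable_sum _ fun I _ =>
    ((measurable_pi_apply I).comp hX).mul ((measurable_pi_apply _).comp hη)

theorem measurable_tensorPow {Ω : Type*} [MeasurableSpace Ω] {n m : ℕ}
    {x : Ω → EuclideanSpace ℝ (Fin n)} (hx : Measurable x) :
    Measurable fun ω => tensorPow (x ω) m := by
  refine measurable_pi_lambda _ fun I => ?_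
  unfold tensorPow
  fun_prop

theorem measurable_powerIter {Ω : Type*} [MeasurableSpace Ω] {n k : ℕ} [NeZero k]
    {X : Ω → Tensor n k} {u : Ω → EuclideanSpace ℝ (Fin n)} (hX : Measurable X)
    (hu : Measurable u) (t : ℕ) : Measurable fun ω => powerIter (X ω) (u ω) t := by
  induction t with
  | zero => exact hu
  | succ t ih =>
    have h := measurable_act hX (measurable_tensorPow (m := k - 1) ih)
    exact h.norm.inv.smul h

theorem measurable_observation_noiseTensor {n k r : ℕ} (β : Fin r → ℝ)
    (v : Fin r → EuclideanSpace ℝ (Fin n)) :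
    Measurable fun W : EuclideanSpace ℝ (Fin k → Fin n) => observation β v (noiseTensor W) := by
  refine measurable_pi_lambda _ fun I => ?_
  unfold observation noiseTensor
  fun_prop

theorem norm_powerStep_le {n k : ℕ} [NeZero k] (X : Tensor n k) (x : EuclideanSpace ℝ (Fin n)) :
    ‖powerStep X x‖ ≤ 1 := by
  rw [powerStep, norm_smul, norm_inv, norm_norm]
  exact inv_mul_le_one

theorem norm_powerIter_le {n k : ℕ} [NeZero k] (X : Tensor n k) {u : EuclideanSpace ℝ (Fin n)}
    (hu : ‖u‖ ≤ 1) (t : ℕ) : ‖powerIter X u t‖ ≤ 1 := by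
  cases t with
  | zero => exact hu
  | succ t => exact norm_powerStep_le _ _

theorem act_sum_smul {n k : ℕ} [NeZero k] {ι : Type*} (s : Finset ι) (τ : Tensor n k) (c : ι → ℝ)
    (η : ι → Tensor n (k - 1)) :
    act τ (fun I => ∑ i ∈ s, c i * η i I) = ∑ i ∈ s, c i • act τ (η i) := by
  ext j
  simp only [act, WithLp.ofLp_sum, WithLp.ofLp_smul, Finset.sum_apply, Pi.smul_apply, smul_eq_mul,
    Finset.mul_sum]
  rw [Finset.sum_comm]
  exact Finset.sum_congr rfl fun i _ => Finset.sum_congr rfl fun I _ => by ring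

theorem act_add_left {n k : ℕ} [NeZero k] (τ τ' : Tensor n k) (η : Tensor n (k - 1)) :
    act (τ + τ') η = act τ η + act τ' η := by
  ext j
  simp [act, add_mul, Finset.sum_add_distrib]

theorem prod_sum_smul_apply {n m d : ℕ} (c : Fin m → Fin d → ℝ)
    (e : Fin d → EuclideanSpace ℝ (Fin n)) (I : Fin m → Fin n) :
    ∏ s, (∑ a, c s a • e a) (I s) =
      ∑ J : Fin m → Fin d, (∏ s, c s (J s)) * ∏ s, e (J s) (I s) := by
  simp only [WithLp.ofLp_sum, WithLp.ofLp_smul, Finset.sum_apply, Pi.smul_apply, smul_eq_mul]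
  rw [Finset.prod_univ_sum]
  simp [Finset.prod_mul_distrib]

/-- If the noise only changes by tensors acting into the span of the spikes, then the `t`-th
iterate stays in a fixed subspace whose dimension is bounded independently of `n`. -/
theorem exists_trajectory_submodule (k r : ℕ) [NeZero k] (t : ℕ) : ∃ m : ℕ, ∀ (n : ℕ)
    (v : Fin r → EuclideanSpace ℝ (Fin n)) (D : Tensor n k) (u : EuclideanSpace ℝ (Fin n)),
    ∃ U : Submodule ℝ (EuclideanSpace ℝ (Fin n)), Module.finrank ℝ U ≤ m ∧ (∀ j, v j ∈ U) ∧
      ∀ (R : Tensor n k) (β : Fin r → ℝ),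
        (∀ x, act R (tensorPow x (k - 1)) ∈ Submodule.span ℝ (Set.range v)) →
        powerIter (observation β v (D + R)) u t ∈ U := by
  induction t with
  | zero =>
    refine ⟨r + 1, fun n v D u => ?_⟩
    refine ⟨Submodule.span ℝ (Set.range (Sum.elim v fun _ : Fin 1 => u)), ?_, fun j => ?_,
      fun R β _ => ?_⟩
    · refine (finrank_range_le_card _).trans ?_
      simp
    · exact Submodule.subset_span ⟨Sum.inl j, rfl⟩
    · exact Submodule.subset_span ⟨Sum.inr 0, rfl⟩
  | succ t ih =>
    obtain ⟨m, hm⟩ := ih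
    -- The tensor power of a vector of `U` expands in `m ^ (k - 1)` tensors built from a basis of
    -- `U`. The fixed part `D` maps them to as many fixed vectors; the spikes and the part `R`
    -- contribute only the span of the `r` spikes.
    refine ⟨r + m ^ (k - 1), fun n v D u => ?_⟩
    obtain ⟨U, hU, -, hUt⟩ := hm n v D u
    set e := stdOrthonormalBasis ℝ U with he
    let w : (Fin (k - 1) → Fin (Module.finrank ℝ U)) → EuclideanSpace ℝ (Fin n) :=
      fun J => act D fun I => ∏ s, (e (J s) : EuclideanSpace ℝ (Fin n)) (I s)
    set U' := Submodule.span ℝ (Set.range (Sum.elim v w)) with hU'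
    have hvU' : Submodule.span ℝ (Set.range v) ≤ U' := by
      refine Submodule.span_mono ?_
      rintro _ ⟨j, rfl⟩
      exact ⟨Sum.inl j, rfl⟩
    refine ⟨U', ?_, fun j => hvU' (Submodule.subset_span ⟨j, rfl⟩), fun R β hR => ?_⟩
    · refine (finrank_range_le_card _).trans ?_
      simp only [Fintype.card_sum, Fintype.card_fin, Fintype.card_pi, Finset.prod_const,
        Finset.card_univ]
      gcongr
    · change powerStep _ _ ∈ U'
      refine U'.smul_mem _ ?_
      set x := powerIter (observation β v (D + R)) u t with hx
      have hxU : x ∈ U := hUt R β hR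
      rw [act_observation, act_add_left]
      refine U'.add_mem (U'.sum_mem fun j _ => U'.smul_mem _
        (hvU' (Submodule.subset_span ⟨j, rfl⟩))) (U'.add_mem ?_ (hvU' (hR x)))
      have hxe : x = ∑ a, (e.repr ⟨x, hxU⟩ a) • (e a : EuclideanSpace ℝ (Fin n)) := by
        have := congrArg Subtype.val (e.sum_repr ⟨x, hxU⟩)
        simpa using this.symm
      have h1 : tensorPow x (k - 1) = fun I => ∑ J : Fin (k - 1) → Fin (Module.finrank ℝ U),
          (∏ s, e.repr ⟨x, hxU⟩ (J s)) *
            (fun I => ∏ s, (e (J s) : EuclideanSpace ℝ (Fin n)) (I s)) I := by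
        ext I
        have := prod_sum_smul_apply (fun (_ : Fin (k - 1)) a => e.repr ⟨x, hxU⟩ a)
          (fun a => (e a : EuclideanSpace ℝ (Fin n))) I
        rw [← hxe] at this
        exact this
      rw [h1, act_sum_smul]
      exact U'.sum_mem fun J _ => U'.smul_mem _ (Submodule.subset_span ⟨Sum.inr J, rfl⟩)

theorem integral_abs_inner_le {E : Type*} [NormedAddCommGroup E] [InnerProductSpace ℝ E]
    [FiniteDimensional ℝ E] [MeasurableSpace E] [BorelSpace E] {t : E} (ht : ‖t‖ ≤ 1) :
    Integrable (fun W => |⟪t, W⟫|) (stdGaussian E) ∧ ∫ W, |⟪t, W⟫| ∂stdGaussian E ≤ 1 := by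
  have hlaw := map_inner_stdGaussian t
  have h2 : MemLp (fun W => ⟪t, W⟫) 2 (stdGaussian E) := by
    have h := memLp_id_gaussianReal (μ := 0) (v := ‖t‖₊ ^ 2) 2
    rw [← hlaw, memLp_map_measure_iff (by fun_prop) (by fun_prop)] at h
    simpa [Function.comp_def] using h
  have hint : Integrable (fun W => ⟪t, W⟫) (stdGaussian E) := h2.integrable one_le_two
  refine ⟨hint.abs, ?_⟩
  have hsq : ∫ W, ⟪t, W⟫ ^ 2 ∂stdGaussian E ≤ 1 := by
    have h := variance_fun_id_gaussianReal (μ := 0) (v := ‖t‖₊ ^ 2)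
    rw [variance_of_integral_eq_zero (by fun_prop) (by simp), ← hlaw,
      integral_map (by fun_prop) (by fun_prop)] at h
    rw [h]
    push_cast
    exact pow_le_one₀ (norm_nonneg _) ht
  calc ∫ W, |⟪t, W⟫| ∂stdGaussian E ≤ ∫ W, (1 + ⟪t, W⟫ ^ 2) / 2 ∂stdGaussian E := by
        refine integral_mono hint.abs (((integrable_const _).add h2.integrable_sq).div_const _) ?_
        intro W
        simp only
        nlinarith [sq_nonneg (|⟪t, W⟫| - 1), sq_abs ⟪t, W⟫]
    _ ≤ 1 := by
        rw [integral_div, integral_add (integrable_const _) h2.integrable_sq]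
        simp only [integral_const, probReal_univ, smul_eq_mul]
        linarith

/-- Markov's inequality for the first moment. A tail of order `1/l` suffices, because `l` will be a
power of `n` and the number of terms is bounded. -/
theorem measureReal_le_sum_abs_inner_le {E ι : Type*} [NormedAddCommGroup E]
    [InnerProductSpace ℝ E] [FiniteDimensional ℝ E] [MeasurableSpace E] [BorelSpace E] [Fintype ι]
    {t : ι → E} (ht : ∀ i, ‖t i‖ ≤ 1) {l : ℝ} (hl : 0 < l) :
    (stdGaussian E).real {W | l ≤ ∑ i, |⟪t i, W⟫|} ≤ Fintype.card ι / l := by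
  rw [le_div_iff₀' hl]
  refine (mul_meas_ge_le_integral_of_nonneg (Eventually.of_forall fun W => by positivity)
    (integrable_finsetSum _ fun i _ => (integral_abs_inner_le (ht i)).1) l).trans ?_
  rw [integral_finsetSum _ fun i _ => (integral_abs_inner_le (ht i)).1]
  refine (Finset.sum_le_sum fun i _ => (integral_abs_inner_le (ht i)).2).trans ?_
  simp

/-- The overlaps of the noise with the spikes, during the first `τ` steps of the power iteration,
are of order `1/√n`. -/
theorem exists_noise_overlap_bound (k r τ : ℕ) [NeZero k] : ∃ c : ℝ, 0 ≤ c ∧ ∀ (n : ℕ), 1 ≤ n →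
    ∀ (β : Fin r → ℝ) (v : Fin r → EuclideanSpace ℝ (Fin n)), Orthonormal ℝ v →
    ∀ (u : EuclideanSpace ℝ (Fin n)), ‖u‖ ≤ 1 → ∀ l : ℝ, 0 < l →
    stdGaussian (EuclideanSpace ℝ (Fin k → Fin n))
      {W | ∃ t < τ, ∃ j, l / √n < |⟪v j, act (noiseTensor W)
        (tensorPow (powerIter (observation β v (noiseTensor W)) u t) (k - 1))⟫|} ≤
      ENNReal.ofReal (c / l) := by
  choose m hm using exists_trajectory_submodule k r
  refine ⟨∑ t ∈ Finset.range τ, (m t : ℝ) ^ k, by positivity, ?_⟩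
  intro n hn β v hv u hu l hl
  have hn0 : (0 : ℝ) < √n := Real.sqrt_pos.2 (by exact_mod_cast hn)
  set γ := stdGaussian (EuclideanSpace ℝ (Fin k → Fin n)) with hγ
  set Bad := {W : EuclideanSpace ℝ (Fin k → Fin n) | ∃ t < τ, ∃ j, l / √n < |⟪v j,
    act (noiseTensor W) (tensorPow (powerIter (observation β v (noiseTensor W)) u t) (k - 1))⟫|}
    with hBad
  have hmN : Measurable fun W : EuclideanSpace ℝ (Fin k → Fin n) => noiseTensor W := by
    refine measurable_pi_lambda _ fun I => ?_
    unfold noiseTensor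
    fun_prop
  have hmBad : MeasurableSet Bad := by
    have : Bad = ⋃ t ∈ Finset.range τ, ⋃ j, {W | l / √n < |⟪v j, act (noiseTensor W)
        (tensorPow (powerIter (observation β v (noiseTensor W)) u t) (k - 1))⟫|} := by
      ext W; simp [hBad]
    rw [this]
    refine Finset.measurableSet_biUnion _ fun t _ => MeasurableSet.iUnion fun j =>
      measurableSet_lt measurable_const ?_
    have := measurable_act hmN (measurable_tensorPow (m := k - 1)
      (measurable_powerIter (measurable_observation_noiseTensor β v) (measurable_const (a := u)) t))
    exact (measurable_const.inner this).abs
  -- The overlaps of the noise with the spikes only see the projection of the noise to this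
  -- subspace. Resampling that projection alone keeps the subspaces containing the iterates fixed.
  set S : Submodule ℝ (EuclideanSpace ℝ (Fin k → Fin n)) :=
    Submodule.span ℝ {y | ∃ (x : Fin k → EuclideanSpace ℝ (Fin n)) (j : Fin r),
      x 0 = v j ∧ y = elemTensor x} with hS
  have hmem : ∀ (x : Fin k → EuclideanSpace ℝ (Fin n)) j, x 0 = v j → elemTensor x ∈ S :=
    fun x j hx => Submodule.subset_span ⟨x, j, hx, rfl⟩
  have hperp : ∀ (x : Fin k → EuclideanSpace ℝ (Fin n)), (∀ j, ⟪x 0, v j⟫ = 0) →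
      elemTensor x ∈ Sᗮ := by
    intro x hx
    rw [Submodule.mem_orthogonal']
    intro y hy
    induction hy using Submodule.span_induction with
    | mem y hy =>
      obtain ⟨x', j, hx', rfl⟩ := hy
      rw [inner_elemTensor]
      exact Finset.prod_eq_zero (Finset.mem_univ 0) (by rw [hx', hx j])
    | zero => simp
    | add y z _ _ h1 h2 => rw [inner_add_right, h1, h2, add_zero]
    | smul a y _ h => rw [inner_smul_right, h, mul_zero]
  -- the resampled part of the noise acts into the span of the spikes
  have hact : ∀ (W : EuclideanSpace ℝ (Fin k → Fin n)) x,
      act (noiseTensor (S.starProjection W)) (tensorPow x (k - 1)) ∈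
        Submodule.span ℝ (Set.range v) := by
    intro W x
    rw [← Submodule.orthogonal_orthogonal (Submodule.span ℝ (Set.range v)),
      Submodule.mem_orthogonal]
    intro w hw
    rw [inner_act, mform_noiseTensor, ← Submodule.inner_starProjection_left_eq_right,
      (Submodule.starProjection_apply_eq_zero_iff S).2 (hperp _ fun j => ?_), inner_zero_left,
      mul_zero]
    rw [Function.update_self]
    exact (Submodule.mem_orthogonal' _ _).1 hw _ (Submodule.subset_span ⟨j, rfl⟩)
  -- With `W₁` frozen, the subspaces `U t` no longer depend on the remaining randomness `W₂`. The
  -- iterate still does, so the bound is taken uniformly over the unit ball of `U t`.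
  have hsection : ∀ W₁, γ {W₂ | Sᗮ.starProjection W₁ + S.starProjection W₂ ∈ Bad} ≤
      ENNReal.ofReal ((∑ t ∈ Finset.range τ, (m t : ℝ) ^ k) / l) := by
    intro W₁
    choose U hUm hUv hUt using fun t => hm t n v (noiseTensor (Sᗮ.starProjection W₁)) u
    let e := fun t => stdOrthonormalBasis ℝ (U t)
    let y := fun t (J : Fin k → Fin (Module.finrank ℝ (U t))) =>
      S.starProjection (elemTensor fun s => (e t (J s) : EuclideanSpace ℝ (Fin n)))
    have hy : ∀ t J, ‖y t J‖ ≤ 1 := by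
      intro t J
      refine (Submodule.norm_starProjection_apply_le S _).trans ?_
      rw [norm_elemTensor]
      refine Finset.prod_le_one (fun _ _ => norm_nonneg _) fun s _ => ?_
      have := (e t).orthonormal.1 (J s)
      exact this.le
    have hsub : {W₂ | Sᗮ.starProjection W₁ + S.starProjection W₂ ∈ Bad} ⊆
        ⋃ t ∈ Finset.range τ, {W₂ | l ≤ ∑ J, |⟪y t J, W₂⟫|} := by
      rintro W₂ ⟨t, ht, j, htj⟩
      simp only [Set.mem_iUnion, Finset.mem_range, Set.mem_ofPred_eq]
      refine ⟨t, ht, ?_⟩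
      rw [noiseTensor_add] at htj
      set x := powerIter (observation β v (noiseTensor (Sᗮ.starProjection W₁) +
        noiseTensor (S.starProjection W₂))) u t with hx
      have hxU : x ∈ U t := hUt t _ β (hact W₂)
      have hx1 : ‖x‖ ≤ 1 := norm_powerIter_le _ hu t
      have h1 : ⟪elemTensor (Function.update (fun _ : Fin k => x) 0 (v j)),
          Sᗮ.starProjection W₁⟫ = 0 := by
        refine Submodule.inner_right_of_mem_orthogonal (hmem _ j (by simp)) ?_
        exact Submodule.starProjection_apply_mem _ _
      rw [inner_act, mform_add, mform_noiseTensor, mform_noiseTensor, h1, mul_zero, zero_add,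
        abs_mul, abs_of_pos (inv_pos.2 hn0), div_eq_inv_mul,
        mul_lt_mul_iff_right₀ (inv_pos.2 hn0)] at htj
      refine htj.le.trans ?_
      have hz : ∀ s, Function.update (fun _ : Fin k => x) 0 (v j) s ∈ U t := by
        intro s
        rcases eq_or_ne s 0 with rfl | hs
        · simpa using hUv t j
        · simpa [Function.update_of_ne hs] using hxU
      have hz1 : ∀ s, ‖Function.update (fun _ : Fin k => x) 0 (v j) s‖ ≤ 1 := by
        intro s
        rcases eq_or_ne s 0 with rfl | hs
        · simpa using (hv.1 j).le
        · simpa [Function.update_of_ne hs] using hx1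
      generalize Function.update (fun _ : Fin k => x) 0 (v j) = z at hz hz1 ⊢
      have hze : elemTensor z = ∑ J : Fin k → Fin (Module.finrank ℝ (U t)),
          (∏ s, (e t).repr ⟨z s, hz s⟩ (J s)) •
            elemTensor fun s => (e t (J s) : EuclideanSpace ℝ (Fin n)) := by
        ext I
        have := prod_sum_smul_apply (fun s a => (e t).repr ⟨z s, hz s⟩ a)
          (fun a => (e t a : EuclideanSpace ℝ (Fin n))) I
        have h3 : ∀ s, (∑ a, (e t).repr ⟨z s, hz s⟩ a • (e t a : EuclideanSpace ℝ (Fin n))) = z s := by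
          intro s
          have := congrArg Subtype.val ((e t).sum_repr ⟨z s, hz s⟩)
          simpa using this
        simp_rw [h3] at this
        simpa [elemTensor] using this
      rw [hze, sum_inner]
      -- The coefficients depend on `W₂` through the iterate, but they are at most `1` in absolute
      -- value. The sum over the fixed vectors `y t J` therefore dominates.
      refine (Finset.abs_sum_le_sum_abs _ _).trans (Finset.sum_le_sum fun J _ => ?_)
      rw [real_inner_smul_left, ← Submodule.inner_starProjection_left_eq_right, abs_mul,
        Finset.abs_prod]
      refine mul_le_of_le_one_left (abs_nonneg _) (Finset.prod_le_one (fun _ _ => abs_nonneg _)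
        fun s _ => ?_)
      rw [(e t).repr_apply_apply]
      refine (abs_real_inner_le_norm _ _).trans ?_
      rw [(e t).orthonormal.1, one_mul]
      exact hz1 s
    calc _ ≤ _ := measure_mono hsub
      _ ≤ _ := measure_biUnion_finset_le _ _
      _ ≤ ∑ t ∈ Finset.range τ, ENNReal.ofReal ((m t : ℝ) ^ k / l) := by
          refine Finset.sum_le_sum fun t _ => ?_
          rw [← ofReal_measureReal (μ := γ)]
          refine ENNReal.ofReal_le_ofReal ((measureReal_le_sum_abs_inner_le (hy t) hl).trans ?_)
          gcongr
          simp only [Fintype.card_pi, Fintype.card_fin, Finset.prod_const, Finset.card_univ]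
          exact_mod_cast Nat.pow_le_pow_left (hUm t) k
      _ = _ := by
          rw [← ENNReal.ofReal_sum_of_nonneg fun _ _ => by positivity, Finset.sum_div]
  rw [hγ, stdGaussian_eq_map_resample S, Measure.map_apply (by fun_prop) hmBad,
    Measure.prod_apply ((by fun_prop : Measurable fun p : EuclideanSpace ℝ (Fin k → Fin n) × _ =>
      Sᗮ.starProjection p.1 + S.starProjection p.2) hmBad)]
  refine (lintegral_mono fun W₁ => hsection W₁).trans ?_
  simp

/-! ### The uniform distribution on the sphere as a normalized Gaussian vector -/

section Polar

variable {E : Type*} [NormedAddCommGroup E] [InnerProductSpace ℝ E] [FiniteDimensional ℝ E]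
  [MeasurableSpace E] [BorelSpace E]

/-- The two measures have the same characteristic function. Only the radial form of the density will
matter, so the value of the constant is left unspecified. -/
theorem stdGaussian_eq_withDensity : ∃ c : ℝ, 0 < c ∧ stdGaussian E =
    (volume : Measure E).withDensity fun x => ENNReal.ofReal (c * Real.exp (-(1 / 2) * ‖x‖ ^ 2)) := by
  have hb : (0 : ℝ) < 1 / 2 := by norm_num
  set d : ℝ := Module.finrank ℝ E / 2 with hd
  set A : ℝ := (Real.pi / (1 / 2)) ^ d with hA
  have hA0 : 0 < A := by positivity
  have hint := GaussianFourier.integral_rexp_neg_mul_sq_norm (V := E) hb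
  rw [← hd, ← hA] at hint
  have hintb : Integrable fun x : E => Real.exp (-(1 / 2) * ‖x‖ ^ 2) := by
    by_contra h
    rw [integral_undef h] at hint
    exact hA0.ne hint
  refine ⟨A⁻¹, by positivity, ?_⟩
  set f : E → ℝ≥0 := fun x => (A⁻¹ * Real.exp (-(1 / 2) * ‖x‖ ^ 2)).toNNReal with hf
  have hfm : Measurable f := by fun_prop
  have hfr : ∀ x, (f x : ℝ) = A⁻¹ * Real.exp (-(1 / 2) * ‖x‖ ^ 2) := fun x =>
    Real.coe_toNNReal _ (by positivity)
  change _ = volume.withDensity fun x => (f x : ℝ≥0∞)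
  have hfin : IsFiniteMeasure ((volume : Measure E).withDensity fun x => (f x : ℝ≥0∞)) :=
    isFiniteMeasure_withDensity_ofReal (hintb.const_mul A⁻¹).2
  refine Measure.ext_of_charFun ?_
  ext t
  rw [charFun_stdGaussian, charFun_apply, integral_withDensity_eq_integral_smul hfm]
  have key := GaussianFourier.integral_cexp_neg_mul_sq_norm_add (V := E) (b := (1 / 2 : ℂ))
    (by norm_num) Complex.I t
  have h1 : ∀ x : E, f x • Complex.exp (⟪x, t⟫ * Complex.I) =
      (A⁻¹ : ℂ) * Complex.exp (-(1 / 2) * ‖x‖ ^ 2 + Complex.I * ⟪t, x⟫) := by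
    intro x
    rw [NNReal.smul_def, hfr, Complex.real_smul, Complex.exp_add, real_inner_comm]
    push_cast
    ring_nf
  simp_rw [h1]
  rw [integral_const_mul, key]
  have h2 : ((Real.pi : ℂ) / (1 / 2)) ^ ((Module.finrank ℝ E : ℂ) / 2) = (A : ℂ) := by
    rw [hA, Complex.ofReal_cpow (by positivity), hd]
    push_cast
    rfl
  rw [h2, ← mul_assoc, inv_mul_cancel₀ (by exact_mod_cast hA0.ne'), one_mul]
  congr 1
  rw [Complex.I_sq]
  ring

theorem lintegral_polar [Nontrivial E] {f : E → ℝ≥0∞} {h : ℝ → ℝ≥0∞} (hf : Measurable f)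
    (hh : Measurable h) :
    ∫⁻ x : E, f (‖x‖⁻¹ • x) * h ‖x‖ = (∫⁻ y, f y ∂(volume : Measure E).toSphere) *
      ∫⁻ y, h y ∂Measure.volumeIoiPow (Module.finrank ℝ E - 1) := by
  have hmp := (volume : Measure E).measurePreserving_homeomorphUnitSphereProd
  have h1 : ∫⁻ x : E, f (‖x‖⁻¹ • x) * h ‖x‖ =
      ∫⁻ x : ({(0 : E)}ᶜ : Set E), f (‖x.1‖⁻¹ • x.1) * h ‖x.1‖
        ∂((volume : Measure E).comap Subtype.val) := by
    rw [lintegral_subtype_comap (measurableSet_singleton _).compl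
      (fun x => f (‖x‖⁻¹ • x) * h ‖x‖), restrict_compl_singleton]
  rw [h1, ← lintegral_prod_mul (by fun_prop) (by fun_prop), ← hmp.lintegral_comp (by fun_prop)]
  simp

end Polar

/-- In polar coordinates the radial Gaussian density splits off the factor `K`, which does not
depend on the set of directions. Total mass one forces `K` to be the inverse of the surface measure.
-/
theorem uniformSphere_eq_map {n : ℕ} (hn : 1 ≤ n) :
    uniformSphere n =
      (stdGaussian (EuclideanSpace ℝ (Fin n))).map fun g => ‖g‖⁻¹ • g := by
  obtain ⟨c, hc, hγ⟩ := stdGaussian_eq_withDensity (E := EuclideanSpace ℝ (Fin n))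
  have : Nonempty (Fin n) := ⟨⟨0, hn⟩⟩
  set S := (volume : Measure (EuclideanSpace ℝ (Fin n))).toSphere with hS
  set h : ℝ → ℝ≥0∞ := fun y => ENNReal.ofReal (c * Real.exp (-(1 / 2) * y ^ 2)) with hh
  have hhm : Measurable h := by fun_prop
  set K := ∫⁻ y, h y ∂Measure.volumeIoiPow (Module.finrank ℝ (EuclideanSpace ℝ (Fin n)) - 1) with hK
  have key : ∀ A : Set (EuclideanSpace ℝ (Fin n)), MeasurableSet A →
      stdGaussian (EuclideanSpace ℝ (Fin n)) ((fun g => ‖g‖⁻¹ • g) ⁻¹' A) =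
        S (Subtype.val ⁻¹' A) * K := by
    intro A hA
    have hAm : MeasurableSet ((fun g : EuclideanSpace ℝ (Fin n) => ‖g‖⁻¹ • g) ⁻¹' A) :=
      (by fun_prop : Measurable fun g : EuclideanSpace ℝ (Fin n) => ‖g‖⁻¹ • g) hA
    rw [hγ, withDensity_apply _ hAm, ← lintegral_indicator hAm]
    have := lintegral_polar (E := EuclideanSpace ℝ (Fin n)) (f := A.indicator 1) (h := h)
      (measurable_one.indicator hA) hhm
    rw [← hS, ← hK] at this
    have h3 : ∫⁻ y, A.indicator 1 (y : EuclideanSpace ℝ (Fin n)) ∂S = S (Subtype.val ⁻¹' A) := by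
      rw [← lintegral_indicator_one (measurable_subtype_coe hA)]
      rfl
    rw [h3] at this
    rw [← this]
    congr with x
    by_cases hx : ‖x‖⁻¹ • x ∈ A <;> simp [Set.indicator, hx, hh]
  have hK1 : S Set.univ * K = 1 := by
    have := key Set.univ MeasurableSet.univ
    simpa using this.symm
  have hK2 : K = (S Set.univ)⁻¹ := by
    rw [mul_comm] at hK1
    exact ENNReal.eq_inv_of_mul_eq_one_left hK1
  ext A hA
  rw [Measure.map_apply (by fun_prop) hA, key A hA, uniformSphere, Measure.map_apply
    measurable_subtype_coe hA, Measure.smul_apply, hK2, ← hS, smul_eq_mul, mul_comm]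

/-! ### Small overlaps of the initialization are unlikely -/

/-- The density is below `1`. This crude bound yields all small-ball estimates used for overlaps and
pivots. -/
theorem gaussianReal_le_volume (s : Set ℝ) : gaussianReal 0 1 s ≤ volume s := by
  rw [gaussianReal_apply _ one_ne_zero]
  calc ∫⁻ x in s, gaussianPDF 0 1 x ≤ ∫⁻ _ in s, 1 := by
        refine lintegral_mono fun x => ?_
        rw [gaussianPDF_def, ENNReal.ofReal_le_one, gaussianPDFReal_def]
        have h1 : 1 ≤ √(2 * Real.pi * (1 : ℝ≥0)) := by
          rw [Real.one_le_sqrt]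
          push_cast
          linarith [Real.pi_gt_three]
        have h2 : Real.exp (-(x - 0) ^ 2 / (2 * (1 : ℝ≥0))) ≤ 1 := by
          rw [Real.exp_le_one_iff]
          push_cast
          nlinarith [sq_nonneg (x - 0)]
        simp only
        exact mul_le_one₀ (inv_le_one_of_one_le₀ h1) (Real.exp_pos _).le h2
    _ = volume s := by simp

theorem gaussianReal_real_Icc_le {a b : ℝ} (hab : a ≤ b) :
    (gaussianReal 0 1).real (Set.Icc a b) ≤ b - a := by
  refine ENNReal.toReal_le_of_le_ofReal (by linarith) ?_
  exact (gaussianReal_le_volume _).trans (by rw [Real.volume_Icc])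

theorem gaussianReal_real_abs_le {a : ℝ} (ha : 0 ≤ a) :
    (gaussianReal 0 1).real {x | |x| ≤ a} ≤ 2 * a := by
  have h : {x : ℝ | |x| ≤ a} = Set.Icc (-a) a := by
    ext x
    simp [abs_le]
  rw [h]
  exact (gaussianReal_real_Icc_le (by linarith)).trans (by linarith)

theorem measureReal_mul_sqrt_le_norm_le {n : ℕ} (hn : 1 ≤ n) {s : ℝ} (hs : 0 < s) :
    (stdGaussian (EuclideanSpace ℝ (Fin n))).real {g | s * √n ≤ ‖g‖} ≤ 1 / s ^ 2 := by
  have hn0 : (0 : ℝ) < n := by exact_mod_cast hn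
  have hsq : ∀ g : EuclideanSpace ℝ (Fin n),
      ‖g‖ ^ 2 = ∑ i, ⟪EuclideanSpace.basisFun (Fin n) ℝ i, g⟫ ^ 2 := fun g =>
    ((EuclideanSpace.basisFun (Fin n) ℝ).sum_sq_inner_right g).symm
  have hterm : ∀ t : EuclideanSpace ℝ (Fin n), ‖t‖ = 1 →
      Integrable (fun g => ⟪t, g⟫ ^ 2) (stdGaussian _) ∧ ∫ g, ⟪t, g⟫ ^ 2 ∂stdGaussian _ = 1 := by
    intro t ht
    have hlaw := map_inner_stdGaussian t
    have h2 : MemLp (fun W => ⟪t, W⟫) 2 (stdGaussian (EuclideanSpace ℝ (Fin n))) := by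
      have h := memLp_id_gaussianReal (μ := 0) (v := ‖t‖₊ ^ 2) 2
      rw [← hlaw, memLp_map_measure_iff (by fun_prop) (by fun_prop)] at h
      simpa [Function.comp_def] using h
    refine ⟨h2.integrable_sq, ?_⟩
    have h := variance_fun_id_gaussianReal (μ := 0) (v := ‖t‖₊ ^ 2)
    rw [variance_of_integral_eq_zero (by fun_prop) (by simp), ← hlaw,
      integral_map (by fun_prop) (by fun_prop)] at h
    rw [h]
    push_cast
    rw [ht, one_pow]
  have hb := fun i => hterm _ ((EuclideanSpace.basisFun (Fin n) ℝ).orthonormal.1 i)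
  have hint : Integrable (fun g => ‖g‖ ^ 2) (stdGaussian (EuclideanSpace ℝ (Fin n))) := by
    simp_rw [hsq]
    exact integrable_finsetSum _ fun i _ => (hb i).1
  have hval : ∫ g, ‖g‖ ^ 2 ∂stdGaussian (EuclideanSpace ℝ (Fin n)) = n := by
    simp_rw [hsq]
    rw [integral_finsetSum _ fun i _ => (hb i).1, Finset.sum_congr rfl fun i _ => (hb i).2]
    simp
  have hset : {g : EuclideanSpace ℝ (Fin n) | s * √n ≤ ‖g‖} = {g | s ^ 2 * n ≤ ‖g‖ ^ 2} := by
    ext g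
    simp only [Set.mem_ofPred_eq]
    rw [← sq_le_sq₀ (by positivity) (norm_nonneg _), mul_pow, Real.sq_sqrt hn0.le]
  rw [hset, le_div_iff₀ (by positivity)]
  have := mul_meas_ge_le_integral_of_nonneg (μ := stdGaussian (EuclideanSpace ℝ (Fin n)))
    (f := fun g => ‖g‖ ^ 2) (Eventually.of_forall fun g => by positivity) hint (s ^ 2 * n)
  rw [hval] at this
  nlinarith

/-- For `u = g / ‖g‖`, a small overlap forces either a large norm of `g` or a small Gaussian
coordinate `⟨v, g⟩`. -/
theorem uniformSphere_abs_inner_le {n : ℕ} (hn : 1 ≤ n) {v : EuclideanSpace ℝ (Fin n)}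
    (hv : ‖v‖ = 1) {a s : ℝ} (ha : 0 ≤ a) (hs : 0 < s) :
    (uniformSphere n).real {u | |⟪u, v⟫| ≤ a} ≤ 1 / s ^ 2 + 2 * (a * (s * √n)) := by
  rw [uniformSphere_eq_map hn, map_measureReal_apply (by fun_prop)
    (measurableSet_le (by fun_prop) (by fun_prop))]
  have hsub : (fun g : EuclideanSpace ℝ (Fin n) => ‖g‖⁻¹ • g) ⁻¹' {u | |⟪u, v⟫| ≤ a} ⊆
      {g | s * √n ≤ ‖g‖} ∪ (fun g => ⟪v, g⟫) ⁻¹' {x | |x| ≤ a * (s * √n)} := by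
    intro g hg
    simp only [Set.mem_preimage, Set.mem_ofPred_eq, Set.mem_union, real_inner_smul_left] at hg ⊢
    by_contra! hcon
    have h0 : 0 < ‖g‖ := by
      rcases (norm_nonneg g).eq_or_lt with h | h
      · have : g = 0 := norm_eq_zero.1 h.symm
        have h2 := hcon.2
        simp only [this, inner_zero_right, abs_zero] at h2
        exact absurd h2 (not_lt.2 (by positivity))
      · exact h
    rw [abs_mul, abs_inv, abs_norm, inv_mul_le_iff₀ h0, real_inner_comm] at hg
    nlinarith [hcon.1, hcon.2]
  refine (measureReal_mono hsub).trans ((measureReal_union_le _ _).trans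
    (add_le_add (measureReal_mul_sqrt_le_norm_le hn hs) ?_))
  rw [← map_measureReal_apply (by fun_prop) (measurableSet_le (by fun_prop) (by fun_prop)),
    map_inner_stdGaussian]
  have : ‖v‖₊ ^ 2 = 1 := by
    ext
    simp [hv]
  rw [this]
  exact gaussianReal_real_abs_le (by positivity)

/-! ### The probability of selecting an index -/

/-- The overlaps `x_j` select the index `i`: the condition of `Selects`, on the overlaps. -/
def OverlapsSelect {r : ℕ} (k : ℕ) (κ : ℝ) (β : Fin r → ℝ) (i : Fin r) : Set (Fin r → ℝ) :=
  {x | (∀ j l, 1 / κ ≤ |x j / x l| ∧ |x j / x l| ≤ κ) ∧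
    ∀ j, j ≠ i → |β j * x j ^ (k - 2)| ≤ (1 - 1 / κ) * |β i * x i ^ (k - 2)|}

theorem measurableSet_overlapsSelect {r : ℕ} (k : ℕ) (κ : ℝ) (β : Fin r → ℝ) (i : Fin r) :
    MeasurableSet (OverlapsSelect k κ β i) := by
  simp only [OverlapsSelect, Set.ofPred_and, Set.ofPred_forall]
  refine MeasurableSet.inter ?_ ?_
  · refine MeasurableSet.iInter fun j => MeasurableSet.iInter fun l => ?_
    exact (measurableSet_le (by fun_prop) (by fun_prop)).inter
      (measurableSet_le (by fun_prop) (by fun_prop))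
  · refine MeasurableSet.iInter fun j => MeasurableSet.iInter fun _ => ?_
    exact measurableSet_le (by fun_prop) (by fun_prop)

/-- Scale invariance is what allows the overlaps of a uniform vector to be replaced by unnormalized
Gaussians. -/
theorem smul_mem_overlapsSelect_iff {r k : ℕ} {κ : ℝ} {β : Fin r → ℝ} {i : Fin r} {c : ℝ}
    (hc : c ≠ 0) (x : Fin r → ℝ) : c • x ∈ OverlapsSelect k κ β i ↔ x ∈ OverlapsSelect k κ β i := by
  have h1 : ∀ j l, (c • x) j / (c • x) l = x j / x l := fun j l => by
    simp [mul_div_mul_left _ _ hc]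
  have h2 : ∀ j, |β j * (c • x) j ^ (k - 2)| = |c| ^ (k - 2) * |β j * x j ^ (k - 2)| := fun j => by
    simp only [Pi.smul_apply, smul_eq_mul, mul_pow, abs_mul, abs_pow]
    ring
  have hp : 0 < |c| ^ (k - 2) := pow_pos (abs_pos.2 hc) _
  simp only [OverlapsSelect, Set.mem_ofPred_eq, h1, h2, mul_left_comm (1 - 1 / κ),
    mul_le_mul_iff_right₀ hp]

theorem ne_zero_of_mem_overlapsSelect {r k : ℕ} {κ : ℝ} (hκ : 1 ≤ κ) {β : Fin r → ℝ} {i : Fin r}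
    {x : Fin r → ℝ} (hx : x ∈ OverlapsSelect k κ β i) (j : Fin r) : x j ≠ 0 := by
  intro h
  have := (hx.1 j j).1
  rw [h, div_zero, abs_zero] at this
  have : 0 < 1 / κ := by positivity
  linarith

/-- The overlaps of a uniform vector with an orthonormal family, up to scaling, are independent
standard Gaussians. -/
theorem uniformSphere_overlaps {n r : ℕ} (hn : 1 ≤ n) {v : Fin r → EuclideanSpace ℝ (Fin n)}
    (hv : Orthonormal ℝ v) {S : Set (Fin r → ℝ)} (hS : MeasurableSet S)
    (hinv : ∀ c : ℝ, 0 < c → ∀ x, c • x ∈ S ↔ x ∈ S) :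
    (uniformSphere n).real {u | (fun j => ⟪u, v j⟫) ∈ S} =
      (Measure.pi fun _ => gaussianReal 0 1).real S := by
  have hm : Measurable fun (u : EuclideanSpace ℝ (Fin n)) j => ⟪u, v j⟫ := by fun_prop
  rw [uniformSphere_eq_map hn, map_measureReal_apply (by fun_prop) (s := {u | (fun j => ⟪u, v j⟫) ∈ S}) (hm hS),
    ← map_inner_orthonormal_stdGaussian hv, map_measureReal_apply (by fun_prop) hS]
  congr 1
  ext g
  have h : (fun j => ⟪‖g‖⁻¹ • g, v j⟫) = ‖g‖⁻¹ • fun j => ⟪v j, g⟫ := by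
    ext j
    simp [real_inner_smul_left, real_inner_comm g]
  simp only [Set.mem_preimage, Set.mem_ofPred_eq, h]
  rcases eq_or_ne g 0 with rfl | hg
  · simp
    rfl
  · exact hinv _ (by positivity) _

theorem gaussianReal_real_abs_lt {c : ℝ} (hc : 0 ≤ c) :
    (gaussianReal 0 1).real {y | |y| < c} =
      ∫ y in (0 : ℝ)..c, √(2 / Real.pi) * Real.exp (-y ^ 2 / 2) := by
  have hpdf : ∀ y, gaussianPDFReal 0 1 y = (√(2 * Real.pi))⁻¹ * Real.exp (-y ^ 2 / 2) := by
    intro y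
    rw [gaussianPDFReal_def]
    norm_num
  have hcst : √(2 / Real.pi) = 2 * (√(2 * Real.pi))⁻¹ := by
    rw [← Real.sqrt_inv, Real.sqrt_eq_iff_mul_self_eq (by positivity) (by positivity)]
    rw [mul_mul_mul_comm, Real.mul_self_sqrt (by positivity)]
    field_simp
  have hset : {y : ℝ | |y| < c} = Set.Ioo (-c) c := by
    ext y
    simp [abs_lt]
  rw [Measure.real, gaussianReal_apply_eq_integral _ one_ne_zero, ENNReal.toReal_ofReal
    (integral_nonneg fun y => gaussianPDFReal_nonneg _ _ _), hset, ← integral_Ioc_eq_integral_Ioo,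
    ← intervalIntegral.integral_of_le (by linarith)]
  have hii : ∀ a b : ℝ, IntervalIntegrable (gaussianPDFReal 0 1) volume a b := fun a b =>
    (integrable_gaussianPDFReal 0 1).intervalIntegrable
  rw [← intervalIntegral.integral_add_adjacent_intervals (hii (-c) 0) (hii 0 c)]
  have hneg : ∫ y in (-c)..0, gaussianPDFReal 0 1 y = ∫ y in (0 : ℝ)..c, gaussianPDFReal 0 1 y := by
    have := intervalIntegral.integral_comp_neg (a := 0) (b := c) (gaussianPDFReal 0 1)
    rw [neg_zero] at this
    rw [← this]
    congr with y
    simp [hpdf]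
  rw [hneg, ← two_mul, ← intervalIntegral.integral_const_mul]
  congr with y
  rw [hpdf, hcst]
  ring

theorem integral_gaussianReal_comp_abs (F : ℝ → ℝ) :
    ∫ x, F |x| ∂gaussianReal 0 1 =
      ∫ x in Set.Ioi (0 : ℝ), √(2 / Real.pi) * Real.exp (-x ^ 2 / 2) * F x := by
  have hcst : √(2 / Real.pi) = 2 * (√(2 * Real.pi))⁻¹ := by
    rw [← Real.sqrt_inv, Real.sqrt_eq_iff_mul_self_eq (by positivity) (by positivity)]
    rw [mul_mul_mul_comm, Real.mul_self_sqrt (by positivity)]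
    field_simp
  rw [integral_gaussianReal_eq_integral_smul one_ne_zero]
  have h := integral_comp_abs (f := fun x => gaussianPDFReal 0 1 x • F x)
  have h1 : ∀ x, gaussianPDFReal 0 1 |x| = gaussianPDFReal 0 1 x := fun x => by
    simp [gaussianPDFReal_def]
  simp only [h1] at h
  rw [h, ← integral_const_mul]
  congr with x
  rw [gaussianPDFReal_def, hcst, smul_eq_mul]
  norm_num
  ring

theorem abs_mul_pow_lt_iff {p : ℕ} (hp : p ≠ 0) {a b : ℝ} (ha : a ≠ 0) (y x : ℝ) :
    |a * y ^ p| < |b * x ^ p| ↔ |y| < (|b| / |a|) ^ (1 / (p : ℝ)) * |x| := by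
  have ha' : 0 < |a| := abs_pos.2 ha
  rw [← pow_lt_pow_iff_left₀ (abs_nonneg y) (by positivity) hp, mul_pow, one_div,
    Real.rpow_inv_natCast_pow (by positivity) hp, abs_mul, abs_mul, abs_pow, abs_pow, div_mul_eq_mul_div,
    lt_div_iff₀ ha', mul_comm]

/-- The mixture weight of `i` is the probability that `i` maximizes `j ↦ |β_j x_j^{k-2}|`, for
independent standard Gaussians `x_j`. -/
theorem pi_gaussian_real_argmax {r k : ℕ} (hk : 3 ≤ k) {β : Fin r → ℝ} (hβ : ∀ j, β j ≠ 0)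
    (i : Fin r) :
    (Measure.pi fun _ => gaussianReal 0 1).real
      {x : Fin r → ℝ | ∀ j, j ≠ i → |β j * x j ^ (k - 2)| < |β i * x i ^ (k - 2)|} =
      mixtureWeight k β i := by
  obtain ⟨q, rfl⟩ : ∃ q, r = q + 1 := ⟨r - 1, by have := i.2; omega⟩
  have hp : k - 2 ≠ 0 := by omega
  have hcast : ((k - 2 : ℕ) : ℝ) = (k : ℝ) - 2 := by
    rw [Nat.cast_sub (by omega)]
    norm_num
  set s : Fin (q + 1) → ℝ := fun l => (|β i| / |β l|) ^ (1 / ((k : ℝ) - 2)) with hs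
  have hs0 : ∀ l, 0 ≤ s l := fun l => by positivity
  set F : ℝ → ℝ := fun x => ∏ m : Fin q, (gaussianReal 0 1).real {y | |y| < s (i.succAbove m) * x}
    with hF
  have hmw : mixtureWeight k β i =
      ∫ x in Set.Ioi (0 : ℝ), √(2 / Real.pi) * Real.exp (-x ^ 2 / 2) * F x := by
    rw [mixtureWeight]
    refine setIntegral_congr_fun measurableSet_Ioi fun x hx => ?_
    have hx0 : 0 ≤ x := (Set.mem_Ioi.1 hx).le
    have himg : Finset.univ.erase i = Finset.univ.image i.succAbove := by
      rw [Fin.image_succAbove_univ, Finset.compl_singleton]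
    simp only [hF]
    rw [himg, Finset.prod_image fun a _ b _ h => Fin.succAbove_right_injective h]
    congr 1
    refine Finset.prod_congr rfl fun m _ => ?_
    rw [gaussianReal_real_abs_lt (mul_nonneg (hs0 _) hx0)]
  rw [hmw, ← integral_gaussianReal_comp_abs]
  have hmp := measurePreserving_piFinSuccAbove (fun _ : Fin (q + 1) => gaussianReal 0 1) i
  -- Coordinate `i` is split off. Given its value, the conditions on the other coordinates are
  -- independent, so Fubini gives the product in the mixture weight.
  set B : Set (ℝ × (Fin q → ℝ)) := {z | ∀ m, |z.2 m| < s (i.succAbove m) * |z.1|} with hB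
  have hBm : MeasurableSet B :=
    by
      rw [hB, Set.ofPred_forall]
      exact MeasurableSet.iInter fun m => measurableSet_lt (by fun_prop) (by fun_prop)
  have hpre : {x : Fin (q + 1) → ℝ | ∀ j, j ≠ i → |β j * x j ^ (k - 2)| < |β i * x i ^ (k - 2)|} =
      MeasurableEquiv.piFinSuccAbove (fun _ => ℝ) i ⁻¹' B := by
    ext x
    simp only [hB, Set.mem_ofPred_eq, Set.mem_preimage, MeasurableEquiv.piFinSuccAbove_apply]
    constructor
    · intro h m
      have := h _ (Fin.succAbove_ne i m)
      rwa [abs_mul_pow_lt_iff hp (hβ _), hcast] at this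
    · intro h j hj
      obtain ⟨m, rfl⟩ := Fin.exists_succAbove_eq hj
      have := h m
      rwa [abs_mul_pow_lt_iff hp (hβ _), hcast]
  rw [hpre, measureReal_def, hmp.measure_preimage hBm.nullMeasurableSet, Measure.prod_apply hBm,
    integral_eq_lintegral_of_nonneg_ae (Eventually.of_forall fun x => by positivity)]
  · congr 1
    refine lintegral_congr fun x => ?_
    have hsec : Prod.mk x ⁻¹' B = Set.univ.pi fun m => {y | |y| < s (i.succAbove m) * |x|} := by
      ext y
      simp [hB]
    rw [hsec, Measure.pi_pi, hF, ENNReal.ofReal_prod_of_nonneg fun m _ => measureReal_nonneg]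
    refine Finset.prod_congr rfl fun m _ => ?_
    rw [ofReal_measureReal]
  · have hsec : (fun x => F |x|) =
        fun x => (Measure.pi fun _ : Fin q => gaussianReal 0 1).real (Prod.mk x ⁻¹' B) := by
      ext x
      have hsec : Prod.mk x ⁻¹' B = Set.univ.pi fun m => {y | |y| < s (i.succAbove m) * |x|} := by
        ext y
        simp [hB]
      rw [hsec, measureReal_def, Measure.pi_pi, ENNReal.toReal_prod]
      rfl
    rw [hsec]
    exact (measurable_measure_prodMk_left hBm).ennreal_toReal.aestronglyMeasurable

theorem gaussianReal_real_le_abs {s : ℝ} (hs : 0 < s) :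
    (gaussianReal 0 1).real {x | s ≤ |x|} ≤ 4 / s ^ 2 := by
  have h := measureReal_le_abs_inner_le (t := (1 : ℝ)) (by simp) hs.le
  have hlaw := map_inner_stdGaussian (1 : ℝ)
  have h1 : gaussianReal 0 1 = gaussianReal 0 (‖(1 : ℝ)‖₊ ^ 2) := by simp
  rw [h1, ← hlaw, map_measureReal_apply (by fun_prop) (measurableSet_le (by fun_prop) (by fun_prop))]
  refine h.trans ?_
  have h2 : s ^ 2 / 2 + 1 ≤ Real.exp (s ^ 2 / 2) := Real.add_one_le_exp _
  rw [neg_div, Real.exp_neg, ← div_eq_mul_inv, div_le_div_iff₀ (Real.exp_pos _) (by positivity)]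
  linarith

theorem measurePreserving_eval_gaussian {r : ℕ} (j : Fin r) :
    MeasurePreserving (fun x : Fin r → ℝ => x j) (Measure.pi fun _ => gaussianReal 0 1)
      (gaussianReal 0 1) :=
  measurePreserving_eval (fun _ : Fin r => gaussianReal 0 1) j

/-- The overlap `x_j` is unlikely to be within a factor `1 - 1/κ` of a multiple of `|x_i|`. -/
theorem pi_gaussian_real_tie_le {r : ℕ} {i j : Fin r} (hij : j ≠ i) {κ s : ℝ} (hκ : 2 ≤ κ)
    (hs : 0 ≤ s) : (Measure.pi fun _ => gaussianReal 0 1).real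
      {x : Fin r → ℝ | (1 - 1 / κ) * (s * |x i|) ≤ |x j| ∧ |x j| ≤ s * |x i| ∧ |x j| ≤ √κ} ≤
      4 / √κ := by
  obtain ⟨q, rfl⟩ : ∃ q, r = q + 1 := ⟨r - 1, by have := i.2; omega⟩
  obtain ⟨m, rfl⟩ := Fin.exists_succAbove_eq hij
  have hκ0 : 0 < κ := by linarith
  have hκ1 : 1 / κ ≤ 1 / 2 := one_div_le_one_div_of_le (by norm_num) hκ
  have hmp := measurePreserving_piFinSuccAbove (fun _ : Fin (q + 1) => gaussianReal 0 1) i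
  set B : Set (ℝ × (Fin q → ℝ)) :=
    {z | (1 - 1 / κ) * (s * |z.1|) ≤ |z.2 m| ∧ |z.2 m| ≤ s * |z.1| ∧ |z.2 m| ≤ √κ} with hB
  have hBm : MeasurableSet B := by
    simp only [hB, Set.ofPred_and]
    exact (measurableSet_le (by fun_prop) (by fun_prop)).inter
      ((measurableSet_le (by fun_prop) (by fun_prop)).inter
        (measurableSet_le (by fun_prop) (by fun_prop)))
  change (Measure.pi fun _ => gaussianReal 0 1).real
    (MeasurableEquiv.piFinSuccAbove (fun _ => ℝ) i ⁻¹' B) ≤ _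
  refine ENNReal.toReal_le_of_le_ofReal (by positivity) ?_
  rw [hmp.measure_preimage hBm.nullMeasurableSet, Measure.prod_apply hBm]
  calc _ ≤ ∫⁻ _, ENNReal.ofReal (4 / √κ) ∂gaussianReal 0 1 := by
        refine lintegral_mono fun a => ?_
        set w := s * |a| with hw
        have hw0 : 0 ≤ w := by positivity
        have hsec : Prod.mk a ⁻¹' B = (fun y : Fin q → ℝ => y m) ⁻¹'
          {t | (1 - 1 / κ) * w ≤ |t| ∧ |t| ≤ w ∧ |t| ≤ √κ} := rfl
        have hD : MeasurableSet {t : ℝ | (1 - 1 / κ) * w ≤ |t| ∧ |t| ≤ w ∧ |t| ≤ √κ} := by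
          simp only [Set.ofPred_and]
          exact (measurableSet_le (by fun_prop) (by fun_prop)).inter
            ((measurableSet_le (by fun_prop) (by fun_prop)).inter
              (measurableSet_le (by fun_prop) (by fun_prop)))
        rw [hsec, (measurePreserving_eval_gaussian m).measure_preimage hD.nullMeasurableSet]
        -- Here `t` lies in two intervals of length `w / κ ≤ 2 / √κ`. In the other case `κ ≥ 2`
        -- gives `(1 - 1/κ) w ≥ w / 2 > √κ`, and the set is empty.
        by_cases hwκ : w ≤ 2 * √κ
        · have hsub : {t : ℝ | (1 - 1 / κ) * w ≤ |t| ∧ |t| ≤ w ∧ |t| ≤ √κ} ⊆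
              Set.Icc ((1 - 1 / κ) * w) w ∪ Set.Icc (-w) (-((1 - 1 / κ) * w)) := by
            rintro t ⟨h1, h2, -⟩
            rcases abs_cases t with ⟨h, -⟩ | ⟨h, -⟩ <;> rw [h] at h1 h2
            · exact Or.inl ⟨h1, h2⟩
            · exact Or.inr ⟨by linarith, by linarith⟩
          refine (measure_mono hsub).trans ((measure_union_le _ _).trans
            ((add_le_add (gaussianReal_le_volume _) (gaussianReal_le_volume _)).trans ?_))
          have h3 : 0 ≤ 1 / κ * w := by positivity
          rw [Real.volume_Icc, Real.volume_Icc, ← ENNReal.ofReal_add (by linarith) (by linarith)]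
          refine ENNReal.ofReal_le_ofReal ?_
          have h4 : 1 / κ * w ≤ 1 / κ * (2 * √κ) := by gcongr
          have h5 : 1 / κ * (2 * √κ) = 2 / √κ := by
            have : √κ * √κ = κ := Real.mul_self_sqrt hκ0.le
            field_simp
            nlinarith
          have h6 : (4 : ℝ) / √κ = 2 / √κ + 2 / √κ := by ring
          linarith
        · have hemp : {t : ℝ | (1 - 1 / κ) * w ≤ |t| ∧ |t| ≤ w ∧ |t| ≤ √κ} = ∅ := by
            refine Set.eq_empty_of_forall_notMem ?_
            rintro t ⟨h1, -, h3⟩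
            push Not at hwκ
            nlinarith
          rw [hemp]
          simp
    _ = _ := by simp

theorem overlapsSelect_subset {r k : ℕ} {κ : ℝ} (hκ : 1 ≤ κ) {β : Fin r → ℝ} {i : Fin r}
    (hβ : β i ≠ 0) : OverlapsSelect k κ β i ⊆
      {x | ∀ j, j ≠ i → |β j * x j ^ (k - 2)| < |β i * x i ^ (k - 2)|} := by
  intro x hx j hj
  refine (hx.2 j hj).trans_lt ?_
  have h1 : 0 < |β i * x i ^ (k - 2)| :=
    abs_pos.2 (mul_ne_zero hβ (pow_ne_zero _ (ne_zero_of_mem_overlapsSelect hκ hx i)))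
  have h2 : 0 < 1 / κ := by positivity
  nlinarith

/-- Being the maximizer without being selected requires some overlap to be below `1/√κ`, above `√κ`,
or nearly tied with the maximum. For each index these cost `2/√κ`, `4/√κ` and `4/√κ`. Overlaps
between `1/√κ` and `√κ` are automatically comparable up to `κ`. -/
theorem abs_overlapsSelect_sub_le {r k : ℕ} (hk : 3 ≤ k) {κ : ℝ} (hκ : 1 ≤ κ) {β : Fin r → ℝ}
    (hβ : ∀ j, β j ≠ 0) (i : Fin r) :
    |(Measure.pi fun _ => gaussianReal 0 1).real (OverlapsSelect k κ β i) - mixtureWeight k β i| ≤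
      10 * r / √κ := by
  rw [← pi_gaussian_real_argmax hk hβ i]
  set μ : Measure (Fin r → ℝ) := Measure.pi fun _ => gaussianReal 0 1 with hμ
  set A : Set (Fin r → ℝ) :=
    {x | ∀ j, j ≠ i → |β j * x j ^ (k - 2)| < |β i * x i ^ (k - 2)|} with hA
  have hsub : OverlapsSelect k κ β i ⊆ A := overlapsSelect_subset hκ (hβ i)
  have hr : (1 : ℝ) ≤ r := by
    have := i.2
    exact_mod_cast (by omega : 1 ≤ r)
  have hle := measureReal_mono (μ := μ) hsub
  have hκ0 : 0 < κ := by linarith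
  have hsκ : 0 < √κ := Real.sqrt_pos.2 hκ0
  rw [abs_sub_comm, abs_of_nonneg (by linarith)]
  -- For `κ < 2` the right-hand side is at least `1` and there is nothing to prove.
  rcases lt_or_ge κ 2 with h2 | h2
  · have h3 : √κ ≤ 2 := by
      rw [Real.sqrt_le_left (by norm_num)]
      linarith
    have h4 : μ.real A ≤ 1 := measureReal_le_one
    have h5 : 0 ≤ μ.real (OverlapsSelect k κ β i) := measureReal_nonneg
    have h6 : 1 ≤ 10 * r / √κ := by
      rw [le_div_iff₀ hsκ]
      linarith
    linarith
  have hp : k - 2 ≠ 0 := by omega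
  set s : Fin r → ℝ := fun l => (|β i| / |β l|) ^ (1 / ((k - 2 : ℕ) : ℝ)) with hs
  have hs0 : ∀ l, 0 ≤ s l := fun l => by positivity
  set D : Fin r → Set (Fin r → ℝ) := fun j =>
    ((fun x => x j) ⁻¹' {t | |t| ≤ 1 / √κ} ∪ (fun x => x j) ⁻¹' {t | √κ ≤ |t|}) ∪
      (if j = i then ∅ else
        {x | (1 - 1 / κ) * (s j * |x i|) ≤ |x j| ∧ |x j| ≤ s j * |x i| ∧ |x j| ≤ √κ}) with hD
  have hcover : A ⊆ OverlapsSelect k κ β i ∪ ⋃ j, D j := by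
    intro x hx
    by_contra hcon
    rw [Set.mem_union, not_or, Set.mem_iUnion, not_exists] at hcon
    obtain ⟨hnS, hnD⟩ := hcon
    have hlow : ∀ j, 1 / √κ < |x j| := fun j => by
      by_contra! h
      exact hnD j (Or.inl (Or.inl h))
    have hup : ∀ j, |x j| < √κ := fun j => by
      by_contra! h
      exact hnD j (Or.inl (Or.inr h))
    refine hnS ⟨fun j l => ?_, fun j hj => ?_⟩
    · have hratio : ∀ j l, |x j| ≤ κ * |x l| := fun j l => by
        have h1 : 1 < √κ * |x l| := by
          have := hlow l
          rw [div_lt_iff₀ hsκ] at this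
          linarith
        have h3 : √κ * √κ = κ := Real.mul_self_sqrt hκ0.le
        nlinarith [hup j]
      have hl : 0 < |x l| := lt_of_le_of_lt (by positivity) (hlow l)
      rw [abs_div]
      refine ⟨?_, ?_⟩
      · rw [div_le_div_iff₀ hκ0 hl]
        linarith [hratio l j]
      · rw [div_le_iff₀ hl]
        exact hratio j l
    · by_contra! hlt
      refine hnD j (Or.inr ?_)
      rw [if_neg hj]
      refine ⟨?_, ((abs_mul_pow_lt_iff hp (hβ j) _ _).1 (hx j hj)).le, (hup j).le⟩
      by_contra! hlt2
      have hκ1 : 1 / κ ≤ 1 := (div_le_one hκ0).2 hκ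
      have hl0 : 0 ≤ 1 - 1 / κ := by linarith
      -- An overlap smaller by the factor `1 - 1/κ` makes its `(k - 2)`-nd power smaller by at least
      -- that factor, since `k - 2 ≥ 1`. So the margin on overlaps implies the margin on their
      -- weighted powers.
      have hl1 : 1 - 1 / κ ≤ 1 := by
        have : 0 < 1 / κ := by positivity
        linarith
      have h3 : |x j| ^ (k - 2) ≤ ((1 - 1 / κ) * (s j * |x i|)) ^ (k - 2) :=
        pow_le_pow_left₀ (abs_nonneg _) hlt2.le _
      rw [mul_pow, mul_pow, hs, one_div (((k - 2 : ℕ) : ℝ)),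
        Real.rpow_inv_natCast_pow (by positivity) hp] at h3
      have hβj : 0 < |β j| := abs_pos.2 (hβ j)
      have h4 : |β j * x j ^ (k - 2)| ≤
          (1 - 1 / κ) ^ (k - 2) * |β i * x i ^ (k - 2)| := by
        rw [abs_mul, abs_mul, abs_pow, abs_pow]
        calc |β j| * |x j| ^ (k - 2) ≤
            |β j| * ((1 - 1 / κ) ^ (k - 2) * (|β i| / |β j| * |x i| ^ (k - 2))) := by gcongr
          _ = _ := by field_simp
      have h5 : (1 - 1 / κ) ^ (k - 2) ≤ 1 - 1 / κ := pow_le_of_le_one hl0 hl1 hp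
      have h6 : (1 - 1 / κ) ^ (k - 2) * |β i * x i ^ (k - 2)| ≤
          (1 - 1 / κ) * |β i * x i ^ (k - 2)| := by gcongr
      linarith
  have hDle : ∀ j, μ.real (D j) ≤ 10 / √κ := by
    intro j
    have h1 : μ.real ((fun x => x j) ⁻¹' {t | |t| ≤ 1 / √κ}) ≤ 2 * (1 / √κ) := by
      rw [measureReal_def, (measurePreserving_eval_gaussian j).measure_preimage
        (measurableSet_le (by fun_prop) (by fun_prop)).nullMeasurableSet]
      exact gaussianReal_real_abs_le (by positivity)
    have h3 : μ.real ((fun x => x j) ⁻¹' {t | √κ ≤ |t|}) ≤ 4 / √κ := by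
      rw [measureReal_def, (measurePreserving_eval_gaussian j).measure_preimage
        (measurableSet_le (by fun_prop) (by fun_prop)).nullMeasurableSet]
      refine (gaussianReal_real_le_abs hsκ).trans ?_
      have : 1 ≤ √κ := Real.one_le_sqrt.2 hκ
      gcongr
      nlinarith
    have h4 : μ.real (if j = i then ∅ else
        {x | (1 - 1 / κ) * (s j * |x i|) ≤ |x j| ∧ |x j| ≤ s j * |x i| ∧ |x j| ≤ √κ}) ≤
        4 / √κ := by
      split_ifs with hj
      · rw [measureReal_empty]
        positivity
      · exact pi_gaussian_real_tie_le hj h2 (hs0 j)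
    have h5 : (10 : ℝ) / √κ = 2 * (1 / √κ) + 4 / √κ + 4 / √κ := by ring
    rw [h5]
    exact (measureReal_union_le _ _).trans (add_le_add ((measureReal_union_le _ _).trans
      (add_le_add h1 h3)) h4)
  have h7 : μ.real A ≤ μ.real (OverlapsSelect k κ β i) + ∑ j, μ.real (D j) :=
    (measureReal_mono hcover).trans ((measureReal_union_le _ _).trans
      (add_le_add le_rfl (measureReal_iUnion_fintype_le _)))
  have h8 : ∑ j, μ.real (D j) ≤ 10 * r / √κ := by
    refine (Finset.sum_le_sum fun j _ => hDle j).trans (le_of_eq ?_)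
    rw [Finset.sum_const, Finset.card_univ, Fintype.card_fin, nsmul_eq_mul]
    ring
  linarith

/-- The Gaussian measure and the selection event are invariant under `x ↦ -x`, which exchanges the
two signs; selection excludes `x i = 0`. -/
theorem overlapsSelect_sign {r k : ℕ} {κ : ℝ} (hκ : 1 ≤ κ) {β : Fin r → ℝ} (i : Fin r) {σ : ℝ}
    (hσ : σ = 1 ∨ σ = -1) :
    (Measure.pi fun _ => gaussianReal 0 1).real (OverlapsSelect k κ β i ∩ {x | 0 < σ * x i}) =
      (Measure.pi fun _ => gaussianReal 0 1).real (OverlapsSelect k κ β i) / 2 := by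
  set μ : Measure (Fin r → ℝ) := Measure.pi fun _ => gaussianReal 0 1 with hμ
  set S := OverlapsSelect k κ β i with hS
  have hSm : MeasurableSet S := measurableSet_overlapsSelect k κ β i
  have hm : ∀ σ : ℝ, MeasurableSet {x : Fin r → ℝ | 0 < σ * x i} := fun σ =>
    measurableSet_lt (by fun_prop) (by fun_prop)
  have hneg : MeasurePreserving (fun x : Fin r → ℝ => -x) μ μ := by
    have h1 : MeasurePreserving (fun t : ℝ => -t) (gaussianReal 0 1) (gaussianReal 0 1) :=
      ⟨measurable_neg, by rw [gaussianReal_map_neg, neg_zero]⟩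
    exact measurePreserving_pi (fun _ : Fin r => gaussianReal 0 1)
      (fun _ : Fin r => gaussianReal 0 1) (f := fun _ => fun t : ℝ => -t) fun _ => h1
  have hsymm : μ.real (S ∩ {x | 0 < (-σ) * x i}) = μ.real (S ∩ {x | 0 < σ * x i}) := by
    rw [measureReal_def, measureReal_def,
      ← hneg.measure_preimage (hSm.inter (hm σ)).nullMeasurableSet]
    congr 2
    ext x
    have := smul_mem_overlapsSelect_iff (k := k) (κ := κ) (β := β) (i := i)
      (c := -1) (by norm_num) x
    rw [neg_one_smul] at this
    simp only [Set.mem_inter_iff, Set.mem_ofPred_eq, Set.mem_preimage, hS, this, Pi.neg_apply]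
    rw [neg_mul, mul_neg]
  have hunion : S = (S ∩ {x | 0 < σ * x i}) ∪ (S ∩ {x | 0 < (-σ) * x i}) := by
    rw [← Set.inter_union_distrib_left]
    refine (Set.inter_eq_left.2 fun x hx => ?_).symm
    have h0 := ne_zero_of_mem_overlapsSelect hκ hx i
    simp only [Set.mem_union, Set.mem_ofPred_eq]
    rcases hσ with rfl | rfl <;> rcases lt_or_gt_of_ne h0 with h | h
    · right; linarith
    · left; linarith
    · left; linarith
    · right; linarith
  have hdisj : Disjoint (S ∩ {x | 0 < σ * x i}) (S ∩ {x | 0 < (-σ) * x i}) := by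
    rw [Set.disjoint_left]
    rintro x ⟨-, h1⟩ ⟨-, h2⟩
    simp only [Set.mem_ofPred_eq] at h1 h2
    linarith
  have := measureReal_union (μ := μ) hdisj (hSm.inter (hm (-σ)))
  rw [← hunion, hsymm] at this
  linarith

/-! ### The overlaps of the power iteration with the spikes -/

theorem Selects.ne_zero {n r k : ℕ} {κ : ℝ} (hκ : 1 ≤ κ) {β : Fin r → ℝ}
    {v : Fin r → EuclideanSpace ℝ (Fin n)} {i : Fin r} {u : EuclideanSpace ℝ (Fin n)}
    (h : Selects k κ β v i u) (j : Fin r) : ⟪u, v j⟫ ≠ 0 :=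
  ne_zero_of_mem_overlapsSelect (k := k) (β := β) (i := i) hκ (x := fun j => ⟪u, v j⟫) h j

theorem Selects.abs_inner_le {n r k : ℕ} {κ : ℝ} (hκ : 1 ≤ κ) {β : Fin r → ℝ}
    {v : Fin r → EuclideanSpace ℝ (Fin n)} {i : Fin r} {u : EuclideanSpace ℝ (Fin n)}
    (h : Selects k κ β v i u) (j l : Fin r) : |⟪u, v j⟫| ≤ κ * |⟪u, v l⟫| := by
  have h1 := (h.1 j l).2
  rwa [abs_div, div_le_iff₀ (abs_pos.2 (h.ne_zero hκ l))] at h1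

/-- The maximizer has comparable overlaps with all spikes, so its strength is within a factor `κ ^
(k - 2)` of the largest one. Hence errors measured in `1 / |β i|` inherit the growth assumed for the
largest strength. -/
theorem Selects.abs_le_mul {n r k : ℕ} {κ : ℝ} (hκ : 1 ≤ κ) {β : Fin r → ℝ}
    {v : Fin r → EuclideanSpace ℝ (Fin n)} {i : Fin r} {u : EuclideanSpace ℝ (Fin n)}
    (h : Selects k κ β v i u) (j : Fin r) : |β j| ≤ κ ^ (k - 2) * |β i| := by
  rcases eq_or_ne j i with rfl | hj
  · exact le_mul_of_one_le_left (abs_nonneg _) (one_le_pow₀ hκ)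
  have hpos : 0 < |⟪u, v j⟫| ^ (k - 2) := pow_pos (abs_pos.2 (h.ne_zero hκ j)) _
  have h1 := h.2 j hj
  rw [abs_mul, abs_mul, abs_pow, abs_pow] at h1
  have h2 : (1 - 1 / κ) * (|β i| * |⟪u, v i⟫| ^ (k - 2)) ≤ 1 * (|β i| * |⟪u, v i⟫| ^ (k - 2)) := by
    gcongr
    have : 0 ≤ 1 / κ := by positivity
    linarith
  have h3 : |⟪u, v i⟫| ^ (k - 2) ≤ (κ * |⟪u, v j⟫|) ^ (k - 2) :=
    pow_le_pow_left₀ (abs_nonneg _) (h.abs_inner_le hκ i j) _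
  refine le_of_mul_le_mul_right ?_ hpos
  calc |β j| * |⟪u, v j⟫| ^ (k - 2) ≤ |β i| * (κ * |⟪u, v j⟫|) ^ (k - 2) := by
        refine h1.trans (h2.trans ?_)
        rw [one_mul]
        gcongr
    _ = _ := by rw [mul_pow]; ring

/-- The weights `(|β j| / |β i|) ^ (1/p)` turn a noiseless step into an exact `(p + 1)`-st power of
the rescaled ratios, and selection makes their initial values at most `θ * q0`. The last conclusion
concerns unweighted ratios, which the rescaled bound does not control when a weight is tiny. One
further step repairs this, because `|β j| |c j|^p` is controlled. -/
theorem powerIter_overlap_bounds {n r p τ : ℕ} (hp : 1 ≤ p) {β : Fin r → ℝ}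
    {v : Fin r → EuclideanSpace ℝ (Fin n)} (hv : Orthonormal ℝ v) {Z : Tensor n (p + 2)} {i : Fin r}
    {u : EuclideanSpace ℝ (Fin n)} (hu : ‖u‖ ≤ 1) {κ L ν₀ θ q0 η0 η1 a0 astar G : ℝ}
    (hκ : 1 ≤ κ) (hL : 0 < L) (hZ : InjBound Z L) (hsel : Selects (p + 2) κ β v i u)
    (hβ : β i ≠ 0)
    (hν : ∀ t < τ, ∀ j,
      |⟪v j, act Z (tensorPow (powerIter (observation β v Z) u t) (p + 2 - 1))⟫| ≤ ν₀)
    (hθ : 0 < θ) (hθ1 : θ < 1) (hq0 : 0 < q0) (hq1 : q0 ≤ 1) (hθq : 1 - 1 / κ ≤ (θ * q0) ^ p)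
    (ha0 : 0 < a0) (hc0 : a0 ≤ |⟪u, v i⟫|) (hastar : astar = 1 / (4 * (κ * r))) (ha0' : a0 ≤ astar)
    (hη0 : ν₀ ≤ η0 * (|β i| * a0 ^ (p + 1))) (hη0nn : 0 ≤ η0)
    (hη1 : η1 = L / (|β i| * astar ^ (p + 1)))
    (hη0θ : η0 ≤ (1 - θ) / 4) (hη1θ : η1 ≤ (1 - θ) / 4)
    (hη0q : κ * η0 ≤ (1 - θ) / 2 * (θ * q0 ^ (p + 1) ^ τ))
    (hδ : 2 * κ / (1 - θ) * η1 ≤ θ)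
    (hG1 : 1 ≤ G) (hG : G * (4 * L) ≤ |β i| * a0 ^ p) (hGτ : astar ≤ G ^ τ * a0) (t : ℕ) :
    0 < β i * ⟪powerIter (observation β v Z) u t, v i⟫ ^ (p + 1) *
      ⟪powerIter (observation β v Z) u (t + 1), v i⟫ ∧
    (τ ≤ t → astar ≤ |⟪powerIter (observation β v Z) u t, v i⟫|) ∧
    (τ ≤ t → ∀ j, j ≠ i → |⟪powerIter (observation β v Z) u (t + 1), v j⟫| ≤
      2 * (ratioBound p q0 θ (2 * κ / (1 - θ) * η1) t ^ p * κ + η1) *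
        |⟪powerIter (observation β v Z) u (t + 1), v i⟫|) := by
  set X := observation β v Z with hX
  set c : ℕ → Fin r → ℝ := fun t j => ⟪powerIter X u t, v j⟫ with hc
  set A : ℕ → EuclideanSpace ℝ (Fin n) := fun t => act X (tensorPow (powerIter X u t) (p + 2 - 1))
    with hA
  set ν : ℕ → Fin r → ℝ := fun t j => ⟪v j, act Z (tensorPow (powerIter X u t) (p + 2 - 1))⟫ with hνdef
  set s : Fin r → ℝ := fun j => (|β j| / |β i|) ^ (1 / (p : ℝ)) with hs
  have hp0 : p ≠ 0 := by omega
  have hb : 0 < |β i| := abs_pos.2 hβ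
  have hs0 : ∀ j, 0 ≤ s j := fun j => by positivity
  have hsp : ∀ j, s j ^ p = |β j| / |β i| := fun j => by
    rw [hs, one_div]
    exact Real.rpow_inv_natCast_pow (by positivity) hp0
  have hsp' : ∀ j, s j ^ p * |β i| = |β j| := fun j => by rw [hsp]; field_simp
  have hun : ∀ t, ‖powerIter X u t‖ ≤ 1 := norm_powerIter_le X hu
  have hinner : ∀ t j, ⟪v j, A t⟫ = β j * c t j ^ (p + 1) + ν t j := by
    intro t j
    rw [hA, hX, inner_act_observation, Finset.sum_eq_single j]
    · rw [real_inner_self_eq_norm_sq, hv.1 j]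
      simp [hc, hX, hνdef]
    · intro l _ hl
      rw [hv.2 hl.symm]
      simp
    · simp
  have hrec : ∀ t j, c (t + 1) j = (‖A t‖)⁻¹ * (β j * c t j ^ (p + 1) + ν t j) := by
    intro t j
    rw [← hinner, ← real_inner_smul_right, real_inner_comm]
    rfl
  have hZn : ∀ t, ‖act Z (tensorPow (powerIter X u t) (p + 2 - 1))‖ ≤ L := fun t =>
    hZ.norm_act_le hL.le (hun t)
  have hnrm : ∀ t, ‖A t‖ ≤ ∑ j, |β j| * |c t j| ^ (p + 1) + L := by
    intro t
    rw [hA]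
    simp only
    rw [hX, act_observation]
    refine (norm_add_le _ _).trans (add_le_add ((norm_sum_le _ _).trans
      (Finset.sum_le_sum fun j _ => ?_)) (hZn t))
    rw [norm_smul, hv.1 j, mul_one, Real.norm_eq_abs, abs_mul, abs_pow]
    rfl
  have hnrm' : ∀ t, |β i * c t i ^ (p + 1) + ν t i| ≤ ‖A t‖ := by
    intro t
    rw [← hinner]
    exact (abs_real_inner_le_norm _ _).trans (by rw [hv.1 i, one_mul])
  have hνL : ∀ t j, |ν t j| ≤ L := fun t j =>
    (abs_real_inner_le_norm _ _).trans (by rw [hv.1 j, one_mul]; exact hZn t)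
  have hsκ : ∀ j, s j ≤ κ := fun j => by
    refine le_of_pow_le_pow_left₀ hp0 (by linarith) ?_
    rw [hsp, div_le_iff₀ hb]
    exact hsel.abs_le_mul hκ j
  have hinit' : ∀ j, j ≠ i → s j * |c 0 j| ≤ θ * q0 * |c 0 i| := by
    intro j hj
    refine le_of_pow_le_pow_left₀ hp0 (by positivity) ?_
    have h1 := hsel.2 j hj
    rw [abs_mul, abs_mul, abs_pow, abs_pow] at h1
    rw [mul_pow, mul_pow, hsp, div_mul_eq_mul_div, div_le_iff₀ hb]
    have h2 : (1 - 1 / κ) * (|β i| * |⟪u, v i⟫| ^ p) ≤ (θ * q0) ^ p * (|β i| * |⟪u, v i⟫| ^ p) := by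
      gcongr
    refine (h1.trans h2).trans (le_of_eq ?_)
    simp only [hc, powerIter]
    ring
  have main := overlap_bounds hp i β s c ν (fun t => ‖A t‖) hκ hL hβ hs0 hsκ hsp' hrec hnrm hnrm' hνL
    hν hθ hθ1 hq0 hq1 (hsel.abs_inner_le hκ · i) hinit' ha0 hc0 hastar ha0' hη0 hη0nn hη1 hη0θ
    hη1θ hη0q hδ hG1 hG hGτ
  obtain ⟨h1, h2, h3, h4, h5⟩ := main t
  have hr : (1 : ℝ) ≤ r := by
    have : 0 < r := i.pos
    exact_mod_cast this
  have hast : 0 < astar := by rw [hastar]; positivity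
  have hci : 0 < |c t i| := lt_of_lt_of_le (lt_min hast (by positivity)) h3
  have hη : (if t < τ then η0 else η1) ≤ 1 / 2 := by split_ifs <;> linarith
  refine ⟨?_, fun ht => ?_, fun ht j hj => ?_⟩
  · change 0 < β i * c t i ^ (p + 1) * c (t + 1) i
    rw [hrec]
    set m := β i * c t i ^ (p + 1) with hm
    have hmabs : |m| = |β i| * |c t i| ^ (p + 1) := by rw [hm, abs_mul, abs_pow]
    have hm0 : 0 < |m| := by rw [hmabs]; positivity
    have h6 := h5 i
    rw [← hmabs] at h6
    have h7 : |ν t i| ≤ 1 / 2 * |m| := h6.trans (by gcongr)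
    have h8 : -(m * ν t i) ≤ |m| * |ν t i| := by rw [← abs_mul]; exact neg_le_abs _
    have h9 : 0 < m * (m + ν t i) := by nlinarith [sq_abs m]
    have h10 : m * ((‖A t‖)⁻¹ * (m + ν t i)) = (‖A t‖)⁻¹ * (m * (m + ν t i)) := by ring
    rw [h10]
    exact mul_pos (inv_pos.2 h4) h9
  · refine le_trans (le_min le_rfl ?_) h3
    refine hGτ.trans ?_
    gcongr
  · change |c (t + 1) j| ≤ _ * |c (t + 1) i|
    rw [hrec, hrec]
    rw [if_neg (by omega)] at h5 hη
    set M := ratioBound p q0 θ (2 * κ / (1 - θ) * η1) t with hM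
    have hM0 : 0 ≤ M := le_max_of_le_left (by positivity)
    have hη1nn : 0 ≤ η1 := by rw [hη1]; positivity
    refine overlap_step (h1 j) (pow_nonneg hM0 p) ?_ (h5 i) (h5 j) ?_ (by positivity)
    · calc |β j| * |c t j| ^ p = |β i| * (s j * |c t j|) ^ p := by rw [← hsp' j, mul_pow]; ring
        _ ≤ |β i| * (M * |c t i|) ^ p := by
            exact mul_le_mul_of_nonneg_left
              (pow_le_pow_left₀ (mul_nonneg (hs0 j) (abs_nonneg _)) (h2 j hj) p) hb.le
        _ = _ := by rw [mul_pow]; ring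
    · have h6 : 0 ≤ M ^ p * κ + η1 := by positivity
      nlinarith

/-! ### Asymptotics of the deterministic analysis -/

theorem tendsto_natCast_rpow_atTop {a : ℝ} (ha : 0 < a) :
    Tendsto (fun n : ℕ => (n : ℝ) ^ a) atTop atTop :=
  (tendsto_rpow_atTop ha).comp tendsto_natCast_atTop_atTop

theorem tendsto_natCast_rpow_neg {a : ℝ} (ha : 0 < a) :
    Tendsto (fun n : ℕ => (n : ℝ) ^ (-a)) atTop (𝓝 0) :=
  (tendsto_rpow_neg_atTop ha).comp tendsto_natCast_atTop_atTop

/-- The choices are initial overlap `n^(-(1/2+δ))`, early noise `n^(δ-1/2)`, relative noise `κ^p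
n^(-ε/2)` and growth factor `n^(ε/4)`. With `b ≥ κ^(-p) n^(p/2+ε)`, the early noise is at most `κ^p
n^((p+2)δ-ε)` times the signal. Also `b` times the `p`-th power of the initial overlap is at least
`κ^(-p) n^(ε-pδ)`. Both exponents work out because `(p + 2) δ = ε / 2`. -/
theorem eventually_parameters {p τ : ℕ} {κ L ε θ δ Q astar : ℝ} (hκ : 1 ≤ κ)
    (hε : 0 < ε) (hθ : 0 < θ) (hθ1 : θ < 1) (hQ : 0 < Q) (hδ : δ * (p + 2) = ε / 2)
    (hast : 0 < astar) (hast1 : astar ≤ 1) (hτ : 1 / 2 + δ ≤ ε / 4 * τ) (M : ℝ) :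
    ∀ᶠ n : ℕ in atTop, 1 ≤ n ∧ ∀ b : ℝ, (n : ℝ) ^ ((p : ℝ) / 2 + ε) ≤ κ ^ p * b →
      M ≤ b ∧ (n : ℝ) ^ (-(1 / 2 + δ)) ≤ astar ∧
      (n : ℝ) ^ δ / √n ≤ κ ^ p * (n : ℝ) ^ (-(ε / 2)) * (b * ((n : ℝ) ^ (-(1 / 2 + δ))) ^ (p + 1)) ∧
      κ ^ p * (n : ℝ) ^ (-(ε / 2)) ≤ (1 - θ) / 4 ∧
      L / (b * astar ^ (p + 1)) ≤ (1 - θ) / 4 ∧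
      κ * (κ ^ p * (n : ℝ) ^ (-(ε / 2))) ≤ Q ∧
      2 * κ / (1 - θ) * (L / (b * astar ^ (p + 1))) ≤ θ ∧
      1 ≤ (n : ℝ) ^ (ε / 4) ∧
      (n : ℝ) ^ (ε / 4) * (4 * L) ≤ b * ((n : ℝ) ^ (-(1 / 2 + δ))) ^ p ∧
      astar ≤ ((n : ℝ) ^ (ε / 4)) ^ τ * (n : ℝ) ^ (-(1 / 2 + δ)) := by
  have hP : 0 < κ ^ p := by positivity
  have hδ0 : 0 < δ := by
    by_contra! h
    nlinarith [mul_nonneg_of_nonpos_of_nonpos h (by linarith : -((p : ℝ) + 2) ≤ 0)]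
  have h1θ : 0 < 1 - θ := by linarith
  have hA : 0 < astar ^ (p + 1) := by positivity
  set M' := max (max M 1) (max (L / ((1 - θ) / 4 * astar ^ (p + 1)))
    (2 * κ / (1 - θ) * L / (θ * astar ^ (p + 1)))) with hM'
  have e1 := (tendsto_natCast_rpow_neg (a := ε / 2) (by positivity)).eventually_le_const
    (u := min ((1 - θ) / 4) (Q / κ) / κ ^ p) (by positivity)
  have e2 := (tendsto_natCast_rpow_neg (a := 1 / 2 + δ) (by positivity)).eventually_le_const hast
  have e3 := (tendsto_natCast_rpow_atTop (a := (p : ℝ) / 2 + ε) (by positivity)).eventually_ge_atTop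
    (κ ^ p * M')
  have e4 := (tendsto_natCast_rpow_atTop (a := ε / 4) (by positivity)).eventually_ge_atTop
    (max 1 (4 * L * κ ^ p))
  filter_upwards [e1, e2, e3, e4, eventually_ge_atTop 1] with n h1 h2 h3 h4 hn
  refine ⟨hn, fun b hb => ?_⟩
  have hn0 : (0 : ℝ) < n := by exact_mod_cast hn
  have hn1 : (1 : ℝ) ≤ n := by exact_mod_cast hn
  have hbM : M' ≤ b := le_of_mul_le_mul_left (h3.trans hb) hP
  have hb1 : 1 ≤ b := ((le_max_right M 1).trans (le_max_left _ _)).trans hbM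
  have hb0 : 0 < b := by linarith
  rw [le_div_iff₀ hP] at h1
  have h1a : κ ^ p * (n : ℝ) ^ (-(ε / 2)) ≤ (1 - θ) / 4 := by
    rw [mul_comm]
    exact h1.trans (min_le_left _ _)
  have h1b : κ ^ p * (n : ℝ) ^ (-(ε / 2)) ≤ Q / κ := by
    rw [mul_comm]
    exact h1.trans (min_le_right _ _)
  have hpow : ∀ (x : ℝ) (m : ℕ), ((n : ℝ) ^ x) ^ m = (n : ℝ) ^ (x * m) := fun x m => by
    rw [Real.rpow_mul hn0.le, Real.rpow_natCast]
  refine ⟨((le_max_left M 1).trans (le_max_left _ _)).trans hbM, h2, ?_, h1a, ?_, ?_, ?_,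
    (le_max_left _ _).trans h4, ?_, ?_⟩
  · have h5 : (n : ℝ) ^ δ / √n = (n : ℝ) ^ ((p : ℝ) / 2 + ε) *
        ((n : ℝ) ^ (-(ε / 2)) * ((n : ℝ) ^ (-(1 / 2 + δ))) ^ (p + 1)) := by
      rw [Real.sqrt_eq_rpow, ← Real.rpow_sub hn0, hpow, ← Real.rpow_add hn0, ← Real.rpow_add hn0]
      congr 1
      push_cast
      linear_combination hδ
    rw [h5]
    calc _ ≤ κ ^ p * b * ((n : ℝ) ^ (-(ε / 2)) * ((n : ℝ) ^ (-(1 / 2 + δ))) ^ (p + 1)) := by gcongr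
      _ = _ := by ring
  · have h5 := ((le_max_left _ _).trans (le_max_right (max M 1) _)).trans hbM
    rw [div_le_iff₀ (by positivity)] at h5 ⊢
    linarith
  · rw [mul_comm]
    exact (le_div_iff₀ (by linarith)).1 h1b
  · have h5 := ((le_max_right _ _).trans (le_max_right (max M 1) _)).trans hbM
    rw [div_le_iff₀ (by positivity)] at h5
    rw [← mul_div_assoc, div_le_iff₀ (by positivity)]
    linarith
  · refine le_of_mul_le_mul_left ?_ hP
    have h5 : (n : ℝ) ^ ((p : ℝ) / 2 + ε) * ((n : ℝ) ^ (-(1 / 2 + δ))) ^ p =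
        (n : ℝ) ^ (ε / 4) * (n : ℝ) ^ (ε / 4) * (n : ℝ) ^ (2 * δ) := by
      rw [hpow, ← Real.rpow_add hn0, ← Real.rpow_add hn0, ← Real.rpow_add hn0]
      congr 1
      linear_combination -hδ
    have h6 : 1 ≤ (n : ℝ) ^ (2 * δ) := Real.one_le_rpow hn1 (by positivity)
    have h7 := (le_max_right _ _).trans h4
    have h8 : 0 < (n : ℝ) ^ (ε / 4) := by positivity
    calc κ ^ p * ((n : ℝ) ^ (ε / 4) * (4 * L)) = (n : ℝ) ^ (ε / 4) * (4 * L * κ ^ p) := by ring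
      _ ≤ (n : ℝ) ^ (ε / 4) * (n : ℝ) ^ (ε / 4) := by gcongr
      _ ≤ (n : ℝ) ^ (ε / 4) * (n : ℝ) ^ (ε / 4) * (n : ℝ) ^ (2 * δ) :=
        le_mul_of_one_le_right (by positivity) h6
      _ = (n : ℝ) ^ ((p : ℝ) / 2 + ε) * ((n : ℝ) ^ (-(1 / 2 + δ))) ^ p := h5.symm
      _ ≤ κ ^ p * b * ((n : ℝ) ^ (-(1 / 2 + δ))) ^ p := by gcongr
      _ = _ := by ring
  · rw [hpow, ← Real.rpow_add hn0]
    exact hast1.trans (Real.one_le_rpow hn1 (by linarith))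

/-- Contraction parameters for the ratios of the overlaps. -/
theorem exists_contraction {p : ℕ} (hp : 1 ≤ p) {κ : ℝ} (hκ : 1 ≤ κ) : ∃ θ : ℝ, 0 < θ ∧ θ < 1 ∧
    1 - 1 / κ ≤ (θ * Real.exp (-(1 / (κ * p)))) ^ p := by
  have hp0 : p ≠ 0 := by omega
  have hκ0 : 0 < κ := by linarith
  -- The strict inequality `1 - 1/κ < exp(-1/κ)` lets the initial margin be shared between `q0`,
  -- whose powers determine the number of iterations, and a factor `θ < 1` reserved for the noise.
  set x := (1 - 1 / κ) * Real.exp (1 / κ) with hx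
  have hκ1 : 1 / κ ≤ 1 := (div_le_one hκ0).2 hκ
  have hx0 : 0 ≤ x := mul_nonneg (by linarith) (Real.exp_pos _).le
  have hx1 : x < 1 := by
    have h1 := Real.add_one_lt_exp (x := -(1 / κ)) (by
      have : 0 < 1 / κ := by positivity
      linarith)
    calc x < Real.exp (-(1 / κ)) * Real.exp (1 / κ) := by
          rw [hx]
          gcongr
          linarith
      _ = 1 := by rw [← Real.exp_add]; simp
  have hq : Real.exp (-(1 / (κ * p))) ^ p = (Real.exp (1 / κ))⁻¹ := by
    rw [← Real.exp_nat_mul, ← Real.exp_neg]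
    congr 1
    have : (p : ℝ) ≠ 0 := by exact_mod_cast hp0
    field_simp
  -- The `1 / 2` keeps `θ` positive when `κ = 1`, where `x = 0`.
  refine ⟨max (1 / 2) (x ^ (1 / (p : ℝ))), by positivity, max_lt (by norm_num)
    (Real.rpow_lt_one hx0 hx1 (by positivity)), ?_⟩
  rw [mul_pow, hq, ← div_eq_mul_inv, le_div_iff₀ (Real.exp_pos _)]
  calc x = (x ^ (1 / (p : ℝ))) ^ p := by rw [one_div, Real.rpow_inv_natCast_pow hx0 hp0]
    _ ≤ _ := by
      gcongr
      exact le_max_right _ _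

/-- The left side is `exp(-(p+1)^t / κ)`, and the condition on `t` says exactly `(p + 1)^t ≥ κ log
y`. This is the origin of the terms `log κ` and `log log` in the iteration count. -/
theorem exp_neg_pow_div_le {p t : ℕ} (hp : 1 ≤ p) {κ y : ℝ} (hκ : 1 ≤ κ) (hy : 1 < y)
    (ht : (Real.log κ + Real.log (Real.log y)) / Real.log ((p : ℝ) + 1) ≤ t) :
    Real.exp (-(1 / (κ * p))) ^ ((p + 1) ^ t * p) ≤ 1 / y := by
  have hly : 0 < Real.log y := Real.log_pos hy
  have hp1 : (1 : ℝ) ≤ p := by exact_mod_cast hp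
  have hlp : 0 < Real.log ((p : ℝ) + 1) := Real.log_pos (by linarith)
  rw [div_le_iff₀ hlp, ← Real.log_mul (by positivity) hly.ne', ← Real.log_pow] at ht
  have h1 : κ * Real.log y ≤ ((p : ℝ) + 1) ^ t :=
    (Real.log_le_log_iff (by positivity) (by positivity)).1 ht
  rw [← Real.exp_nat_mul, one_div y, ← Real.exp_log (inv_pos.2 (by linarith : 0 < y)), Real.log_inv,
    Real.exp_le_exp]
  push_cast
  have h2 : ((p : ℝ) + 1) ^ t * p * -(1 / (κ * p)) = -(((p : ℝ) + 1) ^ t / κ) := by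
    field_simp
  rw [h2, neg_le_neg_iff, le_div_iff₀ (by positivity)]
  linarith

set_option maxHeartbeats 1000000 in
/-- The power iteration, started at a vector which selects the index `i`, on the event that the
noise is bounded in injective norm and small along the spikes during the first `τ` steps. -/
theorem exists_powerIter_expansion {p : ℕ} (r : ℕ) [NeZero r] (hp : 1 ≤ p) {κ L ε : ℝ} (hκ : 1 ≤ κ)
    (hL : 1 ≤ L) (hε : 0 < ε) : ∃ (τ : ℕ) (D : ℝ), 1 ≤ D ∧ ∀ M : ℝ, ∀ᶠ n : ℕ in atTop,
    ∀ (β : Fin r → ℝ) (v : Fin r → EuclideanSpace ℝ (Fin n)) (Z : Tensor n (p + 2)) (i : Fin r)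
      (u : EuclideanSpace ℝ (Fin n)) (T : ℕ), Orthonormal ℝ v → β i ≠ 0 → (∀ j, |β j| ≤ |β 0|) →
      (n : ℝ) ^ ((p : ℝ) / 2 + ε) ≤ |β 0| → τ + 3 ≤ T →
      3 + (Real.log κ + Real.log (Real.log (√n * |β 0|))) / Real.log ((p : ℝ) + 1) ≤ T →
      InjBound Z L → ‖u‖ ≤ 1 → Selects (p + 2) κ β v i u →
      (n : ℝ) ^ (-(1 / 2 + ε / (2 * (p + 2)))) ≤ |⟪u, v i⟫| →
      (∀ t < τ, ∀ j, |⟪v j, act Z (tensorPow (powerIter (observation β v Z) u t) (p + 2 - 1))⟫| ≤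
        (n : ℝ) ^ (ε / (2 * (p + 2))) / √n) →
      M ≤ |β i| ∧ (∀ j, |β j| ≤ κ ^ p * |β i|) ∧
      ∀ s : ℕ → ℝ, (∀ t, s t ^ 2 = 1) → 0 < s 0 * ⟪u, v i⟫ →
        (∀ t, 0 < s (t + 1) * (β i * s t ^ (p + 1))) →
        ‖powerIter (observation β v Z) u T‖ = 1 ∧
        0 < s T * ⟪powerIter (observation β v Z) u T, v i⟫ ∧
        ‖rej (v i) (powerIter (observation β v Z) u T)‖ ≤ D / |β i| ∧
        ‖rej (v i) (powerIter (observation β v Z) u T) -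
          (s T / β i) • rej (v i) (act Z (tensorPow (v i) (p + 2 - 1)))‖ ≤ D / |β i| ^ 2 ∧
        |strengthEst (observation β v Z) (powerIter (observation β v Z) u T) -
          s T ^ (p + 2) * (β i + mform Z fun _ => v i)| ≤ D / |β i| := by
  obtain ⟨θ, hθ, hθ1, hθq⟩ := exists_contraction hp hκ
  set δ := ε / (2 * ((p : ℝ) + 2)) with hδ
  have hδ' : δ * (p + 2) = ε / 2 := by rw [hδ]; field_simp
  set q0 := Real.exp (-(1 / (κ * p))) with hq0
  have hp1 : (1 : ℝ) ≤ p := by exact_mod_cast hp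
  have hr : (1 : ℝ) ≤ r := by exact_mod_cast NeZero.one_le
  have hκ0 : 0 < κ := by linarith
  have hL0 : 0 < L := by linarith
  have hq0pos : 0 < q0 := Real.exp_pos _
  have hq01 : q0 ≤ 1 := by
    rw [hq0, Real.exp_le_one_iff, neg_nonpos]
    positivity
  -- With growth `n^(ε/4)` per step, `τ` steps lift an overlap `n^(-(1/2+δ))` to constant order. The
  -- number `τ` does not depend on `n`.
  obtain ⟨τ, hτ⟩ := exists_nat_ge ((1 / 2 + δ) / (ε / 4))
  rw [div_le_iff₀ (by positivity)] at hτ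
  set astar := 1 / (4 * (κ * r)) with hastar
  have hast : 0 < astar := by positivity
  have hκr : 1 ≤ κ * r := one_le_mul_of_one_le_of_one_le hκ hr
  have hast1 : astar ≤ 1 := by
    rw [hastar, div_le_one (by positivity)]
    linarith
  have h1θ : 0 < 1 - θ := by linarith
  set E1 := L / astar ^ (p + 1) with hE1
  have hE1pos : 0 < E1 := by positivity
  set E := 2 * κ / (1 - θ) * E1 with hE
  have hEpos : 0 < E := by positivity
  set C₀ := 2 * ((1 + E) * κ + E1) with hC₀
  have hC₀pos : 0 < C₀ := by positivity
  obtain ⟨C₁, hC₁, step1⟩ := exists_norm_rej_powerStep_le (p + 2) r (by omega) (K := κ ^ p) (L := L)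
    (a := astar) (C₀ := C₀) (by positivity) hL0.le hast hC₀pos.le
  obtain ⟨D, hD, step2⟩ := exists_powerStep_expansion (p + 2) r (by omega) (K := κ ^ p) (L := L)
    (C₁ := C₁) (by positivity) hL0.le (by linarith)
  refine ⟨τ, D, hD, fun M => ?_⟩
  filter_upwards [eventually_parameters (p := p) (τ := τ) (κ := κ) (L := L) (ε := ε) (θ := θ) (δ := δ)
    (Q := (1 - θ) / 2 * (θ * q0 ^ (p + 1) ^ τ)) (astar := astar) hκ hε hθ hθ1 (by positivity) hδ'
    hast hast1 (by linarith) (max (max M 1) (max C₁ D)), eventually_ge_atTop 3]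
    with n hpar hn3 β v Z i u T hv hβ hβ0 hbig hT1 hT2 hZ hu hsel hu0 hν
  obtain ⟨hn, hpar⟩ := hpar
  have hK : ∀ j, |β j| ≤ κ ^ p * |β i| := fun j => hsel.abs_le_mul hκ j
  obtain ⟨hM, ha0', hη0, hη0θ, hη1θ, hη0q, hδθ, hG1, hG, hGτ⟩ := hpar |β i| (hbig.trans (hK 0))
  have hMM := ((le_max_left M 1).trans (le_max_left _ _)).trans hM
  have hb1 := ((le_max_right M 1).trans (le_max_left _ _)).trans hM
  have hbC₁ := ((le_max_left C₁ D).trans (le_max_right _ _)).trans hM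
  have hbD := ((le_max_right C₁ D).trans (le_max_right _ _)).trans hM
  refine ⟨hMM, hK, fun s hs hs0 hsrec => ?_⟩
  have hn0 : (0 : ℝ) < n := by exact_mod_cast hn
  have hb0 : 0 < |β i| := by linarith
  have key := powerIter_overlap_bounds hp hv hu hκ hL0 hZ hsel hβ hν hθ hθ1 hq0pos hq01 hθq
    (by positivity) hu0 hastar ha0' hη0 (by positivity) rfl hη0θ hη1θ hη0q hδθ hG1 hG hGτ
  -- `t` steps make the rescaled ratios small and one more the unweighted ratios `O(1/β)`. The next
  -- makes the whole orthogonal component `O(1/β)`, and the last gives the expansion.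
  obtain ⟨t, rfl⟩ : ∃ t, T = t + 3 := ⟨T - 3, by omega⟩
  have htτ : τ ≤ t := by omega
  set X := observation β v Z with hX
  have hsign : ∀ t, 0 < s t * ⟪powerIter X u t, v i⟫ := by
    intro t
    induction t with
    | zero => exact hs0
    | succ t ih =>
      have h1 := (key t).1
      have h2 := hsrec t
      have h3 : 0 < (s t * ⟪powerIter X u t, v i⟫) ^ (p + 1) := pow_pos ih _
      rw [mul_pow] at h3
      have h4 : 0 < (s t ^ (p + 1) * ⟪powerIter X u t, v i⟫ ^ (p + 1)) *
          ((s (t + 1) * (β i * s t ^ (p + 1))) * (β i * ⟪powerIter X u t, v i⟫ ^ (p + 1) *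
            ⟪powerIter X u (t + 1), v i⟫)) := mul_pos h3 (mul_pos h2 h1)
      have h5 : (s t ^ (p + 1) * ⟪powerIter X u t, v i⟫ ^ (p + 1)) *
          ((s (t + 1) * (β i * s t ^ (p + 1))) * (β i * ⟪powerIter X u t, v i⟫ ^ (p + 1) *
            ⟪powerIter X u (t + 1), v i⟫)) =
          (s (t + 1) * ⟪powerIter X u (t + 1), v i⟫) *
            (β i * s t ^ (p + 1) * ⟪powerIter X u t, v i⟫ ^ (p + 1)) ^ 2 := by ring
      rw [h5] at h4
      exact pos_of_mul_pos_left h4 (sq_nonneg _)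
  have hsmall : ∀ j, j ≠ i → |⟪powerIter X u (t + 1), v j⟫| ≤ C₀ / |β i| := by
    intro j hj
    refine ((key t).2.2 htτ j hj).trans ?_
    have hci : |⟪powerIter X u (t + 1), v i⟫| ≤ 1 := by
      refine (abs_real_inner_le_norm _ _).trans ?_
      rw [hv.1 i, mul_one]
      exact norm_powerIter_le X hu _
    have hη1 : L / (|β i| * astar ^ (p + 1)) = E1 / |β i| := by
      rw [hE1, div_div, mul_comm]
    rw [hη1] at hδθ ⊢
    have hδE : 2 * κ / (1 - θ) * (E1 / |β i|) = E / |β i| := by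
      rw [hE]
      ring
    rw [hδE] at hδθ ⊢
    have hρ : ratioBound p q0 θ (E / |β i|) t ^ p ≤ (1 + E) / |β i| := by
      unfold ratioBound
      have hp0 : p ≠ 0 := by omega
      rcases le_total (θ * q0 ^ (p + 1) ^ t) (E / |β i|) with h | h
      · rw [max_eq_right h]
        refine (pow_le_of_le_one (by positivity) (hδθ.trans hθ1.le) hp0).trans ?_
        gcongr
        linarith
      · rw [max_eq_left h, mul_pow, ← pow_mul]
        have hy1 : |β i| ≤ √n * |β 0| := by
          have h1 : 1 ≤ √(n : ℝ) := Real.one_le_sqrt.2 (by exact_mod_cast hn)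
          exact (hβ0 i).trans (le_mul_of_one_le_left (abs_nonneg _) h1)
        have hy : 1 < √n * |β 0| := by
          have h1 : 1 < √(n : ℝ) := by
            rw [Real.lt_sqrt (by norm_num)]
            have : (3 : ℝ) ≤ n := by exact_mod_cast hn3
            linarith
          exact h1.trans_le (le_mul_of_one_le_right (Real.sqrt_nonneg _) (hb1.trans (hβ0 i)))
        have hle := exp_neg_pow_div_le (t := t) hp hκ hy (by
          push_cast at hT2
          linarith)
        calc θ ^ p * q0 ^ ((p + 1) ^ t * p) ≤ 1 * (1 / (√n * |β 0|)) := by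
              gcongr
              exact pow_le_one₀ hθ.le hθ1.le
          _ ≤ 1 * (1 / |β i|) := by gcongr
          _ ≤ (1 + E) / |β i| := by
              rw [one_mul]
              gcongr
              linarith
    have hρ0 : 0 ≤ ratioBound p q0 θ (E / |β i|) t ^ p :=
      pow_nonneg (le_max_of_le_left (by positivity)) p
    calc 2 * (ratioBound p q0 θ (E / |β i|) t ^ p * κ + E1 / |β i|) *
          |⟪powerIter X u (t + 1), v i⟫| ≤
        2 * ((1 + E) / |β i| * κ + E1 / |β i|) * 1 := by gcongr
      _ = C₀ / |β i| := by rw [hC₀]; ring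
  have h1 := step1 n β v Z i (powerIter X u (t + 1)) hv hZ hbC₁ hK (norm_powerIter_le X hu _)
    ((key (t + 1)).2.1 (by omega)) hsmall
  exact ⟨(step2 n β v Z i (powerIter X u (t + 2)) (s (t + 3)) hv hZ hbD hK h1.1 h1.2 (hs _)
    (hsign (t + 3))).1, hsign (t + 3), (step2 n β v Z i (powerIter X u (t + 2)) (s (t + 3)) hv hZ hbD
    hK h1.1 h1.2 (hs _) (hsign (t + 3))).2⟩

/-! ### The noise and the initialization -/

section Noise

variable {Ω : Type*} [MeasurableSpace Ω] {P : Measure Ω}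

theorem HasLaw.measureReal_preimage_le {S : Type*} [MeasurableSpace S]
    {μ : Measure S} [IsFiniteMeasure μ] {f : Ω → S} (hf : HasLaw f μ P) (s : Set S) :
    P.real {ω | f ω ∈ s} ≤ μ.real s := by
  refine ENNReal.toReal_mono (measure_ne_top _ _) ?_
  have := Measure.le_map_apply hf.aemeasurable s
  rwa [hf.map_eq] at this

theorem HasLaw.measureReal_preimage {S : Type*} [MeasurableSpace S]
    {μ : Measure S} {f : Ω → S} (hf : HasLaw f μ P) {s : Set S} (hs : MeasurableSet s) :
    P.real {ω | f ω ∈ s} = μ.real s :=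
  hf.measureReal_eq hs

theorem isProbabilityMeasure_uniformSphere {n : ℕ} (hn : 1 ≤ n) :
    IsProbabilityMeasure (uniformSphere n) := by
  rw [uniformSphere_eq_map hn]
  exact Measure.isProbabilityMeasure_map (by fun_prop)

theorem uniformSphere_norm_le {n : ℕ} (hn : 1 ≤ n) : ∀ᵐ x ∂uniformSphere n, ‖x‖ ≤ 1 := by
  rw [uniformSphere_eq_map hn, ae_map_iff (by fun_prop) (measurableSet_le (by fun_prop) (by fun_prop))]
  refine Eventually.of_forall fun g => ?_
  rw [norm_smul, norm_inv, norm_norm]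
  exact inv_mul_le_one

/-- The noise tensor is `noiseTensor W` for a standard Gaussian `W`, independent of the
initialization. -/
theorem IsNoiseAndInit.exists_stdGaussian [IsProbabilityMeasure P] {n k : ℕ} (hn : 1 ≤ n)
    {Z : Ω → Tensor n k} {u : Ω → EuclideanSpace ℝ (Fin n)} (h : IsNoiseAndInit P Z u) :
    ∃ W : Ω → EuclideanSpace ℝ (Fin k → Fin n), (∀ ω, Z ω = noiseTensor (W ω)) ∧
      HasLaw W (stdGaussian _) P ∧ HasLaw (fun ω => (u ω, W ω)) ((uniformSphere n).prod (stdGaussian _)) P := by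
  have hn0 : (0 : ℝ) < n := by exact_mod_cast hn
  have hsn : √(n : ℝ) ≠ 0 := (Real.sqrt_pos.2 hn0).ne'
  have hZlaw : HasLaw (fun ω I => √n * Z ω I)
      (Measure.pi fun _ : Fin k → Fin n => gaussianReal 0 1) P := by
    have hind := h.noise_indep.comp (fun _ x => √n * x) fun _ => by fun_prop
    refine hind.hasLaw_pi fun I => ?_
    have hl := gaussianReal_const_mul (h.noise_law I) (√n)
    have hvar : (NNReal.mk (√(n : ℝ) ^ 2) (sq_nonneg _)) * (1 / (n : ℝ≥0)) = 1 := by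
      ext
      push_cast
      rw [Real.sq_sqrt hn0.le]
      field_simp
    rw [hvar, mul_zero] at hl
    exact hl
  set W : Ω → EuclideanSpace ℝ (Fin k → Fin n) := fun ω => WithLp.toLp 2 fun I => √n * Z ω I with hW
  have hWlaw : HasLaw W (stdGaussian (EuclideanSpace ℝ (Fin k → Fin n))) P :=
    HasLaw.fun_comp ⟨by fun_prop, map_pi_eq_stdGaussian⟩ hZlaw
  refine ⟨W, fun ω => ?_, hWlaw, ?_⟩
  · ext I
    simp [noiseTensor, hW, hsn]
  · have := isProbabilityMeasure_uniformSphere hn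
    have hind : IndepFun u W P := h.init_indep.comp (φ := id)
      (ψ := fun z : Tensor n k => (WithLp.toLp 2 fun I => √n * z I : EuclideanSpace ℝ _))
      measurable_id (by fun_prop)
    exact (indepFun_iff_hasLaw_prodMk_prod h.init_law hWlaw).1 hind

theorem IsNoiseAndInit.measureReal_init [IsProbabilityMeasure P] {n k : ℕ}
    {Z : Ω → Tensor n k} {u : Ω → EuclideanSpace ℝ (Fin n)} (h : IsNoiseAndInit P Z u)
    {S : Set (EuclideanSpace ℝ (Fin n))} (hS : MeasurableSet S) :
    P.real {ω | u ω ∈ S} = (uniformSphere n).real S :=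
  HasLaw.measureReal_preimage h.init_law hS

theorem measurableSet_selects {n r : ℕ} (k : ℕ) (κ : ℝ) (β : Fin r → ℝ)
    (v : Fin r → EuclideanSpace ℝ (Fin n)) (i : Fin r) : MeasurableSet {u | Selects k κ β v i u} :=
  (by fun_prop : Measurable fun (u : EuclideanSpace ℝ (Fin n)) j => ⟪u, v j⟫)
    (measurableSet_overlapsSelect k κ β i)

/-- The probability that the initialization selects `i`. -/
theorem IsNoiseAndInit.abs_measureReal_selects_sub_le [IsProbabilityMeasure P] {n k r : ℕ} (hn : 1 ≤ n)
    (hk : 3 ≤ k) {κ : ℝ} (hκ : 1 ≤ κ) {β : Fin r → ℝ} (hβ : ∀ j, β j ≠ 0)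
    {v : Fin r → EuclideanSpace ℝ (Fin n)} (hv : Orthonormal ℝ v) (i : Fin r)
    {Z : Ω → Tensor n k} {u : Ω → EuclideanSpace ℝ (Fin n)} (h : IsNoiseAndInit P Z u) :
    |P.real {ω | Selects k κ β v i (u ω)} - mixtureWeight k β i| ≤ 10 * r / √κ := by
  have h1 := h.measureReal_init (measurableSet_selects k κ β v i)
  have h2 := uniformSphere_overlaps hn hv (measurableSet_overlapsSelect k κ β i)
    fun c hc x => smul_mem_overlapsSelect_iff hc.ne' x
  have h3 : P.real {ω | Selects k κ β v i (u ω)} =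
      (Measure.pi fun _ => gaussianReal 0 1).real (OverlapsSelect k κ β i) := h1.trans h2
  rw [h3]
  exact abs_overlapsSelect_sub_le hk hκ hβ i

theorem IsNoiseAndInit.abs_measureReal_selects_sign_sub_le [IsProbabilityMeasure P] {n k r : ℕ}
    (hn : 1 ≤ n) (hk : 3 ≤ k) {κ : ℝ} (hκ : 1 ≤ κ) {β : Fin r → ℝ} (hβ : ∀ j, β j ≠ 0)
    {v : Fin r → EuclideanSpace ℝ (Fin n)} (hv : Orthonormal ℝ v) (i : Fin r)
    {Z : Ω → Tensor n k} {u : Ω → EuclideanSpace ℝ (Fin n)} (h : IsNoiseAndInit P Z u) {σ : ℝ}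
    (hσ : σ = 1 ∨ σ = -1) :
    |P.real ({ω | Selects k κ β v i (u ω)} ∩ {ω | 0 < σ * ⟪u ω, v i⟫}) - mixtureWeight k β i / 2| ≤
      10 * r / √κ := by
  have hm : MeasurableSet {x : Fin r → ℝ | 0 < σ * x i} := measurableSet_lt (by fun_prop) (by fun_prop)
  have h1 := h.measureReal_init ((measurableSet_selects k κ β v i).inter
    (measurableSet_lt (f := fun _ => (0 : ℝ)) (g := fun x => σ * ⟪x, v i⟫) (by fun_prop) (by fun_prop)))
  have h2 := uniformSphere_overlaps hn hv ((measurableSet_overlapsSelect k κ β i).inter hm)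
    fun c hc x => by
      refine and_congr (smul_mem_overlapsSelect_iff hc.ne' x) ?_
      simp only [Set.mem_ofPred_eq, Pi.smul_apply, smul_eq_mul, mul_left_comm σ c,
        mul_pos_iff_of_pos_left hc]
  have h3 : P.real ({ω | Selects k κ β v i (u ω)} ∩ {ω | 0 < σ * ⟪u ω, v i⟫}) =
      (Measure.pi fun _ => gaussianReal 0 1).real (OverlapsSelect k κ β i ∩ {x | 0 < σ * x i}) :=
    h1.trans h2
  rw [h3, overlapsSelect_sign hκ i hσ, ← sub_div, abs_div, abs_two]
  have h4 := abs_overlapsSelect_sub_le hk hκ hβ i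
  have h5 := abs_nonneg ((Measure.pi fun _ => gaussianReal 0 1).real (OverlapsSelect k κ β i) -
    mixtureWeight k β i)
  linarith

theorem measurable_noise_overlap {n k r : ℕ} [NeZero k] (β : Fin r → ℝ)
    (v : Fin r → EuclideanSpace ℝ (Fin n)) (t : ℕ) (j : Fin r) :
    Measurable fun x : EuclideanSpace ℝ (Fin n) × EuclideanSpace ℝ (Fin k → Fin n) =>
      ⟪v j, act (noiseTensor x.2)
        (tensorPow (powerIter (observation β v (noiseTensor x.2)) x.1 t) (k - 1))⟫ := by
  have h1 : Measurable fun W : EuclideanSpace ℝ (Fin k → Fin n) => noiseTensor W := by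
    refine measurable_pi_lambda _ fun I => ?_
    unfold noiseTensor
    fun_prop
  have h2 := measurable_act (h1.comp measurable_snd) (measurable_tensorPow (m := k - 1)
    (measurable_powerIter ((measurable_observation_noiseTensor (k := k) β v).comp
      (measurable_snd (α := EuclideanSpace ℝ (Fin n)))) measurable_fst t))
  exact measurable_const.inner h2

/-- With high probability the noise is bounded in injective norm and small along the spikes during
the first steps, and the initial overlap is not too small. -/
theorem exists_noise_event (k : ℕ) [NeZero k] : ∃ L : ℝ, 1 ≤ L ∧ ∀ r τ : ℕ, ∃ c : ℝ, 0 ≤ c ∧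
    ∀ (n : ℕ), 1 ≤ n → ∀ {Ω : Type*} [MeasurableSpace Ω] (P : Measure Ω) [IsProbabilityMeasure P]
      (Z : Ω → Tensor n k) (u : Ω → EuclideanSpace ℝ (Fin n)), IsNoiseAndInit P Z u →
      ∀ (β : Fin r → ℝ) (v : Fin r → EuclideanSpace ℝ (Fin n)), Orthonormal ℝ v → ∀ i : Fin r,
      ∀ a s l : ℝ, 0 ≤ a → 0 < s → 0 < l →
      P.real {ω | ¬(InjBound (Z ω) L ∧ ‖u ω‖ ≤ 1 ∧ a ≤ |⟪u ω, v i⟫| ∧ ∀ t < τ, ∀ j,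
        |⟪v j, act (Z ω) (tensorPow (powerIter (observation β v (Z ω)) (u ω) t) (k - 1))⟫| ≤
          l / √n)} ≤ 2 * Real.exp (-n) + (1 / s ^ 2 + 2 * (a * (s * √n))) + c / l := by
  obtain ⟨L, hL, hinj⟩ := exists_injBound_noiseTensor k
  refine ⟨L, hL, fun r τ => ?_⟩
  obtain ⟨c, hc, hov⟩ := exists_noise_overlap_bound k r τ
  refine ⟨c, hc, ?_⟩
  intro n hn Ω _ P _ Z u h β v hv i a s l ha hs hl
  have hprob := isProbabilityMeasure_uniformSphere hn
  obtain ⟨W, hZW, hW, hlaw⟩ := h.exists_stdGaussian hn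
  have b1 : P.real {ω | ¬InjBound (Z ω) L} ≤ 2 * Real.exp (-n) := by
    simp_rw [hZW]
    exact (HasLaw.measureReal_preimage_le hW {W | ¬InjBound (noiseTensor W) L}).trans (hinj n hn)
  have b2 : P.real {ω | ¬‖u ω‖ ≤ 1} = 0 := by
    have := h.measureReal_init (measurableSet_le (f := fun x : EuclideanSpace ℝ (Fin n) => ‖x‖)
      (g := fun _ => 1) (by fun_prop) (by fun_prop)).compl
    refine this.trans ?_
    rw [measureReal_def]
    have h0 : uniformSphere n {x | ‖x‖ ≤ 1}ᶜ = 0 := uniformSphere_norm_le hn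
    rw [h0, ENNReal.toReal_zero]
  have b3 : P.real {ω | ¬a ≤ |⟪u ω, v i⟫|} ≤ 1 / s ^ 2 + 2 * (a * (s * √n)) := by
    refine le_trans ?_ (uniformSphere_abs_inner_le hn (hv.1 i) ha hs)
    rw [← h.measureReal_init (measurableSet_le (by fun_prop) (by fun_prop))]
    exact measureReal_mono fun ω (hω : ¬a ≤ |⟪u ω, v i⟫|) => (not_le.1 hω).le
  have b4 : P.real {ω | ¬∀ t < τ, ∀ j,
      |⟪v j, act (Z ω) (tensorPow (powerIter (observation β v (Z ω)) (u ω) t) (k - 1))⟫| ≤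
        l / √n} ≤ c / l := by
    set B : Set (EuclideanSpace ℝ (Fin n) × EuclideanSpace ℝ (Fin k → Fin n)) :=
      {x | ∃ t < τ, ∃ j, l / √n < |⟪v j, act (noiseTensor x.2)
        (tensorPow (powerIter (observation β v (noiseTensor x.2)) x.1 t) (k - 1))⟫|} with hB
    have hBm : MeasurableSet B := by
      have : B = ⋃ t ∈ Finset.range τ, ⋃ j, {x | l / √n < |⟪v j, act (noiseTensor x.2)
        (tensorPow (powerIter (observation β v (noiseTensor x.2)) x.1 t) (k - 1))⟫|} := by
        ext x
        simp [hB]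
      rw [this]
      exact Finset.measurableSet_biUnion _ fun t _ => MeasurableSet.iUnion fun j =>
        measurableSet_lt measurable_const (measurable_noise_overlap β v t j).abs
    have hsub : {ω | ¬∀ t < τ, ∀ j,
        |⟪v j, act (Z ω) (tensorPow (powerIter (observation β v (Z ω)) (u ω) t) (k - 1))⟫| ≤
          l / √n} = {ω | (u ω, W ω) ∈ B} := by
      ext ω
      simp only [hB, Set.mem_ofPred_eq, hZW]
      push Not
      rfl
    rw [hsub]
    refine (HasLaw.measureReal_preimage_le hlaw B).trans
      (ENNReal.toReal_le_of_le_ofReal (by positivity) ?_)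
    rw [Measure.prod_apply hBm]
    -- By independence the initialization is frozen first; the bound on the noise overlaps is
    -- uniform over fixed starting vectors of the unit ball.
    calc _ ≤ ∫⁻ _, ENNReal.ofReal (c / l) ∂uniformSphere n := by
          refine lintegral_mono_ae ?_
          filter_upwards [uniformSphere_norm_le hn] with x hx
          exact hov n hn β v hv x hx l hl
      _ = _ := by simp
  have hsub : {ω | ¬(InjBound (Z ω) L ∧ ‖u ω‖ ≤ 1 ∧ a ≤ |⟪u ω, v i⟫| ∧ ∀ t < τ, ∀ j,
      |⟪v j, act (Z ω) (tensorPow (powerIter (observation β v (Z ω)) (u ω) t) (k - 1))⟫| ≤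
        l / √n)} ⊆ {ω | ¬InjBound (Z ω) L} ∪ ({ω | ¬‖u ω‖ ≤ 1} ∪ ({ω | ¬a ≤ |⟪u ω, v i⟫|} ∪
      {ω | ¬∀ t < τ, ∀ j,
        |⟪v j, act (Z ω) (tensorPow (powerIter (observation β v (Z ω)) (u ω) t) (k - 1))⟫| ≤
          l / √n})) := by
    intro ω hω
    simp only [Set.mem_union, Set.mem_ofPred_eq] at hω ⊢
    tauto
  have u1 := measureReal_mono (μ := P) hsub
  have u2 := measureReal_union_le (μ := P) {ω | ¬InjBound (Z ω) L} ({ω | ¬‖u ω‖ ≤ 1} ∪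
    ({ω | ¬a ≤ |⟪u ω, v i⟫|} ∪ {ω | ¬∀ t < τ, ∀ j,
        |⟪v j, act (Z ω) (tensorPow (powerIter (observation β v (Z ω)) (u ω) t) (k - 1))⟫| ≤
          l / √n}))
  have u3 := measureReal_union_le (μ := P) {ω | ¬‖u ω‖ ≤ 1}
    ({ω | ¬a ≤ |⟪u ω, v i⟫|} ∪ {ω | ¬∀ t < τ, ∀ j,
        |⟪v j, act (Z ω) (tensorPow (powerIter (observation β v (Z ω)) (u ω) t) (k - 1))⟫| ≤
          l / √n})
  have u4 := measureReal_union_le (μ := P) {ω | ¬a ≤ |⟪u ω, v i⟫|} {ω | ¬∀ t < τ, ∀ j,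
        |⟪v j, act (Z ω) (tensorPow (powerIter (observation β v (Z ω)) (u ω) t) (k - 1))⟫| ≤
          l / √n}
  linarith

end Noise

/-! ### Coverage from approximate Gaussian pivots -/

/-- By symmetry the two half-lines ending at `z` and `-z` both have mass `1 - α / 2`. Disjoint
half-lines would exceed total mass one, so `z ≥ 0`; they then cover the line, and
inclusion-exclusion gives their intersection. -/
theorem gaussianReal_quantile {α z : ℝ} (hα : α < 1) (hz : cdf (gaussianReal 0 1) z = 1 - α / 2) :
    0 ≤ z ∧ (gaussianReal 0 1).real {x | |x| ≤ z} = 1 - α := by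
  have hneg : MeasurePreserving (fun t : ℝ => -t) (gaussianReal 0 1) (gaussianReal 0 1) :=
    ⟨measurable_neg, by rw [gaussianReal_map_neg, neg_zero]⟩
  rw [cdf_eq_real] at hz
  have hsymm : (gaussianReal 0 1).real (Set.Ici (-z)) = 1 - α / 2 := by
    rw [← hz, measureReal_def, measureReal_def,
      ← hneg.measure_preimage measurableSet_Iic.nullMeasurableSet]
    congr 2
    ext x
    simp
  have hz0 : 0 ≤ z := by
    by_contra! h
    have hdisj : Disjoint (Set.Iic z) (Set.Ici (-z)) := by
      rw [Set.disjoint_left]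
      intro x hx hx'
      simp only [Set.mem_Iic, Set.mem_Ici] at hx hx'
      linarith
    have h1 := measureReal_union (μ := gaussianReal 0 1) hdisj measurableSet_Ici
    have h2 : (gaussianReal 0 1).real (Set.Iic z ∪ Set.Ici (-z)) ≤ 1 := measureReal_le_one
    linarith
  refine ⟨hz0, ?_⟩
  have hset : {x : ℝ | |x| ≤ z} = Set.Iic z ∩ Set.Ici (-z) := by
    ext x
    simp [abs_le, and_comm]
  have hun : Set.Iic z ∪ Set.Ici (-z) = Set.univ := by
    ext x
    simp only [Set.mem_union, Set.mem_Iic, Set.mem_Ici, Set.mem_univ, iff_true]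
    by_contra! h
    linarith [h.1, h.2]
  have h1 := measureReal_union_add_inter (μ := gaussianReal 0 1) (s := Set.Iic z)
    (t := Set.Ici (-z)) measurableSet_Ici
  have h2 : (gaussianReal 0 1).real Set.univ = 1 := probReal_univ
  rw [hun, h2, hz, hsymm] at h1
  rw [hset]
  linarith

theorem gaussianReal_real_abs_shell_le (a : ℝ) {d : ℝ} (hd : 0 ≤ d) :
    (gaussianReal 0 1).real {x | a ≤ |x| ∧ |x| ≤ a + d} ≤ 2 * d := by
  have hsub : {x : ℝ | a ≤ |x| ∧ |x| ≤ a + d} ⊆ Set.Icc a (a + d) ∪ Set.Icc (-(a + d)) (-a) := by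
    rintro x ⟨h1, h2⟩
    rcases abs_cases x with ⟨h, -⟩ | ⟨h, -⟩ <;> rw [h] at h1 h2
    · exact Or.inl ⟨h1, h2⟩
    · exact Or.inr ⟨by linarith, by linarith⟩
  refine (measureReal_mono hsub).trans ((measureReal_union_le _ _).trans ?_)
  have h1 := gaussianReal_real_Icc_le (a := a) (b := a + d) (by linarith)
  have h2 := gaussianReal_real_Icc_le (a := -(a + d)) (b := -a) (by linarith)
  linarith

/-- If, on the events `G n` and up to events of vanishing probability, membership in `I n` amounts
to `|N n| ≤ z + o(1)`, where `N n` is standard Gaussian and independent of `G n`, then the sets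
`I n` are asymptotic confidence sets on `G n`. -/
theorem asympCovers_of_pivot {Ω : Type*} [MeasurableSpace Ω] {P : Measure Ω} [IsProbabilityMeasure P]
    {G : ℕ → Set Ω} {α z : ℝ} (hz : (gaussianReal 0 1).real {x | |x| ≤ z} = 1 - α) {θ : ℕ → ℝ}
    {I : ℕ → Ω → Set ℝ} (d e : ℕ → ℝ) (hd : Tendsto d atTop (𝓝 0)) (he : Tendsto e atTop (𝓝 0))
    (h : ∀ᶠ n in atTop, 0 ≤ d n ∧ ∃ (N : Ω → ℝ) (bad : Set Ω), P.real bad ≤ e n ∧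
      HasLaw N (gaussianReal 0 1) P ∧
      (∀ B, MeasurableSet B → P.real (G n ∩ {ω | N ω ∈ B}) = P.real (G n) * (gaussianReal 0 1).real B) ∧
      ∀ ω ∈ G n, ω ∉ bad → (|N ω| + d n ≤ z → θ n ∈ I n ω) ∧ (θ n ∈ I n ω → |N ω| ≤ z + d n)) :
    AsympCovers P G α θ I := by
  have hlim : Tendsto (fun n => e n + 2 * d n) atTop (𝓝 0) := by
    simpa using he.add (hd.const_mul 2)
  refine squeeze_zero_norm' ?_ hlim
  filter_upwards [h] with n hn
  obtain ⟨hd0, N, bad, hbad, hN, hind, himp⟩ := hn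
  have hBm : MeasurableSet {x : ℝ | |x| ≤ z} := measurableSet_le (by fun_prop) (by fun_prop)
  have hexact := hind _ hBm
  rw [hz, mul_comm] at hexact
  -- Coverage and `|N| ≤ z` can differ only on `bad` and on shells of width `d n` for `|N|`, whose
  -- mass is at most `2 * d n`.
  have hshell : ∀ a, P.real {ω | a ≤ |N ω| ∧ |N ω| ≤ a + d n} ≤ 2 * d n := fun a =>
    (HasLaw.measureReal_preimage_le hN {x | a ≤ |x| ∧ |x| ≤ a + d n}).trans
      (gaussianReal_real_abs_shell_le a hd0)
  rw [Real.norm_eq_abs, ← hexact, abs_le]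
  have h1 : G n ∩ {ω | θ n ∈ I n ω} ⊆ (G n ∩ {ω | N ω ∈ {x | |x| ≤ z}}) ∪
      ({ω | z ≤ |N ω| ∧ |N ω| ≤ z + d n} ∪ bad) := by
    rintro ω ⟨hG, hI⟩
    by_cases hb : ω ∈ bad
    · exact Or.inr (Or.inr hb)
    have h2 := (himp ω hG hb).2 hI
    rcases le_total |N ω| z with h3 | h3
    · exact Or.inl ⟨hG, h3⟩
    · exact Or.inr (Or.inl ⟨h3, h2⟩)
  have h2 : G n ∩ {ω | N ω ∈ {x | |x| ≤ z}} ⊆ (G n ∩ {ω | θ n ∈ I n ω}) ∪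
      ({ω | z - d n ≤ |N ω| ∧ |N ω| ≤ z - d n + d n} ∪ bad) := by
    rintro ω ⟨hG, hI⟩
    by_cases hb : ω ∈ bad
    · exact Or.inr (Or.inr hb)
    rcases le_total (|N ω| + d n) z with h3 | h3
    · exact Or.inl ⟨hG, (himp ω hG hb).1 h3⟩
    · exact Or.inr (Or.inl ⟨by linarith, by simpa using hI⟩)
  have bound : ∀ {S T : Set Ω} {a : ℝ}, S ⊆ T ∪ ({ω | a ≤ |N ω| ∧ |N ω| ≤ a + d n} ∪ bad) →
      P.real S ≤ P.real T + (2 * d n + e n) := fun {S T a} hST =>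
    (measureReal_mono hST).trans ((measureReal_union_le _ _).trans (add_le_add le_rfl
      ((measureReal_union_le _ _).trans (add_le_add (hshell a) hbad))))
  have h3 := bound h1
  have h4 := bound h2
  constructor <;> linarith

/-! ### The estimators on a good event -/

/-- The setting of the power iteration for order `p + 2`: the initializations in `S n` select `i`,
and when `u n ∈ S n`, the `T n`-th iterate correlates with `v n i` with the sign `sT n`. -/
structure PowerIterSetting {Ω : Type*} [MeasurableSpace Ω] (P : Measure Ω) {p r : ℕ} [NeZero r]
    (κ ε : ℝ) (β : ℕ → Fin r → ℝ) (v : (n : ℕ) → Fin r → EuclideanSpace ℝ (Fin n))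
    (Z : (n : ℕ) → Ω → Tensor n (p + 2)) (u : (n : ℕ) → Ω → EuclideanSpace ℝ (Fin n)) (T : ℕ → ℕ)
    (i : Fin r) (S : (n : ℕ) → Set (EuclideanSpace ℝ (Fin n))) (sT : ℕ → ℝ) : Prop where
  one_le : 1 ≤ p
  one_le_ratio : 1 ≤ κ
  eps_pos : 0 < ε
  orthonormal : ∀ᶠ n in atTop, Orthonormal ℝ (v n)
  strength : ∀ᶠ n in atTop, ∀ j, β n j ≠ 0 ∧ |β n j| ≤ |β n 0|
  strength_large : ∀ᶠ n : ℕ in atTop, (n : ℝ) ^ ((p : ℝ) / 2 + ε) ≤ |β n 0|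
  noise : ∀ᶠ n in atTop, IsNoiseAndInit P (Z n) (u n)
  iterations : ∀ᶠ n : ℕ in atTop,
    3 + (Real.log κ + Real.log (Real.log (√n * |β n 0|))) / Real.log ((p : ℝ) + 1) ≤ T n
  measurableSet : ∀ n, MeasurableSet (S n)
  selects : ∀ n, ∀ x ∈ S n, Selects (p + 2) κ (β n) (v n) i x
  sign_sq : ∀ n, sT n ^ 2 = 1
  sign : ∀ᶠ n in atTop, 1 ≤ T n → ∀ x ∈ S n, ∃ s : ℕ → ℝ, (∀ t, s t ^ 2 = 1) ∧ 0 < s 0 * ⟪x, v n i⟫ ∧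
    (∀ t, 0 < s (t + 1) * (β n i * s t ^ (p + 1))) ∧ s (T n) = sT n

variable {Ω : Type*} [MeasurableSpace Ω] {P : Measure Ω} {p r : ℕ} [NeZero r]
  {κ ε : ℝ} {β : ℕ → Fin r → ℝ} {v : (n : ℕ) → Fin r → EuclideanSpace ℝ (Fin n)}
  {Z : (n : ℕ) → Ω → Tensor n (p + 2)} {u : (n : ℕ) → Ω → EuclideanSpace ℝ (Fin n)} {T : ℕ → ℕ}
  {i : Fin r} {S : (n : ℕ) → Set (EuclideanSpace ℝ (Fin n))} {sT : ℕ → ℝ}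

/-- Since `p ≥ 1`, the strength exceeds `√n` by a power of `n`. This is what makes errors `O(1/β)`
negligible against fluctuations of order `1/√n`. -/
theorem PowerIterSetting.rpow_le (h : PowerIterSetting P κ ε β v Z u T i S sT) :
    ∀ᶠ n : ℕ in atTop, √n * (n : ℝ) ^ ε ≤ |β n 0| := by
  have hp : (1 : ℝ) ≤ p := by exact_mod_cast h.one_le
  filter_upwards [h.strength_large, eventually_ge_atTop 1] with n hn hn1
  have hn1 : (1 : ℝ) ≤ n := by exact_mod_cast hn1
  refine le_trans ?_ hn
  rw [Real.sqrt_eq_rpow, ← Real.rpow_add (by linarith)]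
  exact Real.rpow_le_rpow_of_exponent_le hn1 (by linarith)

/-- The lower bound on `T n` is at least `log log n / log (p + 1)`, so `T n` eventually exceeds the
fixed number of steps needed to leave the initial regime. -/
theorem PowerIterSetting.tendsto_iterations (h : PowerIterSetting P κ ε β v Z u T i S sT) :
    Tendsto T atTop atTop := by
  have hp : (1 : ℝ) ≤ p := by exact_mod_cast h.one_le
  have hlp : 0 < Real.log ((p : ℝ) + 1) := Real.log_pos (by linarith)
  have hll : Tendsto (fun n : ℕ => Real.log (Real.log n) / Real.log ((p : ℝ) + 1)) atTop atTop :=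
    (Real.tendsto_log_atTop.comp (Real.tendsto_log_atTop.comp
      tendsto_natCast_atTop_atTop)).atTop_div_const hlp
  have hcast : Tendsto (fun n => (T n : ℝ)) atTop atTop := by
    refine tendsto_atTop_mono' _ ?_ hll
    filter_upwards [h.iterations, h.rpow_le, eventually_ge_atTop 3] with n hn hb hn3
    have hn3' : (3 : ℝ) ≤ n := by exact_mod_cast hn3
    have hn0 : (0 : ℝ) < n := by linarith
    have h1 : (n : ℝ) ≤ √n * |β n 0| := by
      have h2 : 1 ≤ (n : ℝ) ^ ε := Real.one_le_rpow (by linarith) h.eps_pos.le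
      calc (n : ℝ) = √n * (√n * 1) := by rw [mul_one, Real.mul_self_sqrt hn0.le]
        _ ≤ √n * (√n * (n : ℝ) ^ ε) := by gcongr
        _ ≤ _ := by gcongr
    have hlog : 0 < Real.log n := Real.log_pos (by linarith)
    have h3 : Real.log (Real.log n) ≤ Real.log (Real.log (√n * |β n 0|)) :=
      Real.log_le_log hlog (Real.log_le_log hn0 h1)
    have h4 : 0 ≤ Real.log κ := Real.log_nonneg h.one_le_ratio
    have h5 : Real.log (Real.log n) / Real.log ((p : ℝ) + 1) ≤
        (Real.log κ + Real.log (Real.log (√n * |β n 0|))) / Real.log ((p : ℝ) + 1) := by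
      gcongr
      linarith
    linarith
  exact tendsto_natCast_atTop_iff.1 hcast

/-- The noise event is used with overlap threshold `n^(-(1/2+δ))`, norm factor `n^(δ/2)` and noise
level `n^δ / √n`. Its failure probability is at most `2 exp(-n) + n^(-δ) + 2 n^(-δ/2) + c n^(-δ)`.
The bound `e` is fixed before `M`, so the strength may be required to exceed any constant. -/
theorem PowerIterSetting.exists_good_event [IsProbabilityMeasure P]
    (h : PowerIterSetting P κ ε β v Z u T i S sT) :
    ∃ (L D : ℝ) (e : ℕ → ℝ), 1 ≤ L ∧ 1 ≤ D ∧ Tendsto e atTop (𝓝 0) ∧ ∀ M : ℝ, ∀ᶠ n in atTop,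
      ∃ bad : Set Ω, P.real bad ≤ e n ∧ ∀ ω, u n ω ∈ S n → ω ∉ bad →
        InjBound (Z n ω) L ∧ M ≤ |β n i| ∧ |β n 0| ≤ κ ^ p * |β n i| ∧
        ‖powerIter (observation (β n) (v n) (Z n ω)) (u n ω) (T n)‖ = 1 ∧
        0 < sT n * ⟪powerIter (observation (β n) (v n) (Z n ω)) (u n ω) (T n), v n i⟫ ∧
        ‖rej (v n i) (powerIter (observation (β n) (v n) (Z n ω)) (u n ω) (T n))‖ ≤
          D / |β n i| ∧
        ‖rej (v n i) (powerIter (observation (β n) (v n) (Z n ω)) (u n ω) (T n)) -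
          (sT n / β n i) • rej (v n i) (act (Z n ω) (tensorPow (v n i) (p + 2 - 1)))‖ ≤
          D / |β n i| ^ 2 ∧
        |strengthEst (observation (β n) (v n) (Z n ω))
            (powerIter (observation (β n) (v n) (Z n ω)) (u n ω) (T n)) -
          sT n ^ (p + 2) * (β n i + mform (Z n ω) fun _ => v n i)| ≤ D / |β n i| := by
  obtain ⟨L, hL, hnoise⟩ := exists_noise_event (p + 2)
  obtain ⟨τ, D, hD, hdet⟩ := exists_powerIter_expansion (L := L) r h.one_le h.one_le_ratio hL h.eps_pos
  obtain ⟨c, hc, hnoise⟩ := hnoise r τ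
  set δ := ε / (2 * ((p : ℝ) + 2)) with hδ
  have hδ0 : 0 < δ := div_pos h.eps_pos (by positivity)
  set e : ℕ → ℝ := fun n => 2 * Real.exp (-n) + (1 / ((n : ℝ) ^ (δ / 2)) ^ 2 +
    2 * ((n : ℝ) ^ (-(1 / 2 + δ)) * ((n : ℝ) ^ (δ / 2) * √n))) + c / (n : ℝ) ^ δ with he
  refine ⟨L, D, e, hL, hD, ?_, fun M => ?_⟩
  · have t1 : Tendsto (fun n : ℕ => 2 * Real.exp (-(n : ℝ))) atTop (𝓝 (2 * 0)) :=
      (Real.tendsto_exp_neg_atTop_nhds_zero.comp tendsto_natCast_atTop_atTop).const_mul 2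
    have t2 := (tendsto_natCast_rpow_neg hδ0)
    have t3 := (tendsto_natCast_rpow_neg (half_pos hδ0)).const_mul 2
    have t4 := (tendsto_natCast_rpow_neg hδ0).const_mul c
    have ht := (t1.add (t2.add t3)).add t4
    simp only [mul_zero, add_zero] at ht
    refine ht.congr' ?_
    filter_upwards [eventually_ge_atTop 1] with n hn
    have hn0 : (0 : ℝ) < n := by exact_mod_cast hn
    have r1 : ((n : ℝ) ^ (δ / 2)) ^ 2 = (n : ℝ) ^ δ := by
      rw [← Real.rpow_natCast, ← Real.rpow_mul hn0.le]
      norm_num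
    have r2 : (n : ℝ) ^ (-(1 / 2 + δ)) * ((n : ℝ) ^ (δ / 2) * √n) = (n : ℝ) ^ (-(δ / 2)) := by
      rw [Real.sqrt_eq_rpow, ← Real.rpow_add hn0, ← Real.rpow_add hn0]
      congr 1
      ring
    rw [he]
    simp only
    rw [r1, r2, Real.rpow_neg hn0.le δ, one_div, div_eq_mul_inv c]
  · filter_upwards [hdet M, h.orthonormal, h.strength, h.strength_large, h.noise, h.iterations, h.sign,
      h.tendsto_iterations.eventually_ge_atTop (τ + 3), eventually_ge_atTop 1]
      with n hdet hv hβ hlarge hZ hT2 hsign hT1 hn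
    have hn0 : (0 : ℝ) < n := by exact_mod_cast hn
    refine ⟨_, hnoise n hn P (Z n) (u n) hZ (β n) (v n) hv i ((n : ℝ) ^ (-(1 / 2 + δ)))
      ((n : ℝ) ^ (δ / 2)) ((n : ℝ) ^ δ) (by positivity) (by positivity) (by positivity), ?_⟩
    intro ω hS hgood
    simp only [Set.mem_ofPred_eq, not_not] at hgood
    obtain ⟨hinj, hu, hui, hov⟩ := hgood
    obtain ⟨hM, hK, hfin⟩ := hdet (β n) (v n) (Z n ω) i (u n ω) (T n) hv (hβ i).1 (fun j => (hβ j).2)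
      hlarge hT1 hT2 hinj hu (h.selects n _ hS) hui hov
    obtain ⟨s, hs, hs0, hsrec, hsT⟩ := hsign (by omega) _ hS
    rw [← hsT]
    exact ⟨hinj, hM, hK 0, hfin s hs hs0 hsrec⟩

/-- Linear forms of the noise are standard Gaussian pivots, independent of the initialization. -/
theorem hasLaw_pivot [IsProbabilityMeasure P] {n k : ℕ} (hn : 1 ≤ n)
    {u : Ω → EuclideanSpace ℝ (Fin n)} {W : Ω → EuclideanSpace ℝ (Fin k → Fin n)}
    (hW : HasLaw W (stdGaussian _) P)
    (hlaw : HasLaw (fun ω => (u ω, W ω)) ((uniformSphere n).prod (stdGaussian _)) P)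
    {S : Set (EuclideanSpace ℝ (Fin n))} (hS : MeasurableSet S)
    {t : EuclideanSpace ℝ (Fin k → Fin n)} (ht : ‖t‖ = 1) :
    HasLaw (fun ω => ⟪t, W ω⟫) (gaussianReal 0 1) P ∧ ∀ B, MeasurableSet B →
      P.real ({ω | u ω ∈ S} ∩ {ω | ⟪t, W ω⟫ ∈ B}) =
        P.real {ω | u ω ∈ S} * (gaussianReal 0 1).real B := by
  have hprob := isProbabilityMeasure_uniformSphere hn
  have hmap : (stdGaussian (EuclideanSpace ℝ (Fin k → Fin n))).map (fun W => ⟪t, W⟫) =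
      gaussianReal 0 1 := by
    rw [map_inner_stdGaussian]
    congr 1
    ext
    simp [ht]
  have hN : HasLaw (fun ω => ⟪t, W ω⟫) (gaussianReal 0 1) P :=
    HasLaw.comp (Y := fun W => ⟪t, W⟫) ⟨by fun_prop, hmap⟩ hW
  refine ⟨hN, fun B hB => ?_⟩
  have hBm : MeasurableSet ((fun W : EuclideanSpace ℝ (Fin k → Fin n) => ⟪t, W⟫) ⁻¹' B) :=
    (by fun_prop : Measurable fun W : EuclideanSpace ℝ (Fin k → Fin n) => ⟪t, W⟫) hB
  have h1 := HasLaw.measureReal_preimage hlaw (hS.prod hBm)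
  have h2 := HasLaw.measureReal_preimage hlaw (hS.prod MeasurableSet.univ)
  rw [measureReal_prod_prod] at h1 h2
  rw [probReal_univ, mul_one] at h2
  have h3 : {ω | (u ω, W ω) ∈ S ×ˢ Set.univ} = {ω | u ω ∈ S} := by
    ext ω
    simp
  rw [h3] at h2
  rw [h2, ← hmap, map_measureReal_apply (by fun_prop) hB, ← h1]
  rfl

/-! ### Coverage of the confidence sets -/

theorem abs_abs_sub_le_of_strengthEst {s b c m L D e : ℝ} {k : ℕ} (hs : s ^ 2 = 1)
    (hm : |m| ≤ L) (hc : |c - s ^ k * (b + m)| ≤ e) (he : e ≤ D) : abs (|c| - |b|) ≤ D + L := by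
  have hsk : |s ^ k| = 1 := by
    rw [abs_pow, abs_eq_one_of_sq hs, one_pow]
  have h1 := abs_abs_sub_abs_le_abs_sub c (s ^ k * (b + m))
  rw [abs_mul, hsk, one_mul] at h1
  have h2 := abs_abs_sub_abs_le_abs_sub (b + m) b
  rw [add_sub_cancel_left] at h2
  calc abs (|c| - |b|) ≤ abs (|c| - |b + m|) + abs (|b + m| - |b|) := abs_sub_le _ _ _
    _ ≤ D + L := add_le_add (h1.trans (hc.trans he)) (h2.trans hm)

/-- A confidence condition `|A| ≤ z R / √n` in terms of the pivot `N`. -/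
theorem pivot_sandwich {A B N R h z d E₁ E₂ m : ℝ} (hm : 0 < m) (hh : 0 < h) (hz : 0 ≤ z)
    (hB : |B| = h * |N| / m) (hA : |A - B| ≤ E₁) (hR : |R - h| ≤ E₂)
    (hd : z * E₂ + m * E₁ ≤ h * d) :
    (|N| + d ≤ z → |A| ≤ z * (R / m)) ∧ (|A| ≤ z * (R / m) → |N| ≤ z + d) := by
  rw [eq_div_iff hm.ne'] at hB
  rw [← mul_div_assoc, le_div_iff₀ hm]
  have h1 : |A| ≤ |B| + E₁ := by linarith [abs_sub_abs_le_abs_sub A B]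
  have h2 : |B| ≤ |A| + E₁ := by linarith [abs_sub_abs_le_abs_sub B A, abs_sub_comm A B]
  have h3 : z * h ≤ z * (R + E₂) := by
    gcongr
    linarith [(abs_le.1 hR).1]
  have h4 : z * R ≤ z * (h + E₂) := by
    gcongr
    linarith [(abs_le.1 hR).2]
  constructor
  · intro h5
    have h6 : h * (|N| + d) ≤ h * z := by gcongr
    have h7 : |A| * m ≤ (|B| + E₁) * m := by gcongr
    linarith
  · intro h5
    have h7 : |B| * m ≤ (|A| + E₁) * m := by gcongr
    refine le_of_mul_le_mul_left ?_ hh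
    linarith

/-- The error terms of the expansion of a linear functional, relative to its fluctuations. -/
theorem linear_error_le {z C C' C'' K b m η M y w : ℝ} (hz : 0 ≤ z) (hC : 0 ≤ C) (hC' : 0 ≤ C')
    (hC'' : 0 ≤ C'') (hK : 0 ≤ K) (hb : 0 < b) (hm : 0 < m) (hη : 0 < η) (hM : 0 ≤ M) (hy : 0 < y)
    (hyb : y ≤ K * (b * η)) (hw : m / b ≤ w) :
    z * (C'' / b ^ 2) + m * (η * (C / b ^ 2) + C' / b ^ 3 + M / m / (2 * b ^ 2)) ≤
      η / b * (z * C'' * (K / y) + w * C + w * (C' * (K / y)) + M * (K / y)) := by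
  have hbη : 0 < b * η := by positivity
  have h1 : 1 / (b * η) ≤ K / y := by
    rw [div_le_div_iff₀ hbη hy]
    linarith
  have hK0 : 0 ≤ K / y := by positivity
  have hw0 : 0 ≤ w := (by positivity : 0 ≤ m / b).trans hw
  have h2 : z * (C'' / b ^ 2) + m * (η * (C / b ^ 2) + C' / b ^ 3 + M / m / (2 * b ^ 2)) =
      η / b * (z * C'' * (1 / (b * η)) + m / b * C + m / b * (C' * (1 / (b * η))) +
        M / 2 * (1 / (b * η))) := by
    field_simp
    ring
  rw [h2]
  gcongr
  linarith

variable {Ω : Type*} [MeasurableSpace Ω] {P : Measure Ω} [IsProbabilityMeasure P] {p r : ℕ} [NeZero r]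
  {κ ε : ℝ} {β : ℕ → Fin r → ℝ} {v : (n : ℕ) → Fin r → EuclideanSpace ℝ (Fin n)}
  {Z : (n : ℕ) → Ω → Tensor n (p + 2)} {u : (n : ℕ) → Ω → EuclideanSpace ℝ (Fin n)} {T : ℕ → ℕ}
  {i : Fin r} {S : (n : ℕ) → Set (EuclideanSpace ℝ (Fin n))} {sT : ℕ → ℝ} {α z : ℝ}

/-- The signal strength at the selected index dominates `√n`. -/
theorem sqrt_div_le {n : ℕ} {b b0 K ε : ℝ} (hn : 1 ≤ n) (hb : 0 < b) (h0 : √n * (n : ℝ) ^ ε ≤ b0)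
    (hK : b0 ≤ K * b) : √n / b ≤ K * (n : ℝ) ^ (-ε) := by
  have hn0 : (0 : ℝ) < n := by exact_mod_cast hn
  rw [div_le_iff₀ hb]
  have h1 : (0 : ℝ) < (n : ℝ) ^ ε := by positivity
  have h2 : (n : ℝ) ^ (-ε) * (n : ℝ) ^ ε = 1 := by
    rw [← Real.rpow_add hn0, neg_add_cancel, Real.rpow_zero]
  calc √n = (n : ℝ) ^ (-ε) * (√n * (n : ℝ) ^ ε) := by rw [mul_left_comm, h2, mul_one]
    _ ≤ (n : ℝ) ^ (-ε) * (K * b) :=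
      mul_le_mul_of_nonneg_left (h0.trans hK) (by positivity)
    _ = _ := by ring

/-- The pivot is `√n ⟨Z, v_i^{⊗k}⟩`, exactly standard Gaussian. Both the error of the expansion and
the correction `(k/2 - 1) / β̂` are `O(1/β)`, hence negligible on the scale `1/√n`, and no
cancellation between them is needed. -/
theorem PowerIterSetting.asympCovers_strength (h : PowerIterSetting P κ ε β v Z u T i S sT)
    (hz0 : 0 ≤ z) (hz : (gaussianReal 0 1).real {x | |x| ≤ z} = 1 - α) :
    AsympCovers P (fun n => {ω | u n ω ∈ S n}) α (fun n => sT n ^ (p + 2) * β n i)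
      fun n ω => strengthCI n (p + 2) z (strengthEst (observation (β n) (v n) (Z n ω))
        (powerIter (observation (β n) (v n) (Z n ω)) (u n ω) (T n))) := by
  obtain ⟨L, D, e, hL, hD, he, hgood⟩ := h.exists_good_event
  have hd : Tendsto (fun n : ℕ => (D + p) * (κ ^ p * (n : ℝ) ^ (-ε))) atTop (𝓝 0) := by
    simpa using ((tendsto_natCast_rpow_neg h.eps_pos).const_mul (κ ^ p)).const_mul (D + p)
  have hκ0 : 0 < κ := lt_of_lt_of_le one_pos h.one_le_ratio
  refine asympCovers_of_pivot hz _ e hd he ?_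
  filter_upwards [hgood (2 * (D + L)), h.orthonormal, h.noise, h.rpow_le, eventually_ge_atTop 1]
    with n ⟨bad, hbad, hgood⟩ hv hZ hlarge hn
  have hn0 : (0 : ℝ) < n := by exact_mod_cast hn
  have hsn : 0 < √(n : ℝ) := Real.sqrt_pos.2 hn0
  refine ⟨by positivity, ?_⟩
  obtain ⟨W, hZW, hW, hlaw⟩ := hZ.exists_stdGaussian hn
  set t : EuclideanSpace ℝ (Fin (p + 2) → Fin n) := elemTensor fun _ => v n i with ht
  have ht1 : ‖t‖ = 1 := by rw [ht, norm_elemTensor, Finset.prod_const, hv.1 i, one_pow]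
  obtain ⟨hN, hind⟩ := hasLaw_pivot hn hW hlaw (h.measurableSet n) ht1
  refine ⟨_, bad, hbad, hN, hind, fun ω hS hωb => ?_⟩
  obtain ⟨hinj, hM, hK, -, -, -, -, hest⟩ := hgood ω hS hωb
  set c := strengthEst (observation (β n) (v n) (Z n ω))
    (powerIter (observation (β n) (v n) (Z n ω)) (u n ω) (T n)) with hc
  set b := |β n i| with hb
  have hb1 : 1 ≤ b := by linarith
  have hb0 : 0 < b := by linarith
  have hsq := h.sign_sq n
  have hm : mform (Z n ω) (fun _ => v n i) = ⟪t, W ω⟫ / √n := by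
    rw [hZW, mform_noiseTensor, inv_mul_eq_div]
  have hmL : |mform (Z n ω) fun _ => v n i| ≤ L := by
    refine (hinj _).trans ?_
    rw [Finset.prod_const, hv.1 i, one_pow, mul_one]
  have hcb := abs_abs_sub_le_of_strengthEst hsq hmL hest (div_le_self (by linarith) hb1)
  have hc2 : b / 2 ≤ |c| := by linarith [(abs_le.1 hcb).1]
  have hsk : |sT n ^ (p + 2)| = 1 := by rw [abs_pow, abs_eq_one_of_sq hsq, one_pow]
  rw [mem_strengthCI_iff]
  set d := (D + p) * (κ ^ p * (n : ℝ) ^ (-ε)) with hd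
  have key := pivot_sandwich (A := c + (((p + 2 : ℕ) : ℝ) / 2 - 1) / c - sT n ^ (p + 2) * β n i)
    (B := sT n ^ (p + 2) * (⟪t, W ω⟫ / √n)) (N := ⟪t, W ω⟫) (R := 1) (h := 1) (z := z) (d := d)
    (E₁ := (D + p) / b) (E₂ := 0) (m := √n) hsn one_pos
    hz0 ?_ ?_ (by simp) ?_
  · simpa only [mul_one_div] using key
  · rw [abs_mul, hsk, one_mul, one_mul, abs_div, abs_of_pos hsn]
  · have h1 : c + (((p + 2 : ℕ) : ℝ) / 2 - 1) / c - sT n ^ (p + 2) * β n i -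
        sT n ^ (p + 2) * (⟪t, W ω⟫ / √n) = (c - sT n ^ (p + 2) * (β n i +
          mform (Z n ω) fun _ => v n i)) + ((p : ℝ) / 2) / c := by
      rw [hm]
      push_cast
      ring
    rw [h1, add_div]
    refine (abs_add_le _ _).trans (add_le_add hest ?_)
    rw [abs_div, abs_of_nonneg (by positivity : (0 : ℝ) ≤ (p : ℝ) / 2),
      div_le_div_iff₀ (by linarith) hb0]
    nlinarith [(Nat.cast_nonneg p : (0 : ℝ) ≤ p)]
  · rw [mul_zero, zero_add, one_mul, hd]
    calc √n * ((D + p) / b) = (D + p) * (√n / b) := by ring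
      _ ≤ _ := by
        gcongr
        exact sqrt_div_le hn hb0 hlarge hK

/-- The pivot pairs the noise with `v_i` in all slots but the first, which holds the normalized
component of `a` orthogonal to `v_i`. With `η` the norm of that component, the fluctuation has size
`η / (β √n)`. Relative to it the errors are governed by `1 / (β η)` and `√n / β`, which both tend to
zero. -/
theorem PowerIterSetting.asympCovers_linear (h : PowerIterSetting P κ ε β v Z u T i S sT)
    (hz0 : 0 ≤ z) (hz : (gaussianReal 0 1).real {x | |x| ≤ z} = 1 - α)
    (a : (n : ℕ) → EuclideanSpace ℝ (Fin n)) (ha : ∀ᶠ n in atTop, ‖a n‖ = 1)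
    (hy : Tendsto (fun n => |β n 0| * ‖rej (v n i) (a n)‖) atTop atTop) :
    AsympCovers P (fun n => {ω | u n ω ∈ S n}) α (fun n => ⟪a n, sT n • v n i⟫)
      fun n ω => linearCI z (a n) (powerIter (observation (β n) (v n) (Z n ω)) (u n ω) (T n))
        (strengthEst (observation (β n) (v n) (Z n ω))
          (powerIter (observation (β n) (v n) (Z n ω)) (u n ω) (T n))) := by
  obtain ⟨L, D, e, hL, hD, he, hgood⟩ := h.exists_good_event
  obtain ⟨c₂, hc₂, hconc⟩ := exists_norm_act_concentration
  set K := κ ^ p with hKdef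
  have hK1 : 1 ≤ K := one_le_pow₀ h.one_le_ratio
  set C := D + L with hC
  have hC0 : 0 ≤ C := by linarith
  set C' := C ^ 4 + C * C + 6 * (D + L) with hC'
  have hC'0 : 0 ≤ C' := by positivity
  set C'' := 8 * C + 2 * (D + L) with hC''
  have hC''0 : 0 ≤ C'' := by positivity
  set y : ℕ → ℝ := fun n => |β n 0| * ‖rej (v n i) (a n)‖ with hydef
  -- A slowly growing tolerance: it tends to infinity, so deviations of size `M / √n` in the squared
  -- norm have vanishing probability, yet `M / y = 1 / M` still tends to zero.
  set M : ℕ → ℝ := fun n => √(y n) with hMdef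
  have hMlim : Tendsto M atTop atTop := Real.tendsto_sqrt_atTop.comp hy
  set w : ℕ → ℝ := fun n => K * (n : ℝ) ^ (-ε) with hw
  have hwlim : Tendsto w atTop (𝓝 0) := by
    simpa using (tendsto_natCast_rpow_neg h.eps_pos).const_mul K
  have hKy : Tendsto (fun n => K / y n) atTop (𝓝 0) := hy.const_div_atTop K
  have hMKy : Tendsto (fun n => M n * (K / y n)) atTop (𝓝 0) := by
    refine (hMlim.const_div_atTop K).congr' ?_
    filter_upwards [hy.eventually_gt_atTop 0] with n hn
    have h1 : M n * M n = y n := Real.mul_self_sqrt hn.le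
    have h2 : M n ≠ 0 := (Real.sqrt_pos.2 hn).ne'
    rw [← h1]
    field_simp
  have hd : Tendsto (fun n => z * C'' * (K / y n) + w n * C + w n * (C' * (K / y n)) +
      M n * (K / y n)) atTop (𝓝 0) := by
    have := (((hKy.const_mul (z * C'')).add (hwlim.mul_const C)).add
      (hwlim.mul (hKy.const_mul C'))).add hMKy
    simpa using this
  have he' : Tendsto (fun n => e n + (4 * c₂ / M n ^ 2 + 2 * Real.exp (-(M n / 2)))) atTop (𝓝 0) := by
    have t1 : Tendsto (fun n => 4 * c₂ / M n ^ 2) atTop (𝓝 0) :=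
      ((tendsto_pow_atTop two_ne_zero).comp hMlim).const_div_atTop _
    have t2 : Tendsto (fun n => 2 * Real.exp (-(M n / 2))) atTop (𝓝 (2 * 0)) :=
      (Real.tendsto_exp_neg_atTop_nhds_zero.comp (hMlim.atTop_div_const two_pos)).const_mul 2
    simpa using he.add (t1.add t2)
  refine asympCovers_of_pivot hz _ _ hd he' ?_
  filter_upwards [hgood (2 * (D + L) + 4), h.orthonormal, h.noise, h.rpow_le, ha,
    hy.eventually_gt_atTop 0, eventually_ge_atTop 4] with n ⟨bad, hbad, hgood⟩ hv hZ hlarge ha hy0 hn4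
  have hn : 1 ≤ n := by omega
  have hn4' : (4 : ℝ) ≤ n := by exact_mod_cast hn4
  have hn0 : (0 : ℝ) < n := by linarith
  have hsn : 0 < √(n : ℝ) := Real.sqrt_pos.2 hn0
  have hsn2 : 2 ≤ √(n : ℝ) := Real.le_sqrt_of_sq_le (by linarith)
  have hss : √(n : ℝ) * √(n : ℝ) = n := Real.mul_self_sqrt hn0.le
  have hM0 : 0 < M n := Real.sqrt_pos.2 hy0
  have hw0 : 0 ≤ w n := by positivity
  refine ⟨by positivity, ?_⟩
  obtain ⟨W, hZW, hW, hlaw⟩ := hZ.exists_stdGaussian hn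
  set η := ‖rej (v n i) (a n)‖ with hη
  have hη0 : 0 < η := by
    rcases (norm_nonneg (rej (v n i) (a n))).eq_or_lt with h0 | h0
    · simp only [hydef] at hy0
      rw [← h0, mul_zero] at hy0
      exact absurd hy0 (lt_irrefl _)
    · exact h0
  set t : EuclideanSpace ℝ (Fin (p + 2) → Fin n) :=
    elemTensor (Function.update (fun _ => v n i) 0 (η⁻¹ • rej (v n i) (a n))) with ht
  have ht1 : ‖t‖ = 1 := by
    rw [ht, norm_elemTensor, prod_update_zero (fun _ (x : EuclideanSpace ℝ (Fin n)) => ‖x‖),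
      norm_smul, ← hη, norm_inv, Real.norm_of_nonneg hη0.le, inv_mul_cancel₀ hη0.ne', one_mul]
    simp [hv.1 i]
  set t' : EuclideanSpace ℝ (Fin (p + 2) → Fin n) := elemTensor fun _ => v n i with ht'
  have ht'1 : ‖t'‖ = 1 := by rw [ht', norm_elemTensor, Finset.prod_const, hv.1 i, one_pow]
  obtain ⟨hN, hind⟩ := hasLaw_pivot hn hW hlaw (h.measurableSet n) ht1
  -- The squared norm of the orthogonal part of `ζ` is `‖ζ‖² - ⟨ζ, v_i⟩²`, and each term is allowed
  -- half of the tolerance `M / √n`. Off `bad₂` the second term is at most `M / n`, which is below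
  -- its half because `n ≥ 4`.
  set bad₁ : Set Ω := {ω | M n / (2 * √n) ≤
    |‖act (noiseTensor (W ω)) (tensorPow (v n i) (p + 2 - 1))‖ ^ 2 - 1|} with hbad₁
  set bad₂ : Set Ω := {ω | √(M n) ≤ |⟪t', W ω⟫|} with hbad₂
  have hb₁ : P.real bad₁ ≤ 4 * c₂ / M n ^ 2 := by
    refine (HasLaw.measureReal_preimage_le hW {W | M n / (2 * √n) ≤
      |‖act (noiseTensor W) (tensorPow (v n i) (p + 2 - 1))‖ ^ 2 - 1|}).trans
      ((hconc (p + 2) n hn (v n i) (hv.1 i) _ (by positivity)).trans (le_of_eq ?_))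
    rw [div_pow, mul_pow, Real.sq_sqrt hn0.le]
    field_simp
    norm_num
  have hb₂ : P.real bad₂ ≤ 2 * Real.exp (-(M n / 2)) := by
    refine (HasLaw.measureReal_preimage_le hW {W | √(M n) ≤ |⟪t', W⟫|}).trans
      ((measureReal_le_abs_inner_le ht'1.le (Real.sqrt_nonneg _)).trans (le_of_eq ?_))
    rw [Real.sq_sqrt hM0.le, neg_div]
  refine ⟨_, bad ∪ (bad₁ ∪ bad₂), (measureReal_union_le _ _).trans (add_le_add hbad
    ((measureReal_union_le _ _).trans (add_le_add hb₁ hb₂))), hN, hind, fun ω hS hωb => ?_⟩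
  simp only [Set.mem_union, not_or] at hωb
  obtain ⟨hωb, hω₁, hω₂⟩ := hωb
  obtain ⟨hinj, hMb, hK, hx1, hsx, hrej, hexp, hest⟩ := hgood ω hS hωb
  set x := powerIter (observation (β n) (v n) (Z n ω)) (u n ω) (T n) with hx
  set c := strengthEst (observation (β n) (v n) (Z n ω)) x with hc
  set ζ := act (Z n ω) (tensorPow (v n i) (p + 2 - 1)) with hζ
  set b := |β n i| with hb
  have hb1 : 1 ≤ b := by linarith
  have hb0 : 0 < b := by linarith
  have hsq := h.sign_sq n
  have hmL : |mform (Z n ω) fun _ => v n i| ≤ L := by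
    refine (hinj _).trans ?_
    rw [Finset.prod_const, hv.1 i, one_pow, mul_one]
  have hcb := abs_abs_sub_le_of_strengthEst hsq hmL hest (div_le_self (by linarith) hb1)
  have hc1 : 1 < |c| := by linarith [(abs_le.1 hcb).1]
  have hζL : ‖rej (v n i) ζ‖ ≤ C :=
    (norm_rej_le (hv.1 i) ζ).trans ((hinj.norm_act_le (by linarith) (hv.1 i).le).trans (by linarith))
  have hζv : ⟪ζ, v n i⟫ = ⟪t', W ω⟫ / √n := by
    rw [real_inner_comm, hζ, inner_act, Function.update_eq_self_iff.2 rfl, hZW, mform_noiseTensor,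
      inv_mul_eq_div]
  have hρ : |‖rej (v n i) ζ‖ ^ 2 - 1| ≤ M n / √n := by
    rw [norm_sq_rej (hv.1 i), hζv]
    simp only [hbad₁, hbad₂, Set.mem_ofPred_eq, not_le, ← hZW, ← hζ] at hω₁ hω₂
    have h1 : ⟪t', W ω⟫ ^ 2 ≤ M n := by
      rw [← sq_abs, ← Real.sq_sqrt hM0.le]
      exact pow_le_pow_left₀ (abs_nonneg _) hω₂.le 2
    have h2 : (⟪t', W ω⟫ / √n) ^ 2 ≤ M n / (2 * √n) := by
      rw [div_pow, Real.sq_sqrt hn0.le, div_le_div_iff₀ hn0 (by positivity)]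
      calc ⟪t', W ω⟫ ^ 2 * (2 * √n) ≤ M n * (√n * √n) := by gcongr
        _ = _ := by rw [hss]
    have h3 : M n / √n = M n / (2 * √n) + M n / (2 * √n) := by
      field_simp
      norm_num
    rw [h3, sub_right_comm]
    refine (abs_sub _ _).trans (add_le_add hω₁.le ?_)
    rwa [abs_of_nonneg (sq_nonneg _)]
  obtain ⟨e1, e2⟩ := abs_inner_sub_expansion_le (hv.1 i) hx1 ha hsq hsx hb.symm hb1 hC0
    (hrej.trans (by gcongr; linarith)) (hexp.trans (by gcongr; linarith)) hcb (by linarith) hρ hζL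
  have hpiv : ⟪rej (v n i) (a n), ζ⟫ = η * (⟪t, W ω⟫ / √n) := by
    have h1 : ⟪η⁻¹ • rej (v n i) (a n), ζ⟫ = ⟪t, W ω⟫ / √n := by
      rw [hζ, inner_act, hZW, mform_noiseTensor, inv_mul_eq_div]
    rw [real_inner_smul_left] at h1
    rw [← h1, mul_inv_cancel_left₀ hη0.ne']
  rw [mem_linearCI_iff hx1 hz0 hc1]
  have key := pivot_sandwich (R := ‖rej x (a n)‖ / |c|) (h := η / b) (N := ⟪t, W ω⟫)
    (d := z * C'' * (K / y n) + w n * C + w n * (C' * (K / y n)) + M n * (K / y n)) hsn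
    (by positivity) hz0 ?_ e1 e2 ?_
  · rw [div_div, mul_comm |c|] at key
    exact key
  · rw [hpiv, abs_mul, abs_div, abs_eq_one_of_sq hsq, abs_mul, abs_of_pos hη0, abs_div,
      abs_of_pos hsn, ← hb]
    ring
  · refine linear_error_le hz0 hC0 hC'0 hC''0 (by linarith) hb0 hsn hη0 hM0.le hy0 ?_
      (sqrt_div_le hn hb0 hlarge hK)
    calc |β n 0| * η ≤ K * b * η := by gcongr
      _ = _ := by ring

theorem PowerIterSetting.intervalsValid {Ω : Type*} [MeasurableSpace Ω] {P : Measure Ω}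
    [IsProbabilityMeasure P] {p r : ℕ} [NeZero r] {κ ε : ℝ} {β : ℕ → Fin r → ℝ}
    {v : (n : ℕ) → Fin r → EuclideanSpace ℝ (Fin n)} {Z : (n : ℕ) → Ω → Tensor n (p + 2)}
    {u : (n : ℕ) → Ω → EuclideanSpace ℝ (Fin n)} {T : ℕ → ℕ} {i : Fin r}
    {S : (n : ℕ) → Set (EuclideanSpace ℝ (Fin n))} {sT : ℕ → ℝ} {α z C : ℝ}
    (h : PowerIterSetting P κ ε β v Z u T i S sT) (hα : α < 1)
    (hz : cdf (gaussianReal 0 1) z = 1 - α / 2)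
    {vhat : (n : ℕ) → Ω → EuclideanSpace ℝ (Fin n)} {bhat : ℕ → Ω → ℝ}
    (hvhat : ∀ n ω, vhat n ω = powerIter (observation (β n) (v n) (Z n ω)) (u n ω) (T n))
    (hbhat : ∀ n ω, bhat n ω = strengthEst (observation (β n) (v n) (Z n ω)) (vhat n ω))
    {G : ℕ → Set Ω} (hG : ∀ n, G n = {ω | u n ω ∈ S n}) {q b : ℕ → ℝ}
    {w : (n : ℕ) → EuclideanSpace ℝ (Fin n)} (hq : ∀ᶠ n in atTop, |P.real (G n) - q n| ≤ C / √κ)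
    (hb : ∀ n, b n = sT n ^ (p + 2) * β n i) (hw : ∀ n, w n = sT n • v n i) :
    IntervalsValid P (p + 2) C κ α z vhat bhat (fun n => |β n 0|) G q b w := by
  obtain ⟨hz0, hz1⟩ := gaussianReal_quantile hα hz
  obtain rfl : G = fun n => {ω | u n ω ∈ S n} := funext hG
  obtain rfl : b = fun n => sT n ^ (p + 2) * β n i := funext hb
  obtain rfl : w = fun n => sT n • v n i := funext hw
  obtain rfl : vhat = fun n ω => powerIter (observation (β n) (v n) (Z n ω)) (u n ω) (T n) :=
    funext fun n => funext fun ω => hvhat n ω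
  obtain rfl : bhat = fun n ω => strengthEst (observation (β n) (v n) (Z n ω))
      (powerIter (observation (β n) (v n) (Z n ω)) (u n ω) (T n)) :=
    funext fun n => funext fun ω => hbhat n ω
  refine ⟨hq, h.asympCovers_strength hz0 hz1, fun a ha hy => h.asympCovers_linear hz0 hz1 a ha ?_⟩
  refine hy.congr fun n => ?_
  rw [← rej_smul_left (h.sign_sq n) (v n i) (a n)]
  rfl

/-- For odd order, the sign of the iterates is that of `β`, after one step. -/
theorem exists_sign_of_odd {p T : ℕ} (hp : Odd (p + 2)) {b c ς : ℝ} (hς : ς ^ 2 = 1) (hb : 0 < ς * b)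
    (hc : c ≠ 0) (hT : 1 ≤ T) : ∃ s : ℕ → ℝ, (∀ t, s t ^ 2 = 1) ∧ 0 < s 0 * c ∧
      (∀ t, 0 < s (t + 1) * (b * s t ^ (p + 1))) ∧ s T = ς := by
  obtain ⟨m, hm⟩ : Even (p + 1) := by
    rcases hp with ⟨m, hm⟩
    exact ⟨m, by omega⟩
  obtain ⟨s₀, hs₀, hs₀c⟩ : ∃ s₀ : ℝ, s₀ ^ 2 = 1 ∧ 0 < s₀ * c := by
    rcases lt_or_gt_of_ne hc with h | h
    · exact ⟨-1, by norm_num, by linarith⟩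
    · exact ⟨1, by norm_num, by linarith⟩
  have hsq : ∀ t, (if t = 0 then s₀ else ς) ^ 2 = 1 := fun t => by split_ifs <;> assumption
  refine ⟨fun t => if t = 0 then s₀ else ς, hsq, by simpa using hs₀c, fun t => ?_, ?_⟩
  · have h1 : (if t = 0 then s₀ else ς) ^ (p + 1) = 1 := by
      rw [hm, ← two_mul, pow_mul, hsq, one_pow]
    simp only [h1, Nat.add_eq_zero_iff, one_ne_zero, and_false, if_false, mul_one]
    exact hb
  · simp [Nat.one_le_iff_ne_zero.1 hT]

/-- For even order, the sign of the iterates is constant if `β > 0` and alternates if `β < 0`. -/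
theorem exists_sign_of_even {p : ℕ} (hp : Even (p + 2)) {b c σ ς : ℝ} (hς : ς ^ 2 = 1)
    (hb : 0 < ς * b) (hσ : σ ^ 2 = 1) (hc : 0 < σ * c) (T : ℕ) : ∃ s : ℕ → ℝ,
      (∀ t, s t ^ 2 = 1) ∧ 0 < s 0 * c ∧ (∀ t, 0 < s (t + 1) * (b * s t ^ (p + 1))) ∧
      s T = ς ^ T * σ := by
  have hsq : ∀ t, (ς ^ t * σ) ^ 2 = 1 := fun t => by
    rw [mul_pow, hσ, mul_one, ← pow_mul, mul_comm, pow_mul, hς, one_pow]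
  refine ⟨fun t => ς ^ t * σ, hsq, by simpa using hc, fun t => ?_, rfl⟩
  obtain ⟨m, hm⟩ := hp
  have h1 : ς ^ (t + 1) * σ * (b * (ς ^ t * σ) ^ (p + 1)) = ς * b * (ς ^ t * σ) ^ (p + 2) := by
    ring
  rw [h1, hm, ← two_mul, pow_mul, hsq, one_pow, mul_one]
  exact hb

end SpikedTensor

end

/-! ### The four cases of parity and sign -/

theorem corollary2p9 (k r : ℕ) [NeZero k] [NeZero r] (hk : 3 ≤ k) :
    ∃ C : ℝ, 0 < C ∧ ∀ (κ ε α z : ℝ), 1 ≤ κ → 0 < ε → 0 < α → α < 1 →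
      -- `z` is the `(1 - α/2)`-quantile of the standard Gaussian
      cdf (gaussianReal 0 1) z = 1 - α / 2 →
      ∀ {Ω : Type*} [MeasurableSpace Ω] (P : Measure Ω) [IsProbabilityMeasure P]
        (β : ℕ → Fin r → ℝ) (v : (n : ℕ) → Fin r → EuclideanSpace ℝ (Fin n))
        (Z : (n : ℕ) → Ω → Tensor n k) (u : (n : ℕ) → Ω → EuclideanSpace ℝ (Fin n))
        (T : ℕ → ℕ) (vhat : (n : ℕ) → Ω → EuclideanSpace ℝ (Fin n)) (bhat : ℕ → Ω → ℝ)
        (i : Fin r) (G : ℕ → Set Ω),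
      (∀ᶠ n in atTop, Orthonormal ℝ (v n)) →
      (∀ᶠ n in atTop, ∀ j, β n j ≠ 0 ∧ |β n j| ≤ |β n 0|) →
      (∀ᶠ n : ℕ in atTop, (n : ℝ) ^ (((k : ℝ) - 2) / 2 + ε) ≤ |β n 0|) →
      (∀ᶠ n in atTop, IsNoiseAndInit P (Z n) (u n)) →
      (∀ᶠ n : ℕ in atTop,
        1 + 1 / ε * (1 / 2 + 2 * Real.log |β n 0| / Real.log n) +
          Real.log (Real.log (√n * |β n 0|)) / Real.log ((k : ℝ) - 1) ≤ T n) →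
      (∀ᶠ n : ℕ in atTop,
        3 + (Real.log κ + Real.log (Real.log (√n * |β n 0|))) / Real.log ((k : ℝ) - 1) ≤ T n) →
      -- the estimators, and the event that the initialization selects `i`
      (∀ n ω, vhat n ω = powerIter (observation (β n) (v n) (Z n ω)) (u n ω) (T n)) →
      (∀ n ω, bhat n ω = strengthEst (observation (β n) (v n) (Z n ω)) (vhat n ω)) →
      (∀ n, G n = {ω | Selects k κ (β n) (v n) i (u n ω)}) →
      (Odd k → (∀ᶠ n in atTop, 0 < β n i) →
        IntervalsValid P k C κ α z vhat bhat (fun n => |β n 0|) G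
          (fun n => mixtureWeight k (β n) i) (fun n => β n i) (fun n => v n i)) ∧
      (Odd k → (∀ᶠ n in atTop, β n i < 0) →
        IntervalsValid P k C κ α z vhat bhat (fun n => |β n 0|) G
          (fun n => mixtureWeight k (β n) i) (fun n => -β n i) (fun n => -v n i)) ∧
      (Even k → (∀ᶠ n in atTop, 0 < β n i) → ∀ σ : ℝ, σ = 1 ∨ σ = -1 →
        IntervalsValid P k C κ α z vhat bhat (fun n => |β n 0|)
          (fun n => G n ∩ {ω | 0 < σ * ⟪u n ω, v n i⟫})
          (fun n => mixtureWeight k (β n) i / 2) (fun n => β n i) (fun n => σ • v n i)) ∧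
      (Even k → (∀ᶠ n in atTop, β n i < 0) → ∀ σ : ℝ, σ = 1 ∨ σ = -1 →
        IntervalsValid P k C κ α z vhat bhat (fun n => |β n 0|)
          (fun n => G n ∩ {ω | 0 < σ * ⟪u n ω, v n i⟫})
          (fun n => mixtureWeight k (β n) i / 2) (fun n => β n i)
          (fun n => ((-1) ^ T n * σ) • v n i)) := by
  obtain ⟨p, rfl⟩ : ∃ p, k = p + 2 := ⟨k - 2, by omega⟩
  have hp : 1 ≤ p := by omega
  have hr : (0 : ℝ) < r := by exact_mod_cast NeZero.pos r
  -- The constant comes from the selection probability alone: at most `10 / √κ` for each of the `r`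
  -- overlaps.
  refine ⟨10 * r, by positivity, ?_⟩
  intro κ ε α z hκ hε _ hα hz Ω _ P _ β v Z u T vhat bhat i G hv hβ hlarge hZ _ hT hvhat hbhat hG
  have hGm : ∀ n, MeasurableSet {x | Selects (p + 2) κ (β n) (v n) i x} := fun n =>
    measurableSet_selects _ _ _ _ _
  have hσm : ∀ (σ : ℝ) n, MeasurableSet {x | 0 < σ * ⟪x, v n i⟫} := fun σ n =>
    measurableSet_lt (by fun_prop) (by fun_prop)
  have hσsq : ∀ {σ : ℝ}, σ = 1 ∨ σ = -1 → σ ^ 2 = 1 := by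
    rintro σ (rfl | rfl) <;> norm_num
  have setting : ∀ (S : (n : ℕ) → Set (EuclideanSpace ℝ (Fin n))) (sT : ℕ → ℝ),
      (∀ n, MeasurableSet (S n)) → (∀ n, ∀ x ∈ S n, Selects (p + 2) κ (β n) (v n) i x) →
      (∀ n, sT n ^ 2 = 1) →
      (∀ᶠ n in atTop, 1 ≤ T n → ∀ x ∈ S n, ∃ s : ℕ → ℝ, (∀ t, s t ^ 2 = 1) ∧
        0 < s 0 * ⟪x, v n i⟫ ∧ (∀ t, 0 < s (t + 1) * (β n i * s t ^ (p + 1))) ∧ s (T n) = sT n) →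
      PowerIterSetting P κ ε β v Z u T i S sT := by
    intro S sT hSm hSsel hsq hsign
    refine ⟨hp, hκ, hε, hv, hβ, ?_, hZ, ?_, hSm, hSsel, hsq, hsign⟩
    · filter_upwards [hlarge] with n hn
      push_cast at hn
      rwa [add_sub_cancel_right] at hn
    · filter_upwards [hT] with n hn
      have hcast : ((p + 2 : ℕ) : ℝ) - 1 = p + 1 := by
        push_cast
        ring
      rwa [hcast] at hn
  have hprob : ∀ᶠ n in atTop, |P.real (G n) - mixtureWeight (p + 2) (β n) i| ≤ 10 * r / √κ := by
    filter_upwards [hv, hβ, hZ, eventually_ge_atTop 1] with n hv hβ hZ hn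
    rw [hG]
    exact hZ.abs_measureReal_selects_sub_le hn hk hκ (fun j => (hβ j).1) hv i
  have hprobσ : ∀ σ : ℝ, σ = 1 ∨ σ = -1 → ∀ᶠ n in atTop,
      |P.real (G n ∩ {ω | 0 < σ * ⟪u n ω, v n i⟫}) - mixtureWeight (p + 2) (β n) i / 2| ≤
        10 * r / √κ := by
    intro σ hσ
    filter_upwards [hv, hβ, hZ, eventually_ge_atTop 1] with n hv hβ hZ hn
    rw [hG]
    exact hZ.abs_measureReal_selects_sign_sub_le hn hk hκ (fun j => (hβ j).1) hv i hσ
  have odd : ∀ ς : ℝ, ς = 1 ∨ ς = -1 → Odd (p + 2) → (∀ᶠ n in atTop, 0 < ς * β n i) →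
      PowerIterSetting P κ ε β v Z u T i (fun n => {x | Selects (p + 2) κ (β n) (v n) i x})
        fun _ => ς := by
    intro ς hς hodd hsign
    refine setting _ _ hGm (fun n x hx => hx) (fun _ => hσsq hς) ?_
    filter_upwards [hsign] with n hn hT1 x hx
    exact exists_sign_of_odd hodd (hσsq hς) hn (Selects.ne_zero hκ hx i) hT1
  -- For even order the sign of the initial overlap persists, so it has to be part of the event.
  -- Each step multiplies it by the sign `ς` of the selected strength.
  have even : ∀ ς : ℝ, ς = 1 ∨ ς = -1 → Even (p + 2) → (∀ᶠ n in atTop, 0 < ς * β n i) →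
      ∀ σ : ℝ, σ = 1 ∨ σ = -1 → PowerIterSetting P κ ε β v Z u T i
        (fun n => {x | Selects (p + 2) κ (β n) (v n) i x} ∩ {x | 0 < σ * ⟪x, v n i⟫})
        fun n => ς ^ T n * σ := by
    intro ς hς heven hsign σ hσ
    refine setting _ _ (fun n => (hGm n).inter (hσm σ n)) (fun n x hx => hx.1) (fun n => ?_) ?_
    · rw [mul_pow, hσsq hσ, mul_one, ← pow_mul, mul_comm, pow_mul, hσsq hς, one_pow]
    · filter_upwards [hsign] with n hn _ x hx
      exact exists_sign_of_even heven (hσsq hς) hn (hσsq hσ) hx.2 (T n)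
  have hGσ : ∀ (σ : ℝ) n, G n ∩ {ω | 0 < σ * ⟪u n ω, v n i⟫} =
      {ω | u n ω ∈ {x | Selects (p + 2) κ (β n) (v n) i x} ∩ {x | 0 < σ * ⟪x, v n i⟫}} := by
    intro σ n
    rw [hG]
    rfl
  refine ⟨fun hodd hsign => ?_, fun hodd hsign => ?_, fun heven hsign σ hσ => ?_,
    fun heven hsign σ hσ => ?_⟩
  · exact (odd 1 (Or.inl rfl) hodd (by simpa using hsign)).intervalsValid hα hz hvhat hbhat hG hprob
      (fun n => by simp) fun n => by simp
  · exact (odd (-1) (Or.inr rfl) hodd (by simpa using hsign)).intervalsValid hα hz hvhat hbhat hG hprob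
      (fun n => by rw [hodd.neg_one_pow, neg_one_mul]) fun n => by simp
  · exact (even 1 (Or.inl rfl) heven (by simpa using hsign) σ hσ).intervalsValid hα hz hvhat hbhat
      (hGσ σ) (hprobσ σ hσ) (fun n => by
        obtain ⟨m, hm⟩ := heven
        rw [one_pow, one_mul, hm, ← two_mul, pow_mul, hσsq hσ, one_pow, one_mul]) fun n => by simp
  · exact (even (-1) (Or.inr rfl) heven (by simpa using hsign) σ hσ).intervalsValid hα hz hvhat hbhat
      (hGσ σ) (hprobσ σ hσ) (fun n => by
        obtain ⟨m, hm⟩ := heven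
        rw [hm, ← two_mul, pow_mul, mul_pow, hσsq hσ, mul_one,
          pow_right_comm (-1 : ℝ) (T n) 2, neg_one_sq, one_pow, one_pow, one_mul]) fun n => rfl
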